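/- Let $d\ge 1$, $L>0$, $1\le\alpha\le 2$, $X=[-L/2,L/2)^d$. Let $G:\mathbb R^d\to\mathbb R$ be continuous and even, such that for pairwise distinct $x_1,\dots,x_n\in X$ the matrix $(G(x_a-x_b))_{ab}$ is positive definite (for all $n$); let $\mu$ be the centred Gaussian measure on $L^2(X)$ whose covariance operator has kernel $G(x-y)$. Let $g:\mathbb R^d\to\mathbb R$ be bounded and measurable, $j\in L^2(X)$, and $\bar\phi(x)=\int_X G(x-y)j(y)\,dy$. Put $$Z_t=\int \exp\Big(-t\int_X g|\phi|^\alpha dx-\int_X j\phi\,dx\Big)\,d\mu(\phi),\qquad \mathcal G_I(t)=\ln (Z_t/Z_0),$$ and let $\mathcal G_{I,n}[j]=\frac1{n!}\mathcal G_I^{(n)}(0)$ be the term of order $n\ge 1$ in the coupling. For a connected simple graph $\Gamma$ on $\{1,\dots,n\}$ with adjacency matrix $\nu_{ab}(\Gamma)$ and for variables $s_{ab}=s_{ba}$ let $\tilde G_{aa}=G(0)$ and $\tilde G_{ab}=s_{ab}\nu_{ab}(\Gamma)G(x_a-x_b)$ for $a\ne b$. For a symmetric matrix $A$ with diagonal $G(0)$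 and $m\in\mathbb R^n$ put $Q_A(\phi)=\frac12\sum_{a,b}A^{-1}_{ab}\phi_a\phi_b$, $\chi=A^{-1}m$, and $$\begin{aligned}S_N(A,m)=e^{-Q_A(m)}&\sum_{k=0}^\infty\frac{(2G(0))^{n\alpha/2}}{4^kk!}\frac{\left(\frac{n(\alpha+1)}2\right)_k}{\left(\frac12\right)_k}\sum_{\nu_1+\dots+\nu_n=2k}\binom{2k}{\nu_1,\dots,\nu_n}\chi_1^{\nu_1}\cdots\chi_n^{\nu_n}\\&\times\sum_{q=0}^{N}\sum_{i=0}^q\Big(2q+\frac12\Big)2^{4q-ni+1}\,G(0)^k\,\frac{\Gamma\left(\frac{n(\alpha+1)}2\right)}{\Gamma\left(\frac n2+ni+k\right)}\Big(\sum_{p=0}^q\binom{2q}{2p}\binom{q+p-\frac12}{2q}\frac1{2p+\alpha+1}\Big)\binom{2q}{2i}\binom{q+i-\frac12}{2q}\\&\times\sum_{l}\ \prod_{a<b}\Big[\frac{A_{ab}}{G(0)}\Big]^{l_{ab}}\ \frac{\prod_a(2i+\nu_a)!}{\prod_{a<b}l_{ab}!\;2^{\sum_a l_{aa}/2}\prod_a(l_{aa}/2)!},\end{aligned}$$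 where $l$ runs over the symmetric arrays of integers $l_{ab}\ge0$ with $\sum_b l_{ab}=2i+\nu_a$ and all $l_{aa}$ even, and $(z)_k$ is the rising factorial; $S_\infty(A,m)$ is the same with $\sum_{q=0}^\infty$. For a function $F$ of $(A,m)$ put $$\mathbb S[F]=\frac{(-1)^n}{n!}\sum_{\Gamma}\Big\{\prod_{a<b}\int_0^1ds_{ab}\,\partial_{s_{ab}}^{\nu_{ab}(\Gamma)}\Big\}\Big\{\prod_{a=1}^n\int_Xdx_a\,g(x_a)\Big\}F\big(\tilde G,(\bar\phi(x_a))_a\big),$$ the sum being over the connected graphs $\Gamma$. Here, for an edge $ab$ of $\Gamma$, $\int_0^1ds_{ab}\,\partial_{s_{ab}}$ denotes the difference of the values at $s_{ab}=1$ and $s_{ab}=0$. Where $\tilde G$ is not positive definite, or a sum or integral in $F$ or over $x$ does not converge, any fixed value, determined by the matrix-valued function $x\mapsto\tilde G$ (resp. by the matrix $\tilde G$ and $m$) alone, is assigned; such values cancel in the sum over $\Gamma$, except on a null set of $x$. Let $\langle f\rangle_{A,m}$ be the average of $f$ over the Gaussian density on $\mathbb R^n$ with mean $m$ and covariance matrix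 $A$. Let $P_{2q}$ be the Legendre polynomials, $h_N(t)=\sum_{q\le N}c_{2q}P_{2q}(t)$ with $c_{2q}=\frac{4q+1}2\int_{-1}^1|t|^\alpha P_{2q}(t)\,dt$, and $$f_{N,A}(\phi)=(2G(0)Q_A(\phi))^{n\alpha/2}\,h_N\!\left(\frac{\prod_a|\phi_a|}{(2G(0)Q_A(\phi))^{n/2}}\right),$$ that is, $\prod_a|\phi_a|^\alpha$ with the factor $|t|^\alpha$ on the hypersphere replaced by $h_N(t)$. Let $\mathcal G_{I,n}[j]_N=\mathbb S[F_N]$ with $F_N(A,m)=\langle f_{N,A}\rangle_{A,m}$. Then: 1. For all $x_1,\dots,x_n\in\mathbb R^d$, graphs $\Gamma$ and $s$ such that $A=\tilde G$ is positive definite, and for all $m\in\mathbb R^n$ and $N$, the sums over $k$ and over $q$ in $S_N(A,m)$ and $S_\infty(A,m)$ converge (the sum over $q$ for each $k,\nu$), and $$\Big\langle\prod_a|\phi_a|^\alpha\Big\rangle_{A,m}=S_\infty(A,m),\qquad \langle f_{N,A}\rangle_{A,m}=S_N(A,m).$$ 2. If, for given $x$ and $\Gamma$, $\tilde G$ is positive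 definite for all $s_{ab}\in[0,1]$, then for fixed $m$ the operator $\prod_{a<b}\int_0^1ds_{ab}\,\partial_{s_{ab}}^{\nu_{ab}(\Gamma)}$, read literally as iterated integrals of partial derivatives, gives on $S_\infty(\tilde G,m)$ and on every $S_N(\tilde G,m)$ the same value as with differences. 3. $\mathcal G_I$ is real-analytic at $0$, and $$\mathcal G_{I,n}[j]=\mathbb S[S_\infty],\qquad \mathcal G_{I,n}[j]_N=\mathbb S[S_N]\quad(N=0,1,2,\dots),$$ where the integrands, after summation over $\Gamma$ under the integral over $x\in X^n$, are absolutely integrable. -/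

import Mathlib

open MeasureTheory Matrix Polynomial

noncomputable section

namespace LegendreQFT

/-! ### The fractional scalar field in a box -/

/-- Points of the `d`-dimensional space. -/
abbrev Point (d : ℕ) := Fin d → ℝ

/-- The `d`-dimensional cube with edge `L` centred at the origin (half-open, so that for periodic
functions it is a fundamental domain of the period lattice). -/
def box (d : ℕ) (L : ℝ) : Set (Point d) :=
  Set.univ.pi fun _ => Set.Ico (-(L / 2)) (L / 2)

/-- Configurations of `n` points of the box. -/
def configs (d n : ℕ) (L : ℝ) : Set (Fin n → Point d) :=
  Set.univ.pi fun _ => box d L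

/-- The Hilbert space `L²(box)` of fields and sources. -/
abbrev FieldSpace (d : ℕ) (L : ℝ) := Lp ℝ 2 ((volume : Measure (Point d)).restrict (box d L))

instance (d : ℕ) (L : ℝ) : MeasurableSpace (FieldSpace d L) := borel _

instance (d : ℕ) (L : ℝ) : BorelSpace (FieldSpace d L) := ⟨rfl⟩

/-- An ultraviolet finite, translation invariant, strictly positive propagator `G(x - y)`: for
pairwise distinct points of the box the matrix `G(x_a - x_b)` is positive definite. -/
structure IsPropagator {d : ℕ} (L : ℝ) (G : Point d → ℝ) : Prop where
  continuous : Continuous G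
  even : ∀ x, G (-x) = G x
  posDef : ∀ (n : ℕ) (x : Fin n → Point d), x ∈ configs d n L → Function.Injective x →
    (Matrix.of fun a b => G (x a - x b)).PosDef

/-- `μ` is the centred Gaussian measure on `L²(box)` whose covariance operator has the kernel
`G(x - y)` (stated through the characteristic functional). -/
def IsGaussianField {d : ℕ} {L : ℝ} (G : Point d → ℝ) (μ : Measure (FieldSpace d L)) : Prop :=
  ∀ f : FieldSpace d L, charFun μ f =
    Complex.exp (-((1 / 2 * ∫ x in box d L, ∫ y in box d L, f x * G (x - y) * f y : ℝ) : ℂ))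

/-- The generating functional `Z[j]` with interaction `t · ∫ g(x) |φ(x)|^α dx`. -/
def generatingFunctional {d : ℕ} {L : ℝ} (μ : Measure (FieldSpace d L)) (α : ℝ)
    (g : Point d → ℝ) (j : FieldSpace d L) (t : ℝ) : ℝ :=
  ∫ φ : FieldSpace d L, Real.exp (-(t * ∫ x in box d L, g x * |φ x| ^ α)
    - ∫ x in box d L, j x * φ x) ∂μ

/-- `𝒢_I[j] = ln (Z[j] / Z₀[j])` as a function of the factor `t` in front of the coupling; `Z₀` is
the generating functional of the Gaussian theory (coupling zero). -/
def connectedFunctional {d : ℕ} {L : ℝ} (μ : Measure (FieldSpace d L)) (α : ℝ)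
    (g : Point d → ℝ) (j : FieldSpace d L) (t : ℝ) : ℝ :=
  Real.log (generatingFunctional μ α g j t / generatingFunctional μ α g j 0)

/-- `𝒢_{I,n}[j]`: the term of order `n` in the coupling of `𝒢_I[j]`. -/
def connectedTerm {d : ℕ} {L : ℝ} (μ : Measure (FieldSpace d L)) (α : ℝ)
    (g : Point d → ℝ) (j : FieldSpace d L) (n : ℕ) : ℝ :=
  iteratedDeriv n (connectedFunctional μ α g j) 0 / n.factorial

/-- The classical field `φ̄(x) = ∫ G(x - y) j(y) dy` of the source `j`. -/
def classicalField {d : ℕ} {L : ℝ} (G : Point d → ℝ) (j : FieldSpace d L) (x : Point d) : ℝ :=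
  ∫ y in box d L, G (x - y) * j y

/-! ### Connected graphs and the operator in the variables `s_ab` -/

/-- The auxiliary variables `s_ab = s_ba`. -/
abbrev SVars (n : ℕ) := Sym2 (Fin n) → ℝ

open Classical in
/-- The matrix `G̃`: `G(0)` on the diagonal and `s_ab ν_ab(Γ) G(x_a - x_b)` off the diagonal, where
`ν(Γ)` is the adjacency matrix of `Γ`. -/
def gTilde {d n : ℕ} (G : Point d → ℝ) (x : Fin n → Point d) (Γ : SimpleGraph (Fin n))
    (s : SVars n) : Matrix (Fin n) (Fin n) ℝ :=
  Matrix.of fun a b => if a = b then G 0 else s s(a, b) * Γ.adjMatrix ℝ a b * G (x a - x b)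

open Classical in
/-- The connected simple graphs on `n` labelled vertices. -/
def connectedGraphs (n : ℕ) : Finset (SimpleGraph (Fin n)) :=
  Finset.univ.filter fun Γ => Γ.Connected

open Classical in
/-- The unordered pairs of distinct vertices. -/
def vertexPairs (n : ℕ) : Finset (Sym2 (Fin n)) :=
  Finset.univ.filter fun e => ¬ e.IsDiag

open Classical in
/-- `∫₀¹ ds_e ∂_{s_e}^{ν_e(Γ)}`, read literally. -/
def literalStep {n : ℕ} (Γ : SimpleGraph (Fin n)) (e : Sym2 (Fin n)) (F : SVars n → ℝ) :
    SVars n → ℝ :=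
  fun s => ∫ σ in (0 : ℝ)..1,
    iteratedDeriv (if e ∈ Γ.edgeSet then 1 else 0) (fun τ => F (Function.update s e τ)) σ

open Classical in
/-- `∫₀¹ ds_e ∂_{s_e}^{ν_e(Γ)}`, where for an edge `e` of `Γ` the integral of the derivative stands
for the difference of the values at `1` and `0`. It is the literal operator whenever the latter
makes sense, see `literalStep_eq_pairStep`, and it needs the values at `s_e = 0, 1` only. -/
def pairStep {n : ℕ} (Γ : SimpleGraph (Fin n)) (e : Sym2 (Fin n)) (F : SVars n → ℝ) :
    SVars n → ℝ :=
  fun s => if e ∈ Γ.edgeSet then F (Function.update s e 1) - F (Function.update s e 0)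
    else ∫ σ in (0 : ℝ)..1, F (Function.update s e σ)

theorem literalStep_eq_pairStep {n : ℕ} (Γ : SimpleGraph (Fin n)) (e : Sym2 (Fin n))
    (F : SVars n → ℝ) (s : SVars n)
    (hd : ∀ σ ∈ Set.uIcc (0 : ℝ) 1, DifferentiableAt ℝ (fun τ => F (Function.update s e τ)) σ)
    (hi : IntervalIntegrable (deriv fun τ => F (Function.update s e τ)) volume 0 1) :
    literalStep Γ e F s = pairStep Γ e F s := by
  unfold literalStep pairStep
  split_ifs
  · simp only [iteratedDeriv_one]
    exact intervalIntegral.integral_deriv_eq_sub hd hi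
  · simp only [iteratedDeriv_zero]

/-- `∏_{a<b} ∫₀¹ ds_ab ∂_{s_ab}^{ν_ab(Γ)}`, read literally, one pair after the other. All variables
`s_ab` with `a ≠ b` are eliminated, so that the value at `0` is the value of the result. -/
def literalOp {n : ℕ} (Γ : SimpleGraph (Fin n)) (F : SVars n → ℝ) : ℝ :=
  (vertexPairs n).toList.foldr (literalStep Γ) F 0

/-- `∏_{a<b} ∫₀¹ ds_ab ∂_{s_ab}^{ν_ab(Γ)}`, with differences in place of integrals of derivatives. -/
def graphOp {n : ℕ} (Γ : SimpleGraph (Fin n)) (F : SVars n → ℝ) : ℝ :=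
  (vertexPairs n).toList.foldr (pairStep Γ) F 0

/-- `((-1)ⁿ / n!) ∑_Γ {∏_{a<b} ∫₀¹ ds_ab ∂_{s_ab}^{ν_ab}} {∏_a ∫ dx_a g(x_a)} F(G̃, φ̄(x))`, the sum
being over the connected graphs. -/
def graphSum {d n : ℕ} {L : ℝ} (G : Point d → ℝ) (g : Point d → ℝ) (j : FieldSpace d L)
    (F : Matrix (Fin n) (Fin n) ℝ → (Fin n → ℝ) → ℝ) : ℝ :=
  (-1) ^ n / n.factorial * ∑ Γ ∈ connectedGraphs n, graphOp Γ fun s =>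
    ∫ x in configs d n L, (∏ a, g (x a)) *
      F (gTilde G x Γ s) (fun a => classicalField G j (x a))

/-- The integrand that remains when the sum over graphs is taken under the coordinate integral. -/
def graphIntegrand {d n : ℕ} {L : ℝ} (G : Point d → ℝ) (g : Point d → ℝ) (j : FieldSpace d L)
    (F : Matrix (Fin n) (Fin n) ℝ → (Fin n → ℝ) → ℝ) (x : Fin n → Point d) : ℝ :=
  (∏ a, g (x a)) * ∑ Γ ∈ connectedGraphs n, graphOp Γ fun s =>
    F (gTilde G x Γ s) (fun a => classicalField G j (x a))

/-! ### Gaussian averages and Legendre approximation on the hypersphere -/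

/-- `Q(φ, φ) = ½ ∑_{a,b} (A⁻¹)_{ab} φ_a φ_b`. -/
def quad {n : ℕ} (A : Matrix (Fin n) (Fin n) ℝ) (φ : Fin n → ℝ) : ℝ :=
  1 / 2 * ∑ a, ∑ b, A⁻¹ a b * φ a * φ b

/-- The average of `f` over the Gaussian density with mean `m` and covariance matrix `A`. -/
def gaussianAverage {n : ℕ} (A : Matrix (Fin n) (Fin n) ℝ) (m : Fin n → ℝ)
    (f : (Fin n → ℝ) → ℝ) : ℝ :=
  1 / Real.sqrt ((2 * Real.pi) ^ n * A.det) * ∫ φ : Fin n → ℝ, f φ * Real.exp (-quad A (φ - m))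

/-- The Legendre polynomial `P_n`, by Rodrigues' formula. -/
def legendrePoly (n : ℕ) : ℝ[X] :=
  C (1 / (2 ^ n * (n.factorial : ℝ))) * derivative^[n] ((X ^ 2 - 1) ^ n)

/-- The coefficient `c_{2q}` of `|t|^α` in its Legendre expansion on `[-1, 1]`. -/
def legendreCoeff (α : ℝ) (q : ℕ) : ℝ :=
  (2 * (2 * q : ℝ) + 1) / 2 * ∫ t in (-1 : ℝ)..1, |t| ^ α * (legendrePoly (2 * q)).eval t

/-- The even Legendre polynomial approximation `h_N(t) = ∑_{q ≤ N} c_{2q} P_{2q}(t)` of `|t|^α`. -/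
def legendreApprox (α : ℝ) (N : ℕ) (t : ℝ) : ℝ :=
  ∑ q ∈ Finset.range (N + 1), legendreCoeff α q * (legendrePoly (2 * q)).eval t

/-- The interaction factor `∏_a |φ_a|^α` with its restriction to the hypersphere approximated:
`∏_a |φ_a|^α = (2 c Q)^{nα/2} |t|^α` with `t = ∏_a |φ_a| / (2 c Q)^{n/2} ∈ [0, 1]` depending on the
direction of `φ` only, and `|t|^α` is replaced by `h_N(t)`. -/
def approxInteraction {n : ℕ} (c α : ℝ) (N : ℕ) (A : Matrix (Fin n) (Fin n) ℝ)
    (φ : Fin n → ℝ) : ℝ :=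
  (2 * c * quad A φ) ^ (n * α / 2 : ℝ) *
    legendreApprox α N ((∏ a, |φ a|) / (2 * c * quad A φ) ^ (n / 2 : ℝ))

/-- The polynomial approximation `𝒢_{I,n}[j]_N`. -/
def connectedTermApprox {d : ℕ} {L : ℝ} (G : Point d → ℝ) (α : ℝ) (g : Point d → ℝ)
    (j : FieldSpace d L) (n N : ℕ) : ℝ :=
  graphSum G g j fun A : Matrix (Fin n) (Fin n) ℝ => fun m =>
    gaussianAverage A m (approxInteraction (G 0) α N A)

/-! ### The explicit series -/

/-- The symmetric arrays of line numbers `l_ab ≥ 0` with `∑_b l_ab = β_a` and `l_aa` even. -/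
def lineNumbers {n : ℕ} (β : Fin n → ℕ) : Finset (Fin n → Fin n → ℕ) :=
  (Fintype.piFinset fun a => Fintype.piFinset fun _ => Finset.range (β a + 1)).filter fun l =>
    (∀ a b, l a b = l b a) ∧ (∀ a, ∑ b, l a b = β a) ∧ ∀ a, Even (l a a)

/-- The sum over line numbers of
`∏_{a<b} (A_ab / c)^{l_ab} · ∏_a β_a! / (∏_{a<b} l_ab! · 2^{∑_a l_aa/2} · ∏_a (l_aa/2)!)`. -/
def lineSum {n : ℕ} (c : ℝ) (A : Matrix (Fin n) (Fin n) ℝ) (β : Fin n → ℕ) : ℝ :=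
  ∑ l ∈ lineNumbers β,
    (∏ p : Fin n × Fin n with p.1 < p.2, (A p.1 p.2 / c) ^ l p.1 p.2) *
      ((∏ a, ((β a).factorial : ℝ)) /
        ((∏ p : Fin n × Fin n with p.1 < p.2, ((l p.1 p.2).factorial : ℝ)) *
          2 ^ (∑ a, l a a / 2) * ∏ a, ((l a a / 2).factorial : ℝ)))

/-- The generalized binomial coefficient `(q + i - 1/2 choose 2q)`. -/
def halfBinom (q i : ℕ) : ℝ := Ring.choose ((q : ℝ) + i - 1 / 2) (2 * q)

/-- The `q`-th term for given `k` and `ν`, a finite sum over `i ≤ q`. -/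
def qTerm {n : ℕ} (c α : ℝ) (A : Matrix (Fin n) (Fin n) ℝ) (k : ℕ) (ν : Fin n → ℕ)
    (q : ℕ) : ℝ :=
  ∑ i ∈ Finset.range (q + 1),
    (2 * (q : ℝ) + 1 / 2) * (2 : ℝ) ^ (4 * (q : ℤ) - n * i + 1) * c ^ k *
      (Real.Gamma (n * (α + 1) / 2) / Real.Gamma (n / 2 + n * i + k)) *
      (∑ p ∈ Finset.range (q + 1),
        ((2 * q).choose (2 * p) : ℝ) * halfBinom q p * (1 / (2 * p + α + 1))) *
      ((2 * q).choose (2 * i) : ℝ) * halfBinom q i *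
      lineSum c A (fun a => 2 * i + ν a)

/-- The `k`-th term: `χ = A⁻¹ m`, the sum is over `ν₁ + ⋯ + ν_n = 2k`, and `inner k ν` is what the
sum over `q` gives. -/
def kTerm {n : ℕ} (c α : ℝ) (A : Matrix (Fin n) (Fin n) ℝ) (m : Fin n → ℝ)
    (inner : ℕ → (Fin n → ℕ) → ℝ) (k : ℕ) : ℝ :=
  (2 * c) ^ (n * α / 2 : ℝ) / (4 ^ k * k.factorial) *
    ((ascPochhammer ℝ k).eval (n * (α + 1) / 2 : ℝ) / (ascPochhammer ℝ k).eval (1 / 2 : ℝ)) *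
    ∑ ν ∈ Finset.piAntidiag Finset.univ (2 * k),
      (Nat.multinomial Finset.univ ν : ℝ) * (∏ a, (A⁻¹ *ᵥ m) a ^ ν a) * inner k ν

/-- The `q`-sum up to `q = N`. -/
def qPartialSum {n : ℕ} (c α : ℝ) (A : Matrix (Fin n) (Fin n) ℝ) (N k : ℕ) (ν : Fin n → ℕ) : ℝ :=
  ∑ q ∈ Finset.range (N + 1), qTerm c α A k ν q

/-- The full `q`-sum. -/
def qSum {n : ℕ} (c α : ℝ) (A : Matrix (Fin n) (Fin n) ℝ) (k : ℕ) (ν : Fin n → ℕ) : ℝ :=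
  ∑' q, qTerm c α A k ν q

/-- The explicit series, with the sum over `q` up to `N`. -/
def approxSeries {n : ℕ} (c α : ℝ) (N : ℕ) (A : Matrix (Fin n) (Fin n) ℝ) (m : Fin n → ℝ) : ℝ :=
  Real.exp (-quad A m) * ∑' k, kTerm c α A m (qPartialSum c α A N) k

/-- The explicit series. -/
def legendreSeries {n : ℕ} (c α : ℝ) (A : Matrix (Fin n) (Fin n) ℝ) (m : Fin n → ℝ) : ℝ :=
  Real.exp (-quad A m) * ∑' k, kTerm c α A m (qSum c α A) k

end LegendreQFT

end

open MeasureTheory LegendreQFT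

noncomputable section

namespace LegendreQFT

/-! ### Legendre polynomials of even degree -/

/-! Fix a positive definite `A` with all diagonal entries `c = G 0`. Cauchy-Schwarz for `A` gives
`φ_a² ≤ 2 c Q(φ)` (`sq_le_two_mul_quad`), so `t = ∏ |φ_a| / (2 c Q)^(n/2)` lies in `[0, 1]` and `∏
|φ_a|^α = (2 c Q)^(nα/2) t^α`. For `1 ≤ α ≤ 2` the even Legendre coefficients of `|t|^α` are
absolutely summable (`summable_abs_legendreCoeff`) and the series converges to `t^α` on `[0, 1]`
(`hasSum_legendreCoeff_mul`). Each Legendre term is a finite sum of monomials times real powers of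
`Q`. In polar coordinates the power of `Q` affects the radial integral only, so it contributes a
quotient of Gamma functions (`integral_mul_quad_rpow`), and Wick's theorem evaluates the remaining
monomial (`integral_prod_pow_eq_lineSum`). A mean `m` produces the factor `exp (χ ⬝ᵥ φ)`, whose even
part is expanded in powers (`hasSum_integral_gaussLaw`). Dominated convergence turns all this into
the explicit series (`legendreSeries_spec`, `approxSeries_spec`). Since the series are Gaussian
averages, they are continuously differentiable in each `s_ab` where `G̃` is positive definite, and
the literal operator agrees with differences by the fundamental theorem of calculus
(`literalOp_eq_graphOp_of_contDiffAt`).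

The sum over connected graphs is handled by a replica argument. With differences, the operator of
`Γ` is an alternating sum over edge subsets. Weighting every graph by `z ^ (number of components)`
gives a polynomial in `z` whose linear coefficient is the sum over connected graphs, and whose value
at `z = N` is, by Möbius inversion, a sum over colourings of the vertices with `N` colours. Hence
fixed interpolation weights express the connected sum through colourings (`sum_connected_graphOp`).
The matrices that survive, `blockMatrix`, are covariance matrices of `N` independent copies of the
field and are positive definite at distinct points, so values assigned at other matrices drop out.

On the field side, `connectedFunctional` is the cumulant generating function `K` of minus the
interaction under the measure tilted by the source. The `n`-th derivative of `exp (z K)` at `0` is a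
polynomial in `z` with linear coefficient `K^(n)(0)` (`exists_polynomial_iteratedDeriv_exp`), and
for `z = N` it is a moment of `N` independent copies, again a sum over colourings. The two sides are
matched term by term by `integral_prod_interaction`. This requires the joint law of field values at
almost all configurations, obtained from Lebesgue differentiation and characteristic functions
(`map_copyValues`). Integrability follows from Fernique's theorem for the exact interaction, and for
the approximations from a bound uniform in the covariance matrix combined with
`quad_classicalField_le`. -/

/-- The coefficient of `X ^ (2 i)` in the Legendre polynomial of degree `2 q`. -/
def legCoef (q i : ℕ) : ℝ :=
  (-1) ^ (q + i) * (2 * q + 2 * i).factorial /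
    (4 ^ q * (q + i).factorial * (q - i).factorial * (2 * i).factorial)

/-- In the binomial expansion of `(X ^ 2 - 1) ^ (2 q)` the terms with `j < q` have degree below `2
q` and are killed by the derivatives in Rodrigues' formula; the others are indexed by `j = q + i`.
-/
theorem legendrePoly_two_mul (q : ℕ) :
    legendrePoly (2 * q) = ∑ i ∈ Finset.range (q + 1), C (legCoef q i) * X ^ (2 * i) := by
  have h1 : ((X : ℝ[X]) ^ 2 - 1) ^ (2 * q) = ∑ j ∈ Finset.range (q + (q + 1)),
      C ((-1 : ℝ) ^ j * ((2 * q).choose j : ℝ)) * X ^ (2 * j) := by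
    rw [sub_eq_add_neg, add_pow, show 2 * q + 1 = q + (q + 1) by ring]
    refine Finset.sum_congr rfl fun j hj => ?_
    have hj' : j ≤ 2 * q := by simp at hj; lia
    have : ((-1 : ℝ[X])) ^ (2 * q - j) = (-1) ^ j := by
      obtain ⟨m, hm⟩ := Nat.exists_eq_add_of_le hj'
      have e : m + j = 2 * q := by lia
      have : ((-1 : ℝ[X])) ^ m * (-1) ^ j = 1 := by rw [← pow_add, e, pow_mul]; simp
      rw [hm, Nat.add_sub_cancel_left]
      have h2 : ((-1 : ℝ[X])) ^ j * (-1) ^ j = 1 := by rw [← mul_pow]; simp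
      calc ((-1 : ℝ[X])) ^ m = (-1) ^ m * ((-1) ^ j * (-1) ^ j) := by rw [h2, mul_one]
        _ = _ := by rw [← mul_assoc, this, one_mul]
    rw [this, ← pow_mul]
    simp
    ring
  unfold legendrePoly
  rw [h1, Finset.sum_range_add, iterate_map_add, iterate_derivative_sum,
    iterate_derivative_sum, Finset.sum_eq_zero, zero_add, Finset.mul_sum]
  · refine Finset.sum_congr rfl fun i hi => ?_
    have hi' : i ≤ q := by simp at hi; lia
    rw [iterate_derivative_C_mul, iterate_derivative_X_pow_eq_smul,
      show 2 * (q + i) - 2 * q = 2 * i by lia, ← C_mul', ← mul_assoc, ← mul_assoc, ← C_mul, ← C_mul]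
    congr 2
    have h3 : ((2 * (q + i)).descFactorial (2 * q) : ℝ) =
        (2 * q + 2 * i).factorial / (2 * i).factorial := by
      rw [eq_div_iff (by positivity)]
      have := Nat.factorial_mul_descFactorial (n := 2 * (q + i)) (k := 2 * q) (by lia)
      rw [show 2 * (q + i) - 2 * q = 2 * i by lia] at this
      rw [mul_comm, show 2 * q + 2 * i = 2 * (q + i) by ring]
      exact_mod_cast this
    have h4 : ((2 * q).choose (q + i) : ℝ) =
        (2 * q).factorial / ((q + i).factorial * (q - i).factorial) := by
      rw [Nat.cast_choose ℝ (by lia), show 2 * q - (q + i) = q - i by lia]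
    simp only [h3, h4, legCoef]
    rw [pow_mul]
    norm_num
    field_simp
  · intro j hj
    rw [iterate_derivative_C_mul, iterate_derivative_eq_zero, mul_zero]
    simp at hj ⊢
    lia

theorem prod_range_half (m : ℕ) :
    ∏ r ∈ Finset.range m, ((r : ℝ) + 1 / 2) = (2 * m).factorial / (4 ^ m * m.factorial) := by
  induction m with
  | zero => simp
  | succ m ih =>
    rw [Finset.prod_range_succ, ih, show 2 * (m + 1) = 2 * m + 1 + 1 by ring,
      Nat.factorial_succ (2 * m + 1), Nat.factorial_succ (2 * m), Nat.factorial_succ m]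
    push_cast
    field_simp
    ring

/-- Of the `2 q` factors of the descending factorial of `q + i - 1/2`, the first `q + i` run down to
`1/2` and the remaining `q - i` are `-1/2, -3/2, …`. Both blocks are evaluated by `prod_range_half`.
-/
theorem halfBinom_eq {q i : ℕ} (hi : i ≤ q) :
    halfBinom q i = (-1) ^ (q + i) * ((2 * q + 2 * i).factorial * (2 * q - 2 * i).factorial) /
      (4 ^ (2 * q) * (q + i).factorial * (q - i).factorial * (2 * q).factorial) := by
  have h := Ring.descPochhammer_eq_factorial_smul_choose ((q : ℝ) + i - 1 / 2) (2 * q)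
  rw [← aeval_eq_smeval, aeval_def, eval₂_eq_eval_map, descPochhammer_map, descPochhammer_eval_eq_prod_range] at h
  obtain ⟨m, rfl⟩ := Nat.exists_eq_add_of_le hi
  rw [show 2 * (i + m) = (i + m + i) + m by ring, Finset.prod_range_add] at h
  have e1 : ∏ j ∈ Finset.range (i + m + i), (((i + m : ℕ) : ℝ) + i - 1 / 2 - j) =
      (2 * (i + m + i)).factorial / (4 ^ (i + m + i) * (i + m + i).factorial) := by
    rw [← Finset.prod_range_reflect, ← prod_range_half]
    refine Finset.prod_congr rfl fun r hr => ?_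
    simp at hr
    rw [Nat.cast_sub (by lia), Nat.cast_sub (by lia)]
    push_cast
    ring
  have e2 : ∏ j ∈ Finset.range m, (((i + m : ℕ) : ℝ) + i - 1 / 2 - (i + m + i + j : ℕ)) =
      (-1) ^ m * ((2 * m).factorial / (4 ^ m * m.factorial)) := by
    rw [← prod_range_half, show (-1 : ℝ) ^ m = ∏ _x ∈ Finset.range m, (-1 : ℝ) by simp,
      ← Finset.prod_mul_distrib]
    refine Finset.prod_congr rfl fun r hr => ?_
    push_cast
    ring
  rw [e1, e2] at h
  unfold halfBinom
  have e3 : (-1 : ℝ) ^ (i + m + i) = (-1) ^ m := by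
    rw [show i + m + i = 2 * i + m by ring, pow_add, pow_mul]; simp
  rw [e3, show 2 * (i + m) + 2 * i = 2 * (i + m + i) by ring,
    show 2 * (i + m) - 2 * i = 2 * m by lia, show i + m - i = m by lia,
    show 2 * (i + m) = (i + m + i) + m by ring, pow_add]
  rw [nsmul_eq_mul] at h
  have hne : (((i + m + i + m).factorial : ℕ) : ℝ) ≠ 0 := by positivity
  rw [eq_div_iff (by positivity)]
  generalize Ring.choose (((i + m : ℕ) : ℝ) + i - 1 / 2) (i + m + i + m) = z at h ⊢
  field_simp at h
  linarith

/-- Passes from factorials, used for computing, to the half-integer binomials of the explicit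
series. In `qTerm` it is applied twice: to the polynomial itself and to its moment. -/
theorem legCoef_eq_halfBinom {q i : ℕ} (hi : i ≤ q) :
    legCoef q i = 4 ^ q * ((2 * q).choose (2 * i) : ℝ) * halfBinom q i := by
  rw [halfBinom_eq hi, Nat.cast_choose ℝ (by lia), legCoef, pow_mul]
  norm_num
  have h16 : (16 : ℝ) ^ q = 4 ^ q * 4 ^ q := by rw [← mul_pow]; norm_num
  rw [h16]
  field_simp

/-! ### Moments of Legendre polynomials -/

/-- Up to powers of two these are the differences between the pole `-1 - 2 p` and the other poles of
`legMoment`, as needed for the residues in `sum_legCoef_div`. -/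
theorem prod_erase_range (q p : ℕ) (hp : p ≤ q) :
    ∏ j ∈ (Finset.range (q + 1)).erase p, ((j : ℝ) - p) =
      (-1) ^ p * (p.factorial * (q - p).factorial) := by
  obtain ⟨m, rfl⟩ := Nat.exists_eq_add_of_le hp
  have h := Finset.prod_erase (Finset.range (p + m + 1))
    (f := fun j : ℕ => if j = p then 1 else ((j : ℝ) - p)) (a := p) (by simp)
  have h2 : ∏ j ∈ (Finset.range (p + m + 1)).erase p, ((j : ℝ) - p) =
      ∏ j ∈ (Finset.range (p + m + 1)).erase p, (if j = p then 1 else ((j : ℝ) - p)) :=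
    Finset.prod_congr rfl fun j hj => by rw [if_neg (Finset.ne_of_mem_erase hj)]
  rw [h2, h, show p + m + 1 = p + (m + 1) by ring, Finset.prod_range_add, Finset.prod_range_succ']
  simp only [add_eq_left, if_true, add_zero, Nat.add_eq_zero_iff, one_ne_zero, and_false, if_false,
    mul_one]
  have e1 : ∏ j ∈ Finset.range p, (if j = p then (1 : ℝ) else ((j : ℝ) - p)) =
      (-1) ^ p * p.factorial := by
    rw [← Finset.prod_range_reflect, ← Finset.prod_range_add_one_eq_factorial, Nat.cast_prod,
      show (-1 : ℝ) ^ p = ∏ _x ∈ Finset.range p, (-1 : ℝ) by simp, ← Finset.prod_mul_distrib]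
    refine Finset.prod_congr rfl fun r hr => ?_
    simp at hr
    rw [if_neg (by lia), Nat.cast_sub (by lia), Nat.cast_sub (by lia)]
    push_cast; ring
  have e2 : ∏ j ∈ Finset.range m, (((p + (j + 1) : ℕ) : ℝ) - p) = m.factorial := by
    rw [← Finset.prod_range_add_one_eq_factorial, Nat.cast_prod]
    refine Finset.prod_congr rfl fun r hr => ?_
    push_cast; ring
  rw [e1, e2, show p + m - p = m by lia]
  ring

/-- The value of the numerator of `legMoment` at its pole `σ = -1 - 2 p`. -/
theorem prod_range_odd (p q : ℕ) :
    ∏ r ∈ Finset.range q, ((-1 - 2 * (p : ℝ)) - 2 * r) =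
      (-1) ^ q * ((2 * (p + q)).factorial * p.factorial /
        (2 ^ q * (p + q).factorial * (2 * p).factorial)) := by
  induction q with
  | zero =>
    simp
    field_simp
  | succ q ih =>
    rw [Finset.prod_range_succ, ih, show 2 * (p + (q + 1)) = 2 * (p + q) + 1 + 1 by ring,
      Nat.factorial_succ (2 * (p + q) + 1), Nat.factorial_succ (2 * (p + q)),
      show p + (q + 1) = p + q + 1 by ring, Nat.factorial_succ (p + q)]
    push_cast
    field_simp
    ring

/-- The moment `∫₀¹ t^σ P_{2q}(t) dt`. -/
def legMoment (σ : ℝ) (q : ℕ) : ℝ :=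
  (∏ r ∈ Finset.range q, (σ - 2 * r)) / ∏ r ∈ Finset.range (q + 1), (σ + 1 + 2 * r)

/-- Partial fractions: the numerator of `legMoment` has degree `q`, hence equals its Lagrange
interpolant at the `q + 1` poles `-1 - 2 p`. Divided by the nodal polynomial, the interpolation
formula is the decomposition, and its residues are the Legendre coefficients. -/
theorem sum_legCoef_div {σ : ℝ} (hσ : 0 ≤ σ) (q : ℕ) :
    ∑ p ∈ Finset.range (q + 1), legCoef q p / (2 * p + σ + 1) = legMoment σ q := by
  set s := Finset.range (q + 1)
  set v : ℕ → ℝ := fun p => -1 - 2 * p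
  set f : ℝ[X] := ∏ r ∈ Finset.range q, (X - C (2 * (r : ℝ)))
  have hv : Set.InjOn v s := fun a _ b _ h => by
    simp only [v] at h
    exact_mod_cast (by linarith : (a : ℝ) = b)
  have hdeg : f.degree < s.card := by
    rw [degree_prod_of_monic _ _ fun i _ => monic_X_sub_C _]
    simp only [degree_X_sub_C, Finset.sum_const, Finset.card_range, s]
    rw [nsmul_eq_mul, mul_one]
    exact_mod_cast Nat.lt_succ_self q
  have hint := congrArg (eval σ) (Lagrange.eq_interpolate hv hdeg)
  rw [Lagrange.eval_interpolate_not_at_node _ (fun i _ => by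
    simp only [v]; have : (0 : ℝ) ≤ i := by positivity
    intro h; linarith)] at hint
  have hf (x : ℝ) : eval x f = ∏ r ∈ Finset.range q, (x - 2 * r) := by
    simp [f, eval_prod]
  have hpos : ∏ r ∈ s, (σ + 1 + 2 * (r : ℝ)) ≠ 0 :=
    Finset.prod_ne_zero_iff.2 fun r _ => by positivity
  have hn : eval σ (Lagrange.nodal s v) = ∏ r ∈ s, (σ + 1 + 2 * (r : ℝ)) := by
    rw [Lagrange.eval_nodal]
    exact Finset.prod_congr rfl fun r _ => by simp only [v]; ring
  rw [legMoment, ← hf, hint, hn, mul_div_cancel_left₀ _ hpos]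
  refine Finset.sum_congr rfl fun p hp => ?_
  have hpq : p ≤ q := by simp [s] at hp; lia
  rw [hf, prod_range_odd, Lagrange.nodalWeight]
  have e : ∏ j ∈ s.erase p, (v p - v j)⁻¹ = ((2 : ℝ) ^ q * ((-1) ^ p * (p.factorial * (q - p).factorial)))⁻¹ := by
    rw [Finset.prod_inv_distrib, ← prod_erase_range q p hpq]
    have hc : (s.erase p).card = q := by rw [Finset.card_erase_of_mem hp]; simp [s]
    rw [show (2 : ℝ) ^ q = ∏ _x ∈ s.erase p, (2 : ℝ) by rw [Finset.prod_const, hc],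
      ← Finset.prod_mul_distrib]
    congr 1
    exact Finset.prod_congr rfl fun j _ => by simp only [v]; ring
  have e2 : σ - v p = 2 * p + σ + 1 := by simp only [v]; ring
  have e3 : (2 * (p : ℝ) + σ + 1) ≠ 0 := by positivity
  rw [e, e2, legCoef, show 2 * q + 2 * p = 2 * (p + q) by ring, add_comm q p, pow_add,
    show (4 : ℝ) ^ q = 2 ^ q * 2 ^ q by rw [← mul_pow]; norm_num]
  have h1 : ((-1 : ℝ) ^ p) * (-1) ^ p = 1 := by rw [← mul_pow]; simp
  have h2 : ((-1 : ℝ) ^ p) ≠ 0 := by positivity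
  field_simp
  rw [sq, h1]

theorem eval_legendrePoly (q : ℕ) (t : ℝ) :
    (legendrePoly (2 * q)).eval t = ∑ i ∈ Finset.range (q + 1), legCoef q i * t ^ (2 * i) := by
  simp [legendrePoly_two_mul, eval_finsetSum]

theorem integral_rpow_mul_legendrePoly {σ : ℝ} (hσ : 0 ≤ σ) (q : ℕ) :
    ∫ t in (0 : ℝ)..1, t ^ σ * (legendrePoly (2 * q)).eval t = legMoment σ q := by
  rw [← sum_legCoef_div hσ]
  have h : ∀ t ∈ Set.uIcc (0 : ℝ) 1, t ^ σ * (legendrePoly (2 * q)).eval t =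
      ∑ i ∈ Finset.range (q + 1), legCoef q i * t ^ (2 * (i : ℝ) + σ) := by
    intro t ht
    rw [Set.uIcc_of_le zero_le_one] at ht
    rw [eval_legendrePoly, Finset.mul_sum]
    refine Finset.sum_congr rfl fun i _ => ?_
    rw [Real.rpow_add_of_nonneg ht.1 (by positivity) hσ,
      show (2 * (i : ℝ)) = ((2 * i : ℕ) : ℝ) by push_cast; ring, Real.rpow_natCast]
    ring
  rw [intervalIntegral.integral_congr h, intervalIntegral.integral_finsetSum]
  · refine Finset.sum_congr rfl fun i _ => ?_
    have : (0 : ℝ) ≤ i := by positivity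
    rw [intervalIntegral.integral_const_mul, integral_rpow (Or.inl (by linarith)),
      Real.zero_rpow (by linarith)]
    simp
    rfl
  · intro i _
    have : (0 : ℝ) ≤ i := by positivity
    exact (intervalIntegral.intervalIntegrable_rpow' (by linarith)).const_mul _

theorem eval_legendrePoly_neg (q : ℕ) (t : ℝ) :
    (legendrePoly (2 * q)).eval (-t) = (legendrePoly (2 * q)).eval t := by
  simp [eval_legendrePoly, pow_mul]

theorem legendreCoeff_eq {α : ℝ} (hα : 0 ≤ α) (q : ℕ) :
    legendreCoeff α q = (4 * q + 1) * legMoment α q := by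
  have hc : Continuous fun t : ℝ => |t| ^ α * (legendrePoly (2 * q)).eval t :=
    (continuous_abs.rpow_const fun _ => Or.inr hα).mul (legendrePoly (2 * q)).continuous
  have h0 : ∫ t in (0 : ℝ)..1, |t| ^ α * (legendrePoly (2 * q)).eval t = legMoment α q := by
    rw [← integral_rpow_mul_legendrePoly hα]
    refine intervalIntegral.integral_congr fun t ht => ?_
    rw [Set.uIcc_of_le zero_le_one] at ht
    simp only [abs_of_nonneg ht.1]
  have h1 : ∫ t in (-1 : ℝ)..0, |t| ^ α * (legendrePoly (2 * q)).eval t = legMoment α q := by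
    rw [← h0]
    have := intervalIntegral.integral_comp_neg (a := (0 : ℝ)) (b := 1)
      fun t : ℝ => |t| ^ α * (legendrePoly (2 * q)).eval t
    simp only [abs_neg, eval_legendrePoly_neg, neg_zero] at this
    exact this.symm
  unfold legendreCoeff
  rw [← intervalIntegral.integral_add_adjacent_intervals (b := 0)
    (hc.intervalIntegrable _ _) (hc.intervalIntegrable _ _), h0, h1]
  ring

theorem legMoment_succ {σ : ℝ} (hσ : 0 ≤ σ) (q : ℕ) :
    legMoment σ (q + 1) = (σ - 2 * q) / (σ + 3 + 2 * q) * legMoment σ q := by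
  have hpos : ∏ r ∈ Finset.range (q + 1), (σ + 1 + 2 * (r : ℝ)) ≠ 0 :=
    Finset.prod_ne_zero_iff.2 fun r _ => by positivity
  rw [legMoment, legMoment, Finset.prod_range_succ, Finset.prod_range_succ _ (q + 1)]
  push_cast
  have : σ + 3 + 2 * (q : ℝ) ≠ 0 := by positivity
  rw [show σ + 1 + 2 * ((q : ℝ) + 1) = σ + 3 + 2 * q by ring]
  field_simp

/-- A Kummer-type test: the coefficients are dominated by differences of a nonnegative sequence `b`,
so the partial sums are at most `b 0`. The shift by one makes `2 (q + 1) - α` nonnegative for `α ≤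
2`, which fixes the sign of the ratio of consecutive moments. -/
theorem summable_abs_legendreCoeff {α : ℝ} (h1 : 1 ≤ α) (h2 : α ≤ 2) :
    Summable fun q => |legendreCoeff α q| := by
  have hα : 0 ≤ α := by linarith
  rw [← summable_nat_add_iff 1]
  set R : ℕ → ℝ := fun q => |legMoment α (q + 1)|
  -- The second factor of `b (q + 1)` is the denominator of the ratio `R (q + 1) / R q`; it cancels,
  -- and in the difference the quadratic terms in `q` cancel as well.
  set b : ℕ → ℝ := fun q => 4 * (q + 1) * (2 * (q + 1) + α + 1) * R q
  have hb : ∀ q, 0 ≤ b q := fun q => by positivity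
  have key : ∀ q, |legendreCoeff α (q + 1)| ≤ b q - b (q + 1) := by
    intro q
    have hq : (0 : ℝ) ≤ q := by positivity
    have hR : R (q + 1) = (2 * (q + 1) - α) / (α + 3 + 2 * (q + 1)) * R q := by
      simp only [R]
      rw [legMoment_succ hα (q + 1), abs_mul, abs_div]
      push_cast
      rw [abs_of_nonpos (by linarith : α - 2 * ((q : ℝ) + 1) ≤ 0),
        abs_of_nonneg (by linarith : 0 ≤ α + 3 + 2 * ((q : ℝ) + 1))]
      ring_nf
    have hne : α + 3 + 2 * ((q : ℝ) + 1) ≠ 0 := by positivity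
    have e : b q - b (q + 1) = ((8 * α - 4) * (q + 1) + 4 * α) * R q := by
      simp only [b]
      rw [hR]
      push_cast
      field_simp
      ring
    rw [e, legendreCoeff_eq hα, abs_mul, abs_of_nonneg (by positivity)]
    push_cast
    have : 0 ≤ R q := abs_nonneg _
    refine mul_le_mul_of_nonneg_right ?_ this
    -- The claim is `4 (q + 1) + 1 ≤ (8 α - 4) (q + 1) + 4 α`, which holds because `1 ≤ α`.
    nlinarith
  refine summable_of_sum_range_le (c := b 0) (fun _ => abs_nonneg _) fun n => ?_
  calc _ ≤ ∑ q ∈ Finset.range n, (b q - b (q + 1)) := Finset.sum_le_sum fun q _ => key q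
    _ = b 0 - b n := Finset.sum_range_sub' _ _
    _ ≤ b 0 := by linarith [hb n]

end LegendreQFT

end

noncomputable section

namespace LegendreQFT

/-! ### The Legendre differential equation and the bound on `[0, 1]` -/

/-- Repeated differentiation of `(X ^ 2 - 1) y' = 2 n X y` for `y = (X ^ 2 - 1) ^ n`. Keeping the
order `k` free makes each induction step a single differentiation; `k = n` is Legendre's equation.
-/
theorem iterate_derivative_rodrigues (n k : ℕ) :
    ((X : ℝ[X]) ^ 2 - 1) * derivative^[k + 2] ((X ^ 2 - 1) ^ n) =
      C (2 * ((n : ℝ) - k - 1)) * X * derivative^[k + 1] ((X ^ 2 - 1) ^ n) +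
        C (((k : ℝ) + 1) * (2 * n - k)) * derivative^[k] ((X ^ 2 - 1) ^ n) := by
  induction k with
  | zero =>
    have h : ((X : ℝ[X]) ^ 2 - 1) * derivative ((X ^ 2 - 1) ^ n) =
        C (2 * (n : ℝ)) * X * (X ^ 2 - 1) ^ n := by
      cases n with
      | zero => simp
      | succ n =>
        rw [derivative_pow_succ]
        have hC2 : (C 2 : ℝ[X]) = 2 := map_ofNat C 2
        simp [pow_succ, hC2]
        ring
    have h2 := congrArg derivative h
    simp only [derivative_mul, derivative_sub, derivative_X_pow, derivative_one, derivative_C,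
      derivative_X] at h2
    simp only [Function.iterate_succ, Function.iterate_zero, Function.comp, id]
    simp only [C_mul, C_sub, C_add, Nat.cast_zero, C_0, C_1] at h2 ⊢
    have hC2 : (C 2 : ℝ[X]) = 2 := map_ofNat C 2
    simp [hC2] at h2 ⊢
    linear_combination h2
  | succ k ih =>
    have h2 := congrArg derivative ih
    simp only [derivative_mul, derivative_sub, derivative_add, derivative_X_pow, derivative_one,
      derivative_C, derivative_X, ← Function.iterate_succ_apply' (⇑derivative)] at h2
    simp only [C_mul, C_sub, C_add, C_1, Nat.cast_add, Nat.cast_one, map_natCast] at h2 ⊢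
    have hC2 : (C 2 : ℝ[X]) = 2 := map_ofNat C 2
    simp [hC2] at h2 ⊢
    linear_combination h2

theorem legendrePoly_ode (n : ℕ) :
    ((X : ℝ[X]) ^ 2 - 1) * derivative (derivative (legendrePoly n)) =
      C ((n : ℝ) * (n + 1)) * legendrePoly n - 2 * X * derivative (legendrePoly n) := by
  have h := iterate_derivative_rodrigues n n
  simp only [legendrePoly, derivative_C_mul, ← Function.iterate_succ_apply' (⇑derivative)]
  rw [mul_left_comm, h]
  have e1 : (2 * ((n : ℝ) - n - 1)) = -2 := by ring
  have e2 : ((n : ℝ) + 1) * (2 * n - n) = n * (n + 1) := by ring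
  rw [e1, e2]
  simp only [map_neg, map_ofNat]
  ring

/-- After translation by `1` the polynomial `(X ^ 2 - 1) ^ n` becomes `X ^ n (X + 2) ^ n`, whose
coefficient at `X ^ n` is `2 ^ n`. -/
theorem eval_one_legendrePoly (n : ℕ) : (legendrePoly n).eval 1 = 1 := by
  have h : eval 1 ((derivative (R := ℝ))^[n] ((X ^ 2 - 1) ^ n)) = n.factorial * 2 ^ n := by
    rw [← factorial_smul_hasseDeriv, LinearMap.smul_apply, eval_smul, ← taylor_coeff]
    have : taylor (1 : ℝ) (((X : ℝ[X]) ^ 2 - 1) ^ n) = X ^ n * (X + C 2) ^ n := by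
      rw [taylor_apply, pow_comp, ← mul_pow]
      congr 1
      simp only [sub_comp, pow_comp, X_comp, one_comp, C_1, C_ofNat]
      ring
    rw [this, coeff_X_pow_mul', if_pos le_rfl, Nat.sub_self, coeff_zero_eq_eval_zero]
    simp
  rw [legendrePoly.eq_def, eval_mul, eval_C, h]
  field_simp

/-- By the differential equation, `n (n + 1) P² + (1 - t²) P'²` has derivative `2 t P'²`. It
therefore increases on `[0, 1]` to its value `n (n + 1)` at `t = 1`, and it dominates `n (n + 1)
P²`. -/
theorem abs_eval_legendrePoly_le (n : ℕ) {t : ℝ} (h0 : 0 ≤ t) (h1 : t ≤ 1) :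
    |(legendrePoly n).eval t| ≤ 1 := by
  rcases Nat.eq_zero_or_pos n with rfl | hn
  · simp [legendrePoly.eq_def]
  set P := legendrePoly n with hP
  set E : ℝ[X] := C ((n : ℝ) * (n + 1)) * P ^ 2 + (1 - X ^ 2) * derivative P ^ 2 with hE
  have hd : derivative E = 2 * X * derivative P ^ 2 := by
    have := legendrePoly_ode n
    rw [← hP] at this
    simp only [hE, derivative_add, derivative_mul, derivative_C, derivative_pow, derivative_sub,
      derivative_one, derivative_X]
    have hC2 : (C 2 : ℝ[X]) = 2 := map_ofNat C 2
    simp [hC2]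
    simp at this
    linear_combination (-2 * derivative P) * this
  have hmono : MonotoneOn (fun t => E.eval t) (Set.Icc 0 1) := by
    refine monotoneOn_of_deriv_nonneg (convex_Icc 0 1) E.continuous.continuousOn
      E.differentiable.differentiableOn fun x hx => ?_
    rw [interior_Icc] at hx
    rw [Polynomial.deriv, hd]
    simp
    have := hx.1.le
    positivity
  have hle := hmono ⟨h0, h1⟩ ⟨zero_le_one, le_rfl⟩ h1
  simp only [hE, eval_add, eval_mul, eval_C, eval_pow, eval_sub, eval_one, eval_X, hP,
    eval_one_legendrePoly] at hle
  rw [← hP] at hle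
  have h3 : 0 ≤ (1 - t ^ 2) * eval t (derivative P) ^ 2 :=
    mul_nonneg (by nlinarith) (sq_nonneg _)
  have h4 : 0 < (n : ℝ) * (n + 1) := by positivity
  have h5 : eval t P ^ 2 ≤ 1 := by
    by_contra hc
    push Not at hc
    nlinarith
  exact (sq_le_one_iff_abs_le_one _).1 h5

/-! ### The Legendre expansion of `t ^ α` -/

/-- One of the factors `σ - 2 r` vanishes: this is the orthogonality of `P_{2q}` to lower even
powers. -/
theorem legMoment_natCast_of_lt {r q : ℕ} (h : r < q) : legMoment (2 * r) q = 0 := by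
  rw [legMoment, Finset.prod_eq_zero (Finset.mem_range.2 h) (by simp), zero_div]

theorem legCoef_mul_legMoment_self (q : ℕ) : legCoef q q * legMoment (2 * q) q = 1 / (4 * q + 1) := by
  have h1 : ∏ r ∈ Finset.range q, (2 * (q : ℝ) - 2 * r) = 2 ^ q * q.factorial := by
    rw [← Finset.prod_range_reflect, ← Finset.prod_range_add_one_eq_factorial, Nat.cast_prod,
      show (2 : ℝ) ^ q = ∏ _x ∈ Finset.range q, (2 : ℝ) by simp, ← Finset.prod_mul_distrib]
    refine Finset.prod_congr rfl fun r hr => ?_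
    have hr' := Finset.mem_range.1 hr
    rw [Nat.cast_sub (by lia), Nat.cast_sub (by lia)]
    push_cast; ring
  have h2 : ∏ r ∈ Finset.range (q + 1), (2 * (q : ℝ) + 1 + 2 * r) =
      (2 * (q + q) + 1) * ((2 * (q + q)).factorial * q.factorial /
        (2 ^ q * (q + q).factorial * (2 * q).factorial)) := by
    have := prod_range_odd q q
    have e : ∏ r ∈ Finset.range q, ((-1 - 2 * (q : ℝ)) - 2 * r) =
        (-1) ^ q * ∏ r ∈ Finset.range q, (2 * (q : ℝ) + 1 + 2 * r) := by
      rw [show (-1 : ℝ) ^ q = ∏ _x ∈ Finset.range q, (-1 : ℝ) by simp, ← Finset.prod_mul_distrib]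
      exact Finset.prod_congr rfl fun r _ => by ring
    rw [e] at this
    rw [Finset.prod_range_succ, mul_left_cancel₀ (by positivity) this]
    ring
  rw [legMoment, h1, h2, legCoef, show 2 * q + 2 * q = 2 * (q + q) by ring, ← two_mul q]
  have h4 : (4 : ℝ) ^ q = 2 ^ q * 2 ^ q := by rw [← mul_pow]; norm_num
  rw [h4, two_mul q, pow_add, ← mul_pow]
  norm_num
  have : (4 * (q : ℝ) + 1) ≠ 0 := by positivity
  have : (2 * (2 * (q : ℝ)) + 1) ≠ 0 := by positivity
  have : (2 * ((q : ℝ) + q) + 1) ≠ 0 := by positivity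
  field_simp
  ring

theorem integral_pow_mul_legendrePoly (r q : ℕ) :
    ∫ t in (0 : ℝ)..1, t ^ (2 * r) * (legendrePoly (2 * q)).eval t = legMoment (2 * r) q := by
  rw [← integral_rpow_mul_legendrePoly (by positivity)]
  refine intervalIntegral.integral_congr fun t _ => ?_
  rw [show (2 * (r : ℝ)) = ((2 * r : ℕ) : ℝ) by push_cast; ring, Real.rpow_natCast]

/-- By symmetry let `q ≤ r`. Expanding the polynomial of lower degree, only its leading power can
have a nonzero moment against the other. -/
theorem integral_legendrePoly_mul_legendrePoly (q r : ℕ) :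
    ∫ t in (0 : ℝ)..1, (legendrePoly (2 * q)).eval t * (legendrePoly (2 * r)).eval t =
      if q = r then 1 / (4 * (r : ℝ) + 1) else 0 := by
  have main : ∀ q r : ℕ, q ≤ r →
      ∫ t in (0 : ℝ)..1, (legendrePoly (2 * q)).eval t * (legendrePoly (2 * r)).eval t =
      if q = r then 1 / (4 * (r : ℝ) + 1) else 0 := by
    intro q r hqr
    simp_rw [eval_legendrePoly q, Finset.sum_mul, mul_assoc]
    rw [intervalIntegral.integral_finsetSum fun i _ => by
      apply Continuous.intervalIntegrable
      have := (legendrePoly (2 * r)).continuous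
      fun_prop]
    simp_rw [intervalIntegral.integral_const_mul, integral_pow_mul_legendrePoly]
    rw [Finset.sum_range_succ, Finset.sum_eq_zero, zero_add]
    · split_ifs with h
      · rw [h, legCoef_mul_legMoment_self]
      · rw [legMoment_natCast_of_lt (by lia), mul_zero]
    · intro i hi
      simp at hi
      rw [legMoment_natCast_of_lt (by lia), mul_zero]
  rcases le_total q r with h | h
  · exact main q r h
  · simp_rw [mul_comm (eval _ (legendrePoly (2 * q)))]
    rw [main r q h]
    simp only [eq_comm (a := r)]
    split_ifs with h1
    · rw [h1]
    · rfl

/-- If `u` is orthogonal to all polynomials in `t²`, then `∫ u²` equals `∫ u (u - p(t²))` for every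
`p`, and Weierstrass approximation makes the latter smaller than `∫ u²`. -/
theorem eq_zero_of_forall_integral_pow_eq_zero {u : ℝ → ℝ} (hu : Continuous u)
    (h : ∀ r : ℕ, ∫ t in (0 : ℝ)..1, u t * t ^ (2 * r) = 0) {t : ℝ} (ht : t ∈ Set.Icc (0 : ℝ) 1) :
    u t = 0 := by
  by_contra hne
  have hpos : 0 < ∫ t in (0 : ℝ)..1, u t ^ 2 :=
    intervalIntegral.integral_pos zero_lt_one (hu.pow 2).continuousOn (fun x _ => sq_nonneg _)
      ⟨t, ht, by positivity⟩
  set I := ∫ t in (0 : ℝ)..1, |u t| with hI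
  have hI0 : 0 ≤ I := intervalIntegral.integral_nonneg zero_le_one fun x _ => abs_nonneg _
  -- With this choice `ε * I` is less than `∫ u²`; the `+ 1` keeps the denominator positive.
  set ε := (∫ t in (0 : ℝ)..1, u t ^ 2) / (2 * (I + 1))
  have hε : 0 < ε := by positivity
  -- Approximating `u ∘ √` rather than `u` yields an approximant of `u` on `[0, 1]` containing even
  -- powers only.
  obtain ⟨p, hp⟩ := exists_polynomial_near_of_continuousOn 0 1 (fun s => u (Real.sqrt s))
    (hu.comp Real.continuous_sqrt).continuousOn ε hε
  have hpc : Continuous fun t : ℝ => p.eval (t ^ 2) := p.continuous.comp (continuous_pow 2)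
  have h0 : ∫ t in (0 : ℝ)..1, u t * p.eval (t ^ 2) = 0 := by
    simp_rw [eval_eq_sum_range, Finset.mul_sum]
    rw [intervalIntegral.integral_finsetSum fun i _ => by
      apply Continuous.intervalIntegrable
      fun_prop]
    refine Finset.sum_eq_zero fun i _ => ?_
    simp_rw [← pow_mul, mul_left_comm (u _)]
    rw [intervalIntegral.integral_const_mul, h, mul_zero]
  have h1 : ∫ t in (0 : ℝ)..1, u t ^ 2 = ∫ t in (0 : ℝ)..1, u t * (u t - p.eval (t ^ 2)) := by
    simp_rw [mul_sub, ← sq]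
    rw [intervalIntegral.integral_sub, h0, sub_zero]
    · exact (hu.pow 2).intervalIntegrable _ _
    · exact (hu.mul hpc).intervalIntegrable _ _
  have h2 : ∫ t in (0 : ℝ)..1, u t * (u t - p.eval (t ^ 2)) ≤ ∫ t in (0 : ℝ)..1, ε * |u t| := by
    refine intervalIntegral.integral_mono_on zero_le_one
      ((hu.mul (hu.sub hpc)).intervalIntegrable _ _) ((hu.abs.const_mul ε).intervalIntegrable _ _) fun x hx => ?_
    have := hp (x ^ 2) ⟨sq_nonneg x, by nlinarith [hx.1, hx.2]⟩
    simp only [Real.sqrt_sq hx.1] at this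
    calc u x * (u x - p.eval (x ^ 2)) ≤ |u x * (u x - p.eval (x ^ 2))| := le_abs_self _
      _ = |u x| * |u x - p.eval (x ^ 2)| := abs_mul _ _
      _ ≤ |u x| * ε := by
        rw [abs_sub_comm]
        exact mul_le_mul_of_nonneg_left this.le (abs_nonneg _)
      _ = ε * |u x| := mul_comm _ _
  rw [← h1, intervalIntegral.integral_const_mul, ← hI] at h2
  have h3 : ε * (2 * (I + 1)) = ∫ t in (0 : ℝ)..1, u t ^ 2 := by
    simp only [ε]; field_simp
  nlinarith

/-- The series is dominated by the summable `|c_{2q}|`, so its sum is continuous and may be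
integrated termwise. It has the same integrals against all `P_{2r}` as `|t|^α`; by triangularity the
same even moments; hence it is the same function on `[0, 1]`. -/
theorem hasSum_legendreCoeff_mul {α : ℝ} (h1 : 1 ≤ α) (h2 : α ≤ 2) {t : ℝ}
    (ht : t ∈ Set.Icc (0 : ℝ) 1) :
    HasSum (fun q => legendreCoeff α q * (legendrePoly (2 * q)).eval t) (t ^ α) := by
  have hα : 0 ≤ α := by linarith
  have hs := summable_abs_legendreCoeff h1 h2
  -- Clamping the argument to `[0, 1]` makes the bound on the Legendre polynomials global, so that
  -- the sum is continuous on the whole line.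
  set w : ℝ → ℝ := fun t => max 0 (min t 1)
  have hw : Continuous w := by fun_prop
  have hw01 : ∀ t, w t ∈ Set.Icc (0 : ℝ) 1 := fun t => ⟨le_max_left _ _, by simp [w]⟩
  have hwt : ∀ t ∈ Set.Icc (0 : ℝ) 1, w t = t := fun t ht => by
    simp [w, ht.1, ht.2]
  have hbd : ∀ q t, ‖legendreCoeff α q * (legendrePoly (2 * q)).eval (w t)‖ ≤ |legendreCoeff α q| := by
    intro q t
    rw [norm_mul, Real.norm_eq_abs, Real.norm_eq_abs]
    exact mul_le_of_le_one_right (abs_nonneg _)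
      (abs_eval_legendrePoly_le _ (hw01 t).1 (hw01 t).2)
  have hcont : ∀ q, Continuous fun t => legendreCoeff α q * (legendrePoly (2 * q)).eval (w t) :=
    fun q => ((legendrePoly (2 * q)).continuous.comp hw).const_mul _
  set H : ℝ → ℝ := fun t => ∑' q, legendreCoeff α q * (legendrePoly (2 * q)).eval (w t)
  have hH : Continuous H := continuous_tsum hcont hs hbd
  have hHs : ∀ t, HasSum (fun q => legendreCoeff α q * (legendrePoly (2 * q)).eval (w t)) (H t) :=
    fun t => (Summable.of_norm_bounded hs fun q => hbd q t).hasSum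
  have hA : Continuous fun t : ℝ => |t| ^ α := continuous_abs.rpow_const fun _ => Or.inr hα
  have hr : ∀ r, ∫ t in (0 : ℝ)..1, (|t| ^ α - H t) * (legendrePoly (2 * r)).eval t = 0 := by
    intro r
    have hP := (legendrePoly (2 * r)).continuous
    have e1 : ∫ t in (0 : ℝ)..1, |t| ^ α * (legendrePoly (2 * r)).eval t = legMoment α r := by
      rw [← integral_rpow_mul_legendrePoly hα]
      refine intervalIntegral.integral_congr fun t ht => ?_
      rw [Set.uIcc_of_le zero_le_one] at ht
      simp only [abs_of_nonneg ht.1]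
    have e2 : HasSum (fun q => ∫ t in (0 : ℝ)..1, legendreCoeff α q *
        (legendrePoly (2 * q)).eval (w t) * (legendrePoly (2 * r)).eval t)
        (∫ t in (0 : ℝ)..1, H t * (legendrePoly (2 * r)).eval t) := by
      refine intervalIntegral.hasSum_integral_of_dominated_convergence
        (fun q _ => |legendreCoeff α q|)
        (fun q => ((hcont q).mul hP).aestronglyMeasurable) ?_ ?_ ?_ ?_
      · refine fun q => Filter.Eventually.of_forall fun t ht => ?_
        rw [Set.uIoc_of_le zero_le_one] at ht
        rw [norm_mul]
        exact (mul_le_of_le_one_right (norm_nonneg _)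
          (abs_eval_legendrePoly_le _ ht.1.le ht.2)).trans (hbd q t)
      · exact Filter.Eventually.of_forall fun t ht => hs
      · exact _root_.intervalIntegrable_const
      · exact Filter.Eventually.of_forall fun t ht => (hHs t).mul_right _
    have e3 : ∀ q, ∫ t in (0 : ℝ)..1, legendreCoeff α q *
        (legendrePoly (2 * q)).eval (w t) * (legendrePoly (2 * r)).eval t =
        if q = r then legMoment α r else 0 := by
      intro q
      rw [intervalIntegral.integral_congr (g := fun t => legendreCoeff α q *
        ((legendrePoly (2 * q)).eval t * (legendrePoly (2 * r)).eval t)),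
        intervalIntegral.integral_const_mul, integral_legendrePoly_mul_legendrePoly]
      · split_ifs with h
        · rw [h, legendreCoeff_eq hα]
          have : (4 * (r : ℝ) + 1) ≠ 0 := by positivity
          field_simp
        · rw [mul_zero]
      · intro t ht
        rw [Set.uIcc_of_le zero_le_one] at ht
        simp only [hwt t ht]
        ring
    simp_rw [e3] at e2
    have e4 := e2.unique (hasSum_ite_eq r (legMoment α r))
    simp_rw [sub_mul]
    have e5 := intervalIntegral.integral_sub (μ := volume) ((hA.mul hP).intervalIntegrable 0 1)
      ((hH.mul hP).intervalIntegrable 0 1)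
    simp only [Pi.mul_apply] at e5
    rw [e5, e1, e4, sub_self]
  have hu : Continuous fun t => |t| ^ α - H t := hA.sub hH
  -- `P_{2r}` is a nonzero multiple of `t ^ (2 r)` plus lower even powers, so the moments vanish by
  -- strong induction.
  have hpow : ∀ r : ℕ, ∫ t in (0 : ℝ)..1, (|t| ^ α - H t) * t ^ (2 * r) = 0 := by
    intro r
    induction r using Nat.strong_induction_on with
    | _ r ih =>
      have h := hr r
      simp_rw [eval_legendrePoly, Finset.mul_sum, mul_left_comm (_ - _)] at h
      rw [intervalIntegral.integral_finsetSum fun i _ => by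
        apply Continuous.intervalIntegrable
        fun_prop] at h
      simp_rw [intervalIntegral.integral_const_mul] at h
      rw [Finset.sum_range_succ, Finset.sum_eq_zero, zero_add] at h
      · refine (mul_eq_zero.1 h).resolve_left ?_
        unfold legCoef
        rw [← two_mul, pow_mul]
        positivity
      · intro i hi
        rw [ih i (Finset.mem_range.1 hi), mul_zero]
  have := eq_zero_of_forall_integral_pow_eq_zero hu hpow ht
  simp only [abs_of_nonneg ht.1] at this
  rw [sub_eq_zero.1 this]
  simpa only [hwt t ht] using hHs t

end LegendreQFT

end

noncomputable section

namespace LegendreQFT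

/-! ### Gaussian measures on `ℝⁿ` -/

-- A nonnegative element of a C⋆-algebra has the form `y* y`. The factor `B` whitens the quadratic
-- form: `φ = B ξ` turns `Q` into half the sum of the squares of `ξ`.
open scoped MatrixOrder ComplexOrder Matrix.Norms.L2Operator in
theorem exists_mul_transpose_of_posDef {n : ℕ} {A : Matrix (Fin n) (Fin n) ℝ} (hA : A.PosDef) :
    ∃ B : Matrix (Fin n) (Fin n) ℝ, A = B * Bᵀ ∧ B.det ≠ 0 := by
  obtain ⟨y, hy⟩ := CStarAlgebra.nonneg_iff_eq_star_mul_self.mp hA.posSemidef.nonneg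
  have hyt : star y = yᵀ := by
    ext a b; simp [star_apply]
  rw [hyt] at hy
  refine ⟨yᵀ, by rw [transpose_transpose]; exact hy, fun h => ?_⟩
  have := hA.det_pos
  rw [hy, det_mul, h, zero_mul] at this
  exact lt_irrefl _ this

theorem quad_eq_dotProduct {n : ℕ} (A : Matrix (Fin n) (Fin n) ℝ) (φ : Fin n → ℝ) :
    quad A φ = 1 / 2 * (φ ⬝ᵥ A⁻¹ *ᵥ φ) := by
  simp only [quad, dotProduct, mulVec, Finset.mul_sum]
  refine Finset.sum_congr rfl fun a _ => Finset.sum_congr rfl fun b _ => ?_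
  ring

theorem quad_mul_transpose {n : ℕ} {B : Matrix (Fin n) (Fin n) ℝ} (hB : B.det ≠ 0)
    (ξ : Fin n → ℝ) : quad (B * Bᵀ) (B *ᵥ ξ) = 1 / 2 * ∑ a, ξ a ^ 2 := by
  have hu : IsUnit B.det := hB.isUnit
  have hut : IsUnit Bᵀ.det := by rwa [det_transpose]
  rw [quad_eq_dotProduct, Matrix.mul_inv_rev, mulVec_mulVec, mul_assoc, nonsing_inv_mul _ hu, mul_one,
    dotProduct_mulVec, ← transpose_nonsing_inv, ← mulVec_transpose, transpose_transpose,
    mulVec_mulVec, nonsing_inv_mul _ hu, one_mulVec]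
  simp [dotProduct, sq]

theorem quad_nonneg {n : ℕ} {A : Matrix (Fin n) (Fin n) ℝ} (hA : A.PosDef) (φ : Fin n → ℝ) :
    0 ≤ quad A φ := by
  rw [quad_eq_dotProduct]
  have := hA.inv.posSemidef.dotProduct_mulVec_nonneg φ
  simp at this
  positivity

theorem quad_pos {n : ℕ} {A : Matrix (Fin n) (Fin n) ℝ} (hA : A.PosDef) {φ : Fin n → ℝ}
    (hφ : φ ≠ 0) : 0 < quad A φ := by
  rw [quad_eq_dotProduct]
  have := hA.inv.dotProduct_mulVec_pos hφ
  simp at this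
  positivity

theorem continuous_quad {n : ℕ} (A : Matrix (Fin n) (Fin n) ℝ) : Continuous (quad A) := by
  unfold quad
  fun_prop

theorem quad_smul {n : ℕ} (A : Matrix (Fin n) (Fin n) ℝ) (r : ℝ) (φ : Fin n → ℝ) :
    quad A (r • φ) = r ^ 2 * quad A φ := by
  simp only [quad, Finset.mul_sum, Pi.smul_apply, smul_eq_mul]
  refine Finset.sum_congr rfl fun a _ => Finset.sum_congr rfl fun b _ => ?_
  ring

theorem quad_neg {n : ℕ} (A : Matrix (Fin n) (Fin n) ℝ) (φ : Fin n → ℝ) :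
    quad A (-φ) = quad A φ := by
  simp [quad]

/-- The cross term `χ ⬝ᵥ φ`, with `χ = A⁻¹ m`, is the source of the powers of `χ` in the series. -/
theorem quad_sub {n : ℕ} {A : Matrix (Fin n) (Fin n) ℝ} (hA : A.IsSymm) (φ m : Fin n → ℝ) :
    quad A (φ - m) = quad A φ + quad A m - (A⁻¹ *ᵥ m) ⬝ᵥ φ := by
  have h : φ ⬝ᵥ A⁻¹ *ᵥ m = m ⬝ᵥ A⁻¹ *ᵥ φ := by
    rw [dotProduct_mulVec, dotProduct_comm, ← mulVec_transpose, transpose_nonsing_inv, hA.eq]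
  simp only [quad_eq_dotProduct, mulVec_sub, dotProduct_sub, sub_dotProduct, h,
    dotProduct_comm (A⁻¹ *ᵥ m)]
  ring

theorem PosDef.isSymm {n : ℕ} {A : Matrix (Fin n) (Fin n) ℝ} (hA : A.PosDef) : A.IsSymm := by
  have := hA.isHermitian.eq
  rwa [conjTranspose_eq_transpose_of_trivial] at this

/-- Linear change of variables in `ℝⁿ`. -/
theorem integral_eq_det_mul_integral {n : ℕ} {B : Matrix (Fin n) (Fin n) ℝ} (hB : B.det ≠ 0)
    (m : Fin n → ℝ) (f : (Fin n → ℝ) → ℂ) :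
    ∫ φ, f φ = (|B.det| : ℝ) * ∫ ξ, f (m + B *ᵥ ξ) := by
  have h := Real.map_matrix_volume_pi_eq_smul_volume_pi hB
  have hcont : Continuous (toLin' B) := LinearMap.continuous_of_finiteDimensional _
  have hemb : MeasurableEmbedding (toLin' B) := by
    let e := LinearEquiv.ofIsUnitDet (f := toLin' B) (v := Pi.basisFun ℝ (Fin n))
      (v' := Pi.basisFun ℝ (Fin n)) (by simpa [← toLin_eq_toLin'] using hB.isUnit)
    exact (e.toContinuousLinearEquiv.toHomeomorph).measurableEmbedding
  have h2 := hemb.integral_map (μ := volume) (fun φ => f (m + φ))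
  rw [h, integral_smul_measure, integral_add_left_eq_self, ENNReal.toReal_ofReal (abs_nonneg _)] at h2
  simp only [toLin'_apply] at h2
  rw [← h2, abs_inv, Complex.real_smul, ← mul_assoc, ← Complex.ofReal_mul,
    mul_inv_cancel₀ (abs_ne_zero.2 hB)]
  simp

theorem sqrt_two_pi_pow_mul_det {n : ℕ} (B : Matrix (Fin n) (Fin n) ℝ) :
    Real.sqrt ((2 * Real.pi) ^ n * (B * Bᵀ).det) = Real.sqrt (2 * Real.pi) ^ n * |B.det| := by
  rw [det_mul, det_transpose, ← sq, Real.sqrt_mul (by positivity), Real.sqrt_sq_eq_abs,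
    Real.sqrt_eq_rpow, Real.sqrt_eq_rpow, ← Real.rpow_natCast, ← Real.rpow_natCast, ← Real.rpow_mul
    (by positivity), ← Real.rpow_mul (by positivity), mul_comm (n : ℝ)]

/-- The characteristic function of a Gaussian density. -/
theorem integral_cexp_mul_exp_neg_quad {n : ℕ} {A : Matrix (Fin n) (Fin n) ℝ} (hA : A.PosDef)
    (m t : Fin n → ℝ) :
    ∫ φ : Fin n → ℝ, Complex.exp ((t ⬝ᵥ φ : ℝ) * Complex.I) * (Real.exp (-quad A (φ - m)) : ℝ) =
      (Real.sqrt ((2 * Real.pi) ^ n * A.det) : ℝ) *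
        Complex.exp ((t ⬝ᵥ m : ℝ) * Complex.I - (t ⬝ᵥ A *ᵥ t / 2 : ℝ)) := by
  obtain ⟨B, rfl, hB⟩ := exists_mul_transpose_of_posDef hA
  rw [integral_eq_det_mul_integral hB m, sqrt_two_pi_pow_mul_det]
  have h := GaussianFourier.integral_cexp_neg_mul_sum_add (b := 1 / 2) (by norm_num)
    (fun a : Fin n => ((t ᵥ* B) a : ℂ) * Complex.I)
  have e : ∀ ξ : Fin n → ℝ, Complex.exp ((t ⬝ᵥ (m + B *ᵥ ξ) : ℝ) * Complex.I) *
      (Real.exp (-quad (B * Bᵀ) (m + B *ᵥ ξ - m)) : ℝ) =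
      Complex.exp ((t ⬝ᵥ m : ℝ) * Complex.I) *
        Complex.exp (-(1 / 2) * ∑ a, (ξ a : ℂ) ^ 2 + ∑ a, ((t ᵥ* B) a : ℂ) * Complex.I * ξ a) := by
    intro ξ
    rw [add_sub_cancel_left, quad_mul_transpose hB, Complex.ofReal_exp, ← Complex.exp_add,
      ← Complex.exp_add, dotProduct_add, dotProduct_mulVec]
    congr 1
    simp only [dotProduct, Complex.ofReal_add, Complex.ofReal_sum, Complex.ofReal_mul,
      Complex.ofReal_neg, Complex.ofReal_pow, Complex.ofReal_div, Complex.ofReal_one,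
      Complex.ofReal_ofNat, add_mul, Finset.sum_mul]
    have : ∀ a, ((t ᵥ* B) a : ℂ) * Complex.I * ξ a = ((t ᵥ* B) a : ℂ) * ξ a * Complex.I := by
      intro a; ring
    simp only [this]
    ring
  simp_rw [e]
  rw [integral_const_mul, h]
  have h2 : ∑ a, (((t ᵥ* B) a : ℂ) * Complex.I) ^ 2 = -((t ⬝ᵥ (B * Bᵀ) *ᵥ t : ℝ) : ℂ) := by
    have : t ⬝ᵥ (B * Bᵀ) *ᵥ t = ∑ a, (t ᵥ* B) a ^ 2 := by
      rw [← mulVec_mulVec, dotProduct_mulVec, mulVec_transpose]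
      simp [dotProduct, sq]
    rw [this]
    push_cast
    simp [mul_pow]
  have h3 : ((Real.pi : ℂ) / (1 / 2)) ^ ((Fintype.card (Fin n) : ℂ) / 2) =
      ((Real.sqrt (2 * Real.pi) ^ n : ℝ) : ℂ) := by
    rw [Fintype.card_fin, show (Real.pi : ℂ) / (1 / 2) = ((2 * Real.pi : ℝ) : ℂ) by push_cast; ring,
      show ((n : ℂ) / 2) = (((n : ℝ) / 2 : ℝ) : ℂ) by push_cast; ring,
      ← Complex.ofReal_cpow (by positivity), Real.sqrt_eq_rpow, ← Real.rpow_natCast,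
      ← Real.rpow_mul (by positivity)]
    ring_nf
  rw [h2, h3, sub_eq_add_neg, Complex.exp_add]
  have h4 : -((t ⬝ᵥ (B * Bᵀ) *ᵥ t : ℝ) : ℂ) / (4 * (1 / 2)) =
      -((t ⬝ᵥ (B * Bᵀ) *ᵥ t / 2 : ℝ) : ℂ) := by
    push_cast; ring
  rw [h4]
  push_cast
  ring

/-- The Gaussian density. -/
def gaussDensity {n : ℕ} (A : Matrix (Fin n) (Fin n) ℝ) (m φ : Fin n → ℝ) : ℝ :=
  1 / Real.sqrt ((2 * Real.pi) ^ n * A.det) * Real.exp (-quad A (φ - m))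

theorem gaussDensity_nonneg {n : ℕ} (A : Matrix (Fin n) (Fin n) ℝ) (m φ : Fin n → ℝ) :
    0 ≤ gaussDensity A m φ := by
  unfold gaussDensity
  positivity

theorem continuous_gaussDensity {n : ℕ} (A : Matrix (Fin n) (Fin n) ℝ) (m : Fin n → ℝ) :
    Continuous (gaussDensity A m) := by
  have := continuous_quad A
  unfold gaussDensity
  fun_prop

/-- The Gaussian measure with mean `m` and covariance matrix `A`. -/
def gaussLaw {n : ℕ} (A : Matrix (Fin n) (Fin n) ℝ) (m : Fin n → ℝ) : Measure (Fin n → ℝ) :=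
  volume.withDensity fun φ => ENNReal.ofReal (gaussDensity A m φ)

theorem integral_gaussLaw {n : ℕ} (A : Matrix (Fin n) (Fin n) ℝ) (m : Fin n → ℝ)
    {E : Type*} [NormedAddCommGroup E] [NormedSpace ℝ E] (f : (Fin n → ℝ) → E) :
    ∫ φ, f φ ∂gaussLaw A m = ∫ φ, gaussDensity A m φ • f φ := by
  rw [gaussLaw, integral_withDensity_eq_integral_toReal_smul
    (continuous_gaussDensity A m).measurable.ennreal_ofReal (by simp)]
  simp_rw [ENNReal.toReal_ofReal (gaussDensity_nonneg A m _)]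

theorem gaussianAverage_eq_integral {n : ℕ} (A : Matrix (Fin n) (Fin n) ℝ) (m : Fin n → ℝ)
    (f : (Fin n → ℝ) → ℝ) : gaussianAverage A m f = ∫ φ, f φ ∂gaussLaw A m := by
  rw [integral_gaussLaw, gaussianAverage, ← integral_const_mul]
  refine integral_congr_ae (Filter.Eventually.of_forall fun φ => ?_)
  simp only [gaussDensity, smul_eq_mul]
  ring

theorem integrable_gaussLaw_iff {n : ℕ} {A : Matrix (Fin n) (Fin n) ℝ} {m : Fin n → ℝ}
    {f : (Fin n → ℝ) → ℝ} :
    Integrable f (gaussLaw A m) ↔ Integrable fun φ => f φ * gaussDensity A m φ := by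
  rw [gaussLaw, integrable_withDensity_iff
    (continuous_gaussDensity A m).measurable.ennreal_ofReal (by simp)]
  simp_rw [ENNReal.toReal_ofReal (gaussDensity_nonneg A m _)]

theorem sqrt_det_pos {n : ℕ} {A : Matrix (Fin n) (Fin n) ℝ} (hA : A.PosDef) :
    0 < Real.sqrt ((2 * Real.pi) ^ n * A.det) := by
  have := hA.det_pos
  positivity

theorem gaussLaw_charFun {n : ℕ} {A : Matrix (Fin n) (Fin n) ℝ} (hA : A.PosDef)
    (m t : Fin n → ℝ) :
    ∫ φ, Complex.exp ((t ⬝ᵥ φ : ℝ) * Complex.I) ∂gaussLaw A m =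
      Complex.exp ((t ⬝ᵥ m : ℝ) * Complex.I - (t ⬝ᵥ A *ᵥ t / 2 : ℝ)) := by
  rw [integral_gaussLaw]
  have hd := sqrt_det_pos hA
  have e : ∀ φ, gaussDensity A m φ • Complex.exp ((t ⬝ᵥ φ : ℝ) * Complex.I) =
      ((1 / Real.sqrt ((2 * Real.pi) ^ n * A.det) : ℝ) : ℂ) *
        (Complex.exp ((t ⬝ᵥ φ : ℝ) * Complex.I) * (Real.exp (-quad A (φ - m)) : ℝ)) := by
    intro φ
    rw [Complex.real_smul, gaussDensity, Complex.ofReal_mul]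
    ring
  simp_rw [e]
  rw [integral_const_mul, integral_cexp_mul_exp_neg_quad hA, ← mul_assoc, ← Complex.ofReal_mul,
    one_div, inv_mul_cancel₀ hd.ne']
  simp

theorem isProbabilityMeasure_gaussLaw {n : ℕ} {A : Matrix (Fin n) (Fin n) ℝ} (hA : A.PosDef)
    (m : Fin n → ℝ) : IsProbabilityMeasure (gaussLaw A m) := by
  have h := gaussLaw_charFun hA m 0
  simp only [zero_dotProduct, Complex.ofReal_zero, zero_mul, Complex.exp_zero, integral_const,
    zero_div, sub_zero] at h
  have h1 : (gaussLaw A m).real Set.univ = 1 := by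
    have := congrArg Complex.re h
    simpa using this
  constructor
  rw [measureReal_def] at h1
  exact (ENNReal.toReal_eq_one_iff _).1 h1

/-- A finite measure on `ℝⁿ` is determined by its characteristic function. -/
theorem measure_ext_of_dotProduct {n : ℕ} {P P' : Measure (Fin n → ℝ)} [IsFiniteMeasure P]
    [IsFiniteMeasure P'] (h : ∀ t : Fin n → ℝ, ∫ φ, Complex.exp ((t ⬝ᵥ φ : ℝ) * Complex.I) ∂P =
      ∫ φ, Complex.exp ((t ⬝ᵥ φ : ℝ) * Complex.I) ∂P') : P = P' := by
  refine Measure.ext_of_charFunDual (funext fun L => ?_)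
  rw [charFunDual_apply, charFunDual_apply]
  have hL : ∀ φ : Fin n → ℝ, L φ = (fun a => L (Pi.single a 1)) ⬝ᵥ φ := by
    intro φ
    have hφ : φ = ∑ a, φ a • (Pi.single a 1 : Fin n → ℝ) := by
      funext b
      simp [Finset.sum_apply, Pi.single_apply]
    conv_lhs => rw [hφ, map_sum]
    exact Finset.sum_congr rfl fun a _ => by rw [map_smul, smul_eq_mul, mul_comm]
  have h' := h fun a => L (Pi.single a 1)
  simp only [← hL] at h'
  exact h'

/-- Reduces integrability and moments to the Gaussian measure on the line. -/
theorem map_dotProduct_gaussLaw {n : ℕ} {A : Matrix (Fin n) (Fin n) ℝ} (hA : A.PosDef)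
    (m t : Fin n → ℝ) :
    (gaussLaw A m).map (fun φ => t ⬝ᵥ φ) =
      ProbabilityTheory.gaussianReal (t ⬝ᵥ m) (t ⬝ᵥ A *ᵥ t).toNNReal := by
  have := isProbabilityMeasure_gaussLaw hA m
  have hm : Measurable fun φ : Fin n → ℝ => t ⬝ᵥ φ := by
    unfold dotProduct
    fun_prop
  have := Measure.isProbabilityMeasure_map (μ := gaussLaw A m) hm.aemeasurable
  refine Measure.ext_of_charFun (funext fun s => ?_)
  rw [ProbabilityTheory.charFun_gaussianReal, charFun_apply_real, integral_map hm.aemeasurable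
    (by fun_prop)]
  have h := gaussLaw_charFun hA m (s • t)
  have h0 : 0 ≤ t ⬝ᵥ A *ᵥ t := by simpa using hA.posSemidef.dotProduct_mulVec_nonneg t
  rw [smul_dotProduct, smul_dotProduct, mulVec_smul, dotProduct_smul] at h
  simp only [smul_dotProduct, smul_eq_mul, Complex.ofReal_mul] at h
  rw [h, Real.coe_toNNReal _ h0]
  congr 1
  push_cast
  ring

end LegendreQFT

end

noncomputable section

namespace LegendreQFT

/-! ### Moments of Gaussian measures -/

theorem memLp_eval_gaussLaw {n : ℕ} {A : Matrix (Fin n) (Fin n) ℝ} (hA : A.PosDef)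
    (m : Fin n → ℝ) (a : Fin n) {p : ENNReal} (hp : p ≠ ⊤) :
    MemLp (fun φ : Fin n → ℝ => φ a) p (gaussLaw A m) := by
  have h := map_dotProduct_gaussLaw hA m (Pi.single a 1)
  simp only [single_dotProduct, one_mul] at h
  have h2 := ProbabilityTheory.memLp_id_gaussianReal' (μ := m a)
    (v := (A *ᵥ (Pi.single a 1 : Fin n → ℝ)) a |>.toNNReal) p hp
  rw [← h] at h2
  exact (memLp_map_measure_iff (g := id) (f := fun φ : Fin n → ℝ => φ a) (by fun_prop)
    (measurable_pi_apply a).aemeasurable).1 h2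

theorem memLp_norm_gaussLaw {n : ℕ} {A : Matrix (Fin n) (Fin n) ℝ} (hA : A.PosDef)
    (m : Fin n → ℝ) {p : ENNReal} (hp : p ≠ ⊤) :
    MemLp (fun φ : Fin n → ℝ => ‖φ‖) p (gaussLaw A m) := by
  have h : MemLp (fun φ : Fin n → ℝ => ∑ a, |φ a|) p (gaussLaw A m) :=
    memLp_finsetSum _ fun a _ => (memLp_eval_gaussLaw hA m a hp).abs
  refine h.mono (by fun_prop) (Filter.Eventually.of_forall fun φ => ?_)
  have h0 : 0 ≤ ∑ a, |φ a| := Finset.sum_nonneg fun a _ => abs_nonneg _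
  rw [norm_norm, Real.norm_eq_abs, abs_of_nonneg h0, pi_norm_le_iff_of_nonneg h0]
  exact fun a => Finset.single_le_sum (f := fun a => |φ a|) (fun a _ => abs_nonneg _)
    (Finset.mem_univ a)

theorem integrable_gaussLaw_of_le {n : ℕ} {A : Matrix (Fin n) (Fin n) ℝ} (hA : A.PosDef)
    (m : Fin n → ℝ) {f : (Fin n → ℝ) → ℝ} (hf : Measurable f) {C : ℝ} {N : ℕ}
    (h : ∀ φ, |f φ| ≤ C * (1 + ‖φ‖) ^ N) : Integrable f (gaussLaw A m) := by
  have := isProbabilityMeasure_gaussLaw hA m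
  have h1 : MemLp (fun φ : Fin n → ℝ => 1 + ‖φ‖) N (gaussLaw A m) :=
    (memLp_const (1 : ℝ)).add (memLp_norm_gaussLaw hA m (ENNReal.natCast_ne_top N))
  have h2 : Integrable (fun φ : Fin n → ℝ => C * ‖1 + ‖φ‖‖ ^ N) (gaussLaw A m) :=
    h1.integrable_norm_pow'.const_mul C
  refine h2.mono' hf.aestronglyMeasurable (Filter.Eventually.of_forall fun φ => ?_)
  rw [Real.norm_eq_abs, Real.norm_eq_abs, abs_of_nonneg (by positivity : 0 ≤ 1 + ‖φ‖)]
  exact h φ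

theorem Gamma_natCast_add_half (k : ℕ) : Real.Gamma ((k : ℝ) + 1 / 2) =
    Real.sqrt Real.pi * (2 * k).factorial / (4 ^ k * k.factorial) := by
  induction k with
  | zero => simp [← Real.Gamma_one_half_eq]
  | succ k ih =>
    have h1 : ((k + 1 : ℕ) : ℝ) + 1 / 2 = ((k : ℝ) + 1 / 2) + 1 := by push_cast; ring
    rw [h1, Real.Gamma_add_one (by positivity), ih, show 2 * (k + 1) = 2 * k + 1 + 1 by ring,
      Nat.factorial_succ (2 * k + 1), Nat.factorial_succ (2 * k), Nat.factorial_succ k]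
    push_cast
    field_simp
    ring

theorem integral_pow_gaussianReal_one (k : ℕ) :
    ∫ x, x ^ (2 * k) ∂ProbabilityTheory.gaussianReal 0 1 =
      (2 * k).factorial / (2 ^ k * k.factorial) := by
  rw [ProbabilityTheory.integral_gaussianReal_eq_integral_smul one_ne_zero]
  have e : ∀ x : ℝ, ProbabilityTheory.gaussianPDFReal 0 1 x • x ^ (2 * k) =
      (Real.sqrt (2 * Real.pi))⁻¹ * (|x| ^ (2 * (k : ℝ)) * Real.exp (-(1 / 2) * |x| ^ (2 : ℝ))) := by
    intro x
    rw [ProbabilityTheory.gaussianPDFReal_def]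
    simp only [NNReal.coe_one, mul_one, sub_zero, smul_eq_mul]
    rw [show (2 * (k : ℝ)) = ((2 * k : ℕ) : ℝ) by push_cast; ring, Real.rpow_natCast,
      Real.rpow_two, sq_abs, pow_mul, pow_mul, sq_abs]
    rw [show -(1 / 2) * x ^ 2 = -x ^ 2 / 2 by ring]
    ring
  simp_rw [e]
  rw [integral_const_mul, integral_comp_abs (f := fun x => x ^ (2 * (k : ℝ)) *
    Real.exp (-(1 / 2) * x ^ (2 : ℝ))), integral_rpow_mul_exp_neg_mul_rpow (by norm_num)
    (by have : (0 : ℝ) ≤ k := by positivity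
        linarith) (by norm_num), show (2 * (k : ℝ) + 1) / 2 = k + 1 / 2 by ring]
  have hG := Gamma_natCast_add_half k
  rw [hG, neg_div, show (2 * (k : ℝ) + 1) / 2 = k + 1 / 2 by ring, Real.rpow_neg (by norm_num),
    Real.rpow_add (by norm_num), ← Real.sqrt_eq_rpow, Real.rpow_natCast, Real.sqrt_mul (by norm_num),
    Real.sqrt_div (by norm_num), Real.sqrt_one]
  have h4 : (4 : ℝ) ^ k = 2 ^ k * 2 ^ k := by rw [← mul_pow]; norm_num
  have hpi : Real.sqrt Real.pi ≠ 0 := by positivity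
  rw [h4, one_div, inv_pow]
  field_simp

/-- As a function of `t` this is the generating identity from which all mixed moments of total
degree `2 k` are read off. -/
theorem integral_dotProduct_pow {n : ℕ} {A : Matrix (Fin n) (Fin n) ℝ} (hA : A.PosDef)
    (t : Fin n → ℝ) (k : ℕ) :
    ∫ φ, (t ⬝ᵥ φ) ^ (2 * k) ∂gaussLaw A 0 =
      (2 * k).factorial / (2 ^ k * k.factorial) * (t ⬝ᵥ A *ᵥ t) ^ k := by
  have h0 : 0 ≤ t ⬝ᵥ A *ᵥ t := by simpa using hA.posSemidef.dotProduct_mulVec_nonneg t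
  have hm : Measurable fun φ : Fin n → ℝ => t ⬝ᵥ φ := by
    unfold dotProduct
    fun_prop
  have h := map_dotProduct_gaussLaw hA 0 t
  rw [← integral_map (f := fun x : ℝ => x ^ (2 * k)) hm.aemeasurable (by fun_prop), h,
    dotProduct_zero]
  have h2 := ProbabilityTheory.gaussianReal_map_const_mul (μ := 0) (v := 1) (Real.sqrt (t ⬝ᵥ A *ᵥ t))
  have h3 : NNReal.mk (Real.sqrt (t ⬝ᵥ A *ᵥ t) ^ 2) (sq_nonneg _) * 1 =
      (t ⬝ᵥ A *ᵥ t).toNNReal := by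
    ext
    simp [Real.sq_sqrt h0, h0]
  rw [h3, mul_zero] at h2
  rw [← h2, integral_map (by fun_prop) (by fun_prop)]
  simp_rw [mul_pow]
  rw [integral_const_mul, integral_pow_gaussianReal_one, pow_mul, Real.sq_sqrt h0]
  ring

theorem prod_pow_abs_le {n : ℕ} (β : Fin n → ℕ) (φ : Fin n → ℝ) :
    |∏ a, φ a ^ β a| ≤ (1 + ‖φ‖) ^ ∑ a, β a := by
  rw [Finset.abs_prod, ← Finset.prod_pow_eq_pow_sum]
  refine Finset.prod_le_prod (fun a _ => abs_nonneg _) fun a _ => ?_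
  rw [abs_pow]
  refine pow_le_pow_left₀ (abs_nonneg _) ?_ _
  have := norm_le_pi_norm φ a
  rw [Real.norm_eq_abs] at this
  linarith

theorem integrable_prod_pow_gaussLaw {n : ℕ} {A : Matrix (Fin n) (Fin n) ℝ} (hA : A.PosDef)
    (m : Fin n → ℝ) (β : Fin n → ℕ) :
    Integrable (fun φ : Fin n → ℝ => ∏ a, φ a ^ β a) (gaussLaw A m) :=
  integrable_gaussLaw_of_le hA m (by fun_prop) (C := 1) (N := ∑ a, β a) fun φ => by
    rw [one_mul]
    exact prod_pow_abs_le β φ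

theorem dotProduct_pow_eq {n : ℕ} (t φ : Fin n → ℝ) (k : ℕ) :
    (t ⬝ᵥ φ) ^ k = ∑ ν ∈ Finset.piAntidiag Finset.univ k,
      (Nat.multinomial Finset.univ ν : ℝ) * (∏ a, t a ^ ν a) * ∏ a, φ a ^ ν a := by
  rw [dotProduct, Finset.sum_pow_eq_sum_piAntidiag]
  refine Finset.sum_congr rfl fun ν _ => ?_
  simp_rw [mul_pow, Finset.prod_mul_distrib]
  ring

end LegendreQFT

end

noncomputable section

namespace LegendreQFT

/-! ### Wick's theorem -/

/-- The unordered pairs, as ordered pairs `a ≤ b`. -/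
def lePairs (n : ℕ) : Finset (Fin n × Fin n) := Finset.univ.filter fun p => p.1 ≤ p.2

/-- The number of line ends at the vertex `a`. -/
def lineDegree {n : ℕ} (l : Fin n × Fin n → ℕ) (a : Fin n) : ℕ :=
  ∑ p ∈ lePairs n, ((if p.1 = a then l p else 0) + if p.2 = a then l p else 0)

/-- The weight of a line. -/
def lineWeight {n : ℕ} (A : Matrix (Fin n) (Fin n) ℝ) (p : Fin n × Fin n) : ℝ :=
  if p.1 = p.2 then A p.1 p.2 / 2 else A p.1 p.2

/-- Each pair `a < b` occurs twice in the double sum and each diagonal term once; this is the reason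
for the factor `1/2` in `lineWeight` on the diagonal. -/
theorem half_dotProduct_mulVec {n : ℕ} {A : Matrix (Fin n) (Fin n) ℝ} (hA : A.IsSymm)
    (t : Fin n → ℝ) :
    t ⬝ᵥ A *ᵥ t / 2 = ∑ p ∈ lePairs n, lineWeight A p * (t p.1 * t p.2) := by
  have h1 : t ⬝ᵥ A *ᵥ t = ∑ p : Fin n × Fin n, A p.1 p.2 * (t p.1 * t p.2) := by
    rw [Fintype.sum_prod_type]
    simp only [dotProduct, mulVec, Finset.mul_sum]
    exact Finset.sum_congr rfl fun a _ => Finset.sum_congr rfl fun b _ => by ring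
  have h2 : ∑ p : Fin n × Fin n with ¬ p.1 ≤ p.2, A p.1 p.2 * (t p.1 * t p.2) =
      ∑ p : Fin n × Fin n with p.1 < p.2, A p.1 p.2 * (t p.1 * t p.2) := by
    refine Finset.sum_nbij' Prod.swap Prod.swap ?_ ?_ ?_ ?_ ?_
    · simp
    · simp
    · simp
    · simp
    · intro p _
      rw [Prod.fst_swap, Prod.snd_swap, hA.apply]
      ring
  have h3 : ∑ p : Fin n × Fin n with p.1 < p.2, A p.1 p.2 * (t p.1 * t p.2) =
      ∑ p ∈ lePairs n, if p.1 = p.2 then 0 else A p.1 p.2 * (t p.1 * t p.2) := by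
    rw [lePairs, Finset.sum_filter, Finset.sum_filter]
    refine Finset.sum_congr rfl fun p _ => ?_
    rcases lt_trichotomy p.1 p.2 with h | h | h
    · simp [h, h.le, h.ne]
    · simp [h]
    · simp [h.not_gt, h.not_ge]
  rw [h1, ← Finset.sum_filter_add_sum_filter_not _ fun p : Fin n × Fin n => p.1 ≤ p.2, h2, h3,
    show Finset.univ.filter (fun p : Fin n × Fin n => p.1 ≤ p.2) = lePairs n from rfl,
    ← Finset.sum_add_distrib, Finset.sum_div]
  refine Finset.sum_congr rfl fun p _ => ?_
  unfold lineWeight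
  split_ifs <;> ring

theorem prod_pair_pow {n : ℕ} {R : Type*} [CommMonoid R] (t : Fin n → R) (l : Fin n × Fin n → ℕ) :
    ∏ p ∈ lePairs n, (t p.1 * t p.2) ^ l p = ∏ a, t a ^ lineDegree l a := by
  simp only [lineDegree, ← Finset.prod_pow_eq_pow_sum]
  rw [Finset.prod_comm]
  refine Finset.prod_congr rfl fun p _ => ?_
  simp_rw [pow_add, Finset.prod_mul_distrib, pow_ite, pow_zero]
  rw [Finset.prod_ite_eq, Finset.prod_ite_eq, if_pos (Finset.mem_univ _), if_pos (Finset.mem_univ _),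
    mul_pow]

theorem sum_lineDegree {n : ℕ} (l : Fin n × Fin n → ℕ) :
    ∑ a, lineDegree l a = 2 * ∑ p ∈ lePairs n, l p := by
  unfold lineDegree
  rw [Finset.sum_comm, Finset.mul_sum]
  refine Finset.sum_congr rfl fun p _ => ?_
  rw [Finset.sum_add_distrib, Finset.sum_ite_eq, Finset.sum_ite_eq]
  simp [two_mul]

/-- Polarization: the average of `(t ⬝ᵥ φ) ^ (2 k)` is expanded once over the monomials in `φ` and
once, after integration, by the multinomial theorem for the quadratic form over pairs `a ≤ b`.
Comparing coefficients of `t ^ β` gives the moment. -/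
theorem integral_prod_pow_gaussLaw {n : ℕ} {A : Matrix (Fin n) (Fin n) ℝ} (hA : A.PosDef)
    {k : ℕ} {β : Fin n → ℕ} (hβ : ∑ a, β a = 2 * k) :
    ∫ φ, ∏ a, φ a ^ β a ∂gaussLaw A 0 = (∏ a, ((β a).factorial : ℝ)) *
      ∑ l ∈ (Finset.piAntidiag (lePairs n) k).filter fun l => lineDegree l = β,
        ∏ p ∈ lePairs n, (lineWeight A p ^ l p / (l p).factorial) := by
  classical
  set M : (Fin n → ℕ) → ℝ := fun ν => ∫ φ, ∏ a, φ a ^ ν a ∂gaussLaw A 0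
  let toF : (Fin n → ℕ) → (Fin n →₀ ℕ) := Finsupp.equivFunOnFinite.symm
  have hmon : ∀ (ν : Fin n → ℕ) (t : Fin n → ℝ) (r : ℝ),
      MvPolynomial.eval t (MvPolynomial.monomial (toF ν) r) = r * ∏ a, t a ^ ν a := by
    intro ν t r
    rw [MvPolynomial.eval_monomial, Finsupp.prod_fintype _ _ (by simp)]
    rfl
  -- Equality at all real `t` gives equality of multivariate polynomials, so that coefficients may
  -- be compared.
  have key : (∑ ν ∈ Finset.piAntidiag Finset.univ (2 * k),
      MvPolynomial.monomial (toF ν) ((Nat.multinomial Finset.univ ν : ℝ) * M ν)) =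
      ∑ l ∈ Finset.piAntidiag (lePairs n) k, MvPolynomial.monomial (toF (lineDegree l))
        ((2 * k).factorial * ∏ p ∈ lePairs n, (lineWeight A p ^ l p / (l p).factorial)) := by
    refine MvPolynomial.funext fun t => ?_
    rw [map_sum, map_sum]
    simp_rw [hmon]
    have h1 := integral_dotProduct_pow hA t k
    rw [integral_congr_ae (Filter.Eventually.of_forall fun φ => dotProduct_pow_eq t φ (2 * k))] at h1
    rw [integral_finsetSum _ fun ν _ => (integrable_prod_pow_gaussLaw hA 0 ν).const_mul _] at h1
    simp_rw [integral_const_mul] at h1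
    have h2 : ∀ ν : Fin n → ℕ, (Nat.multinomial Finset.univ ν : ℝ) * M ν * ∏ a, t a ^ ν a =
        (Nat.multinomial Finset.univ ν : ℝ) * (∏ a, t a ^ ν a) * ∫ φ, ∏ a, φ a ^ ν a ∂gaussLaw A 0 :=
      fun ν => by simp only [M]; ring
    simp_rw [h2]
    rw [h1]
    have h3 : (t ⬝ᵥ A *ᵥ t) ^ k = 2 ^ k * (t ⬝ᵥ A *ᵥ t / 2) ^ k := by
      rw [← mul_pow]; congr 1; ring
    rw [h3, half_dotProduct_mulVec (PosDef.isSymm hA), Finset.sum_pow_eq_sum_piAntidiag,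
      Finset.mul_sum, Finset.mul_sum]
    refine Finset.sum_congr rfl fun l hl => ?_
    rw [Finset.mem_piAntidiag] at hl
    have h4 : (Nat.multinomial (lePairs n) l : ℝ) =
        k.factorial / ∏ p ∈ lePairs n, ((l p).factorial : ℝ) := by
      have := Nat.multinomial_spec (lePairs n) l
      rw [hl.1] at this
      rw [eq_div_iff (Finset.prod_ne_zero_iff.2 fun p _ => by positivity), mul_comm]
      exact_mod_cast this
    have h5 : ∏ p ∈ lePairs n, ((l p).factorial : ℝ) ≠ 0 :=
      Finset.prod_ne_zero_iff.2 fun p _ => by positivity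
    simp_rw [mul_pow (lineWeight A _), Finset.prod_mul_distrib, prod_pair_pow, h4,
      Finset.prod_div_distrib]
    field_simp
  have hc := congrArg (MvPolynomial.coeff (toF β)) key
  rw [MvPolynomial.coeff_sum, MvPolynomial.coeff_sum] at hc
  simp_rw [MvPolynomial.coeff_monomial, toF, Finsupp.equivFunOnFinite.symm.injective.eq_iff] at hc
  rw [Finset.sum_ite_eq' , if_pos (by simpa using hβ), ← Finset.sum_filter, ← Finset.mul_sum] at hc
  have hm : (Nat.multinomial Finset.univ β : ℝ) * ∏ a, ((β a).factorial : ℝ) =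
      (2 * k).factorial := by
    have := Nat.multinomial_spec Finset.univ β
    rw [hβ, mul_comm] at this
    exact_mod_cast this
  have hne : ((2 * k).factorial : ℝ) ≠ 0 := by positivity
  refine mul_left_cancel₀ hne ?_
  rw [mul_left_comm, ← hc, ← hm]
  simp only [M]
  ring

/-- The symmetric array belonging to the numbers of lines between pairs `a ≤ b`. -/
def lineArray {n : ℕ} (l : Fin n × Fin n → ℕ) (a b : Fin n) : ℕ :=
  if a = b then 2 * l (a, a) else if a < b then l (a, b) else l (b, a)

theorem sum_lineArray {n : ℕ} (l : Fin n × Fin n → ℕ) (a : Fin n) :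
    ∑ b, lineArray l a b = lineDegree l a := by
  unfold lineDegree lePairs
  rw [Finset.sum_filter, Fintype.sum_prod_type]
  have h : ∀ x y : Fin n, (if x ≤ y then ((if x = a then l (x, y) else 0) +
      if y = a then l (x, y) else 0) else 0) =
      (if x = a then (if a ≤ y then l (a, y) else 0) else 0) +
      (if y = a then (if x ≤ a then l (x, a) else 0) else 0) := by
    intro x y
    by_cases h1 : x = a <;> by_cases h2 : y = a <;> simp [h1, h2]
  simp_rw [h, Finset.sum_add_distrib]
  rw [Finset.sum_comm]
  simp only [Finset.sum_ite_eq', Finset.mem_univ, if_true]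
  rw [← Finset.sum_add_distrib]
  refine Finset.sum_congr rfl fun b _ => ?_
  unfold lineArray
  rcases lt_trichotomy a b with h | h | h
  · simp [h.ne, h, h.le, h.not_ge]
  · subst h; simp [two_mul]
  · simp [h.ne', h.not_gt, h.le, h.not_ge]

theorem prod_lePairs {n : ℕ} {R : Type*} [CommMonoid R] (f : Fin n × Fin n → R) :
    ∏ p ∈ lePairs n, f p = (∏ p : Fin n × Fin n with p.1 < p.2, f p) * ∏ a, f (a, a) := by
  rw [lePairs, ← Finset.prod_filter_mul_prod_filter_not _ fun p => p.1 < p.2,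
    Finset.filter_filter, Finset.filter_filter]
  congr 1
  · refine Finset.prod_congr ?_ fun _ _ => rfl
    ext p
    simp
    exact le_of_lt
  · symm
    refine Finset.prod_nbij' (fun a => (a, a)) Prod.fst ?_ ?_ ?_ ?_ ?_
    · simp
    · simp
    · simp
    · rintro ⟨x, y⟩ h
      simp at h ⊢
      exact le_antisymm h.1 h.2
    · simp

/-- Wick's theorem in terms of line numbers. -/
theorem integral_prod_pow_eq_lineSum {n : ℕ} {c : ℝ} (hc : c ≠ 0) {A : Matrix (Fin n) (Fin n) ℝ}
    (hA : A.PosDef) (hd : ∀ a, A a a = c) {k : ℕ} {β : Fin n → ℕ} (hβ : ∑ a, β a = 2 * k) :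
    ∫ φ, ∏ a, φ a ^ β a ∂gaussLaw A 0 = c ^ k * lineSum c A β := by
  rw [integral_prod_pow_gaussLaw hA hβ, lineSum, Finset.mul_sum, Finset.mul_sum]
  -- A line from a vertex to itself has two ends there, so the number of such lines is half the
  -- diagonal entry. Below the diagonal the inverse map is zero, in agreement with the support
  -- condition of `piAntidiag`.
  refine Finset.sum_bij' (fun l _ => lineArray l) (fun L _ p =>
    if p.1 ≤ p.2 then (if p.1 = p.2 then L p.1 p.2 / 2 else L p.1 p.2) else 0) ?_ ?_ ?_ ?_ ?_
  · intro l hl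
    rw [Finset.mem_filter, Finset.mem_piAntidiag] at hl
    have hdeg : ∀ a, ∑ b, lineArray l a b = β a := fun a => by rw [sum_lineArray, hl.2]
    simp only [lineNumbers, Finset.mem_filter, Fintype.mem_piFinset, Finset.mem_range]
    refine ⟨fun a b => Nat.lt_succ_of_le ?_, fun a b => ?_, hdeg, fun a => ?_⟩
    · rw [← hdeg a]
      exact Finset.single_le_sum (f := fun b => lineArray l a b) (fun _ _ => Nat.zero_le _)
        (Finset.mem_univ b)
    · unfold lineArray
      rcases lt_trichotomy a b with h | h | h
      · simp [h.ne, h, h.ne', h.not_gt]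
      · subst h; rfl
      · simp [h.ne, h, h.ne', h.not_gt]
    · simp [lineArray]
  · intro L hL
    simp only [lineNumbers, Finset.mem_filter, Fintype.mem_piFinset, Finset.mem_range] at hL
    obtain ⟨-, hs, hdeg, hev⟩ := hL
    set l : Fin n × Fin n → ℕ := fun p =>
      if p.1 ≤ p.2 then (if p.1 = p.2 then L p.1 p.2 / 2 else L p.1 p.2) else 0
    have hl : lineArray l = L := by
      funext a b
      unfold lineArray
      rcases lt_trichotomy a b with h | h | h
      · simp [l, h.ne, h, h.le]
      · subst h
        simp [l]
        exact Nat.mul_div_cancel' (hev a).two_dvd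
      · simp [l, h.ne, h.ne', h.le, h.not_gt, hs a b]
    have hdeg' : lineDegree l = β := by
      funext a
      rw [← sum_lineArray, hl, hdeg]
    rw [Finset.mem_filter, Finset.mem_piAntidiag]
    refine ⟨⟨?_, fun p hp => ?_⟩, hdeg'⟩
    · have := sum_lineDegree l
      rw [hdeg', hβ] at this
      lia
    · by_contra hn
      simp [lePairs] at hn
      simp only [l] at hp
      rw [if_neg (by simpa using hn)] at hp
      exact hp rfl
  · intro l hl
    rw [Finset.mem_filter, Finset.mem_piAntidiag] at hl
    funext ⟨a, b⟩
    simp only [lineArray]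
    rcases lt_trichotomy a b with h | h | h
    · simp [h.ne, h, h.le]
    · subst h; simp
    · simp only [h.not_ge, if_false]
      by_contra hne
      have := hl.1.2 (a, b) (fun h0 => hne h0.symm)
      simp [lePairs] at this
      exact absurd h this.not_gt
  · intro L hL
    simp only [lineNumbers, Finset.mem_filter, Fintype.mem_piFinset, Finset.mem_range] at hL
    obtain ⟨-, hs, hdeg, hev⟩ := hL
    funext a b
    simp only [lineArray]
    rcases lt_trichotomy a b with h | h | h
    · simp [h.ne, h, h.le]
    · subst h
      simp
      exact Nat.mul_div_cancel' (hev a).two_dvd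
    · simp [h.ne, h.ne', h.le, h.not_gt, hs a b]
  · intro l hl
    rw [Finset.mem_filter, Finset.mem_piAntidiag] at hl
    have hk := hl.1.1
    rw [prod_lePairs]
    have e1 : ∀ p ∈ Finset.univ.filter (fun p : Fin n × Fin n => p.1 < p.2),
        lineWeight A p ^ l p / (l p).factorial =
          c ^ l p * ((A p.1 p.2 / c) ^ lineArray l p.1 p.2) *
            ((lineArray l p.1 p.2).factorial : ℝ)⁻¹ := by
      intro p hp
      simp at hp
      simp only [lineWeight, lineArray, hp.ne, hp, if_false, if_true, div_pow]
      field_simp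
    have e2 : ∀ a : Fin n, lineWeight A (a, a) ^ l (a, a) / (l (a, a)).factorial =
        c ^ l (a, a) * (2 ^ (lineArray l a a / 2))⁻¹ * ((lineArray l a a / 2).factorial : ℝ)⁻¹ := by
      intro a
      simp only [lineWeight, lineArray, if_true, hd, div_pow, Nat.mul_div_cancel_left _ two_pos]
      field_simp
    have e3 : c ^ k = (∏ p : Fin n × Fin n with p.1 < p.2, c ^ l p) * ∏ a, c ^ l (a, a) := by
      rw [← prod_lePairs (fun p => c ^ l p), Finset.prod_pow_eq_pow_sum, hk]
    rw [Finset.prod_congr rfl e1, Finset.prod_congr rfl fun a _ => e2 a, e3]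
    simp only [Finset.prod_mul_distrib, Finset.prod_inv_distrib, Finset.prod_pow_eq_pow_sum]
    field_simp

end LegendreQFT

end

noncomputable section

namespace LegendreQFT

/-! ### Homogeneous functions under Gaussian averages -/

-- Polar coordinates for an arbitrary norm; in the application the norm is the supremum norm, and
-- only homogeneity of the integrand matters.
open MeasureTheory.Measure in
theorem integral_eq_integral_sphere {E : Type*} [NormedAddCommGroup E] [NormedSpace ℝ E]
    [FiniteDimensional ℝ E] [Nontrivial E] [MeasurableSpace E] [BorelSpace E] (μ : Measure E)
    [μ.IsAddHaarMeasure] {f : E → ℝ} (hf : Integrable f μ) :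
    ∫ x, f x ∂μ = ∫ x : Metric.sphere (0 : E) 1,
      (∫ r in Set.Ioi (0 : ℝ), r ^ (Module.finrank ℝ E - 1) * f (r • (x : E))) ∂μ.toSphere := by
  have hmp := μ.measurePreserving_homeomorphUnitSphereProd
  have hemb := (homeomorphUnitSphereProd E).measurableEmbedding
  set g : Metric.sphere (0 : E) 1 × Set.Ioi (0 : ℝ) → ℝ := fun p => f ((p.2 : ℝ) • (p.1 : E))
  have hg : ∀ x : ({(0)}ᶜ : Set E), g (homeomorphUnitSphereProd E x) = f x := by
    intro x
    have : ((homeomorphUnitSphereProd E).symm (homeomorphUnitSphereProd E x) : E) = x := by simp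
    rw [← this]
    rfl
  have hint : Integrable g (μ.toSphere.prod (volumeIoiPow (Module.finrank ℝ E - 1))) := by
    rw [← hmp.integrable_comp_emb hemb]
    have : g ∘ (homeomorphUnitSphereProd E) = f ∘ (Subtype.val) := funext hg
    rw [this, ← integrableOn_iff_comap_subtypeVal (measurableSet_singleton _).compl]
    exact hf.integrableOn
  calc ∫ x, f x ∂μ = ∫ x : ({(0)}ᶜ : Set E), f x ∂(μ.comap (↑)) := by
        rw [integral_subtype_comap (measurableSet_singleton _).compl f, restrict_compl_singleton]
    _ = ∫ x, g x ∂μ.toSphere.prod (volumeIoiPow (Module.finrank ℝ E - 1)) := by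
        rw [← hmp.integral_comp hemb]
        simp_rw [hg]
    _ = _ := by
        rw [integral_prod _ hint]
        refine integral_congr_ae (Filter.Eventually.of_forall fun x => ?_)
        simp only [volumeIoiPow, ENNReal.ofReal]
        rw [integral_withDensity_eq_integral_smul,
          integral_subtype_comap measurableSet_Ioi fun r =>
            Real.toNNReal (r ^ (Module.finrank ℝ E - 1)) • f (r • (x : E)),
          setIntegral_congr_fun measurableSet_Ioi fun r hr => ?_]
        · simp only [NNReal.smul_def, smul_eq_mul]
          rw [Real.coe_toNNReal _ (pow_nonneg (Set.mem_Ioi.1 hr).le _)]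
        · exact (measurable_subtype_coe.pow_const _).real_toNNReal

/-- On the ray through `x` the form is `r² Q(x)`, so the radial integral is a Gamma function times
`Q(x) ^ (-(n + D)/2 - s)`. The factor `Q(x) ^ (-s)` cancels `Q(x) ^ s`, and the integral over the
sphere no longer involves `s`. -/
theorem integral_sphere_gamma {n : ℕ} (hn : 0 < n) {A : Matrix (Fin n) (Fin n) ℝ} (hA : A.PosDef)
    {F : (Fin n → ℝ) → ℝ} {D : ℕ} (hF : ∀ (r : ℝ) φ, F (r • φ) = r ^ D * F φ) {s : ℝ}
    (hs : 0 < n + D + 2 * s)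
    (hi : Integrable fun φ => F φ * quad A φ ^ s * Real.exp (-quad A φ)) :
    ∫ φ, F φ * quad A φ ^ s * Real.exp (-quad A φ) = Real.Gamma ((n + D) / 2 + s) *
      ∫ x : Metric.sphere (0 : Fin n → ℝ) 1, F x * quad A x ^ (-(n + D : ℝ) / 2) * (1 / 2)
        ∂(volume : Measure (Fin n → ℝ)).toSphere := by
  have : Nonempty (Fin n) := ⟨⟨0, hn⟩⟩
  rw [integral_eq_integral_sphere _ hi, ← integral_const_mul]
  refine integral_congr_ae (Filter.Eventually.of_forall fun x => ?_)
  simp only [Module.finrank_fin_fun]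
  have hx : (x : Fin n → ℝ) ≠ 0 := fun h => by
    have := x.2
    rw [mem_sphere_zero_iff_norm, h, norm_zero] at this
    exact zero_ne_one this
  have hQ := quad_pos hA hx
  have e : ∀ r ∈ Set.Ioi (0 : ℝ), r ^ (n - 1) * (F (r • (x : Fin n → ℝ)) *
      quad A (r • (x : Fin n → ℝ)) ^ s * Real.exp (-quad A (r • (x : Fin n → ℝ)))) =
      F x * quad A x ^ s * (r ^ ((n : ℝ) + D + 2 * s - 1) *
        Real.exp (-quad A x * r ^ (2 : ℝ))) := by
    intro r hr
    have hr0 : 0 < r := hr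
    rw [hF, quad_smul, Real.mul_rpow (sq_nonneg r) hQ.le, ← Real.rpow_natCast r 2,
      ← Real.rpow_mul hr0.le, show (n : ℝ) + D + 2 * s - 1 = ((n - 1 : ℕ) : ℝ) + (D : ℝ) + 2 * s by
        rw [Nat.cast_sub hn]; push_cast; ring, Real.rpow_add hr0, Real.rpow_add hr0]
    simp only [Real.rpow_natCast, Nat.cast_ofNat, Real.rpow_two]
    rw [show -(r ^ 2 * quad A x) = -quad A x * r ^ 2 by ring]
    ring
  rw [setIntegral_congr_fun measurableSet_Ioi e, integral_const_mul,
    integral_rpow_mul_exp_neg_mul_rpow two_pos (by linarith) hQ,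
    show -((n : ℝ) + D + 2 * s - 1 + 1) / 2 = -(n + D) / 2 + -s by ring, Real.rpow_add hQ,
    show ((n : ℝ) + D + 2 * s - 1 + 1) / 2 = (n + D) / 2 + s by ring, Real.rpow_neg hQ.le s]
  have : quad A x ^ s ≠ 0 := (Real.rpow_pos_of_pos hQ s).ne'
  field_simp

/-- The average of a homogeneous function times a power of `Q`. -/
theorem integral_mul_quad_rpow {n : ℕ} (hn : 0 < n) {A : Matrix (Fin n) (Fin n) ℝ} (hA : A.PosDef)
    {F : (Fin n → ℝ) → ℝ} {D : ℕ} (hF : ∀ (r : ℝ) φ, F (r • φ) = r ^ D * F φ) {s : ℝ}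
    (hs : 0 < n + D + 2 * s)
    (hi : Integrable (fun φ => F φ * quad A φ ^ s) (gaussLaw A 0))
    (hi' : Integrable F (gaussLaw A 0)) :
    ∫ φ, F φ * quad A φ ^ s ∂gaussLaw A 0 =
      Real.Gamma ((n + D) / 2 + s) / Real.Gamma ((n + D) / 2) * ∫ φ, F φ ∂gaussLaw A 0 := by
  have hd := (sqrt_det_pos hA).ne'
  have cvt : ∀ {f : (Fin n → ℝ) → ℝ}, Integrable f (gaussLaw A 0) →
      Integrable fun φ => f φ * Real.exp (-quad A φ) := by
    intro f hf
    rw [integrable_gaussLaw_iff] at hf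
    have := hf.mul_const (Real.sqrt ((2 * Real.pi) ^ n * A.det))
    refine this.congr (Filter.Eventually.of_forall fun φ => ?_)
    simp only [gaussDensity, sub_zero]
    field_simp
  have h0 : ∀ f : (Fin n → ℝ) → ℝ, ∫ φ, f φ ∂gaussLaw A 0 =
      1 / Real.sqrt ((2 * Real.pi) ^ n * A.det) * ∫ φ, f φ * Real.exp (-quad A φ) := by
    intro f
    rw [← gaussianAverage_eq_integral]
    simp [gaussianAverage]
  have e1 := integral_sphere_gamma hn hA hF hs (cvt hi)
  -- The case `s = 0` has the same spherical integral, which is eliminated between the two formulas.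
  have e2 := integral_sphere_gamma hn hA hF (s := 0) (by positivity) (by simpa using cvt hi')
  simp only [Real.rpow_zero, mul_one, add_zero] at e2
  have hG : Real.Gamma (((n : ℝ) + D) / 2) ≠ 0 := (Real.Gamma_pos_of_pos (by positivity)).ne'
  rw [h0, h0, e1, e2]
  field_simp

end LegendreQFT

end

noncomputable section

namespace LegendreQFT

/-! ### Expansion in the mean -/

theorem gaussDensity_neg {n : ℕ} (A : Matrix (Fin n) (Fin n) ℝ) (m φ : Fin n → ℝ) :
    gaussDensity A m (-φ) = gaussDensity A (-m) φ := by
  unfold gaussDensity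
  rw [← quad_neg, neg_sub, sub_neg_eq_add, sub_neg_eq_add, add_comm]

theorem integral_gaussLaw_comp_neg {n : ℕ} (A : Matrix (Fin n) (Fin n) ℝ) (m : Fin n → ℝ)
    (f : (Fin n → ℝ) → ℝ) :
    ∫ φ, f (-φ) ∂gaussLaw A m = ∫ φ, f φ ∂gaussLaw A (-m) := by
  rw [integral_gaussLaw, integral_gaussLaw,
    ← integral_neg_eq_self (fun φ => gaussDensity A (-m) φ • f φ)]
  simp_rw [gaussDensity_neg, neg_neg]

theorem gaussDensity_eq_mul {n : ℕ} {A : Matrix (Fin n) (Fin n) ℝ} (hA : A.IsSymm)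
    (m φ : Fin n → ℝ) : gaussDensity A m φ =
      Real.exp (-quad A m) * (Real.exp ((A⁻¹ *ᵥ m) ⬝ᵥ φ) * gaussDensity A 0 φ) := by
  unfold gaussDensity
  rw [quad_sub hA, sub_zero, neg_sub, sub_add_eq_sub_sub, sub_eq_add_neg, sub_eq_add_neg,
    Real.exp_add, Real.exp_add]
  ring

theorem integrable_mul_exp_gaussLaw {n : ℕ} {A : Matrix (Fin n) (Fin n) ℝ} (hA : A.PosDef)
    (m : Fin n → ℝ) {f : (Fin n → ℝ) → ℝ} (hf : Integrable f (gaussLaw A m)) :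
    Integrable (fun φ => f φ * Real.exp ((A⁻¹ *ᵥ m) ⬝ᵥ φ)) (gaussLaw A 0) := by
  rw [integrable_gaussLaw_iff] at hf ⊢
  refine (hf.const_mul (Real.exp (quad A m))).congr (Filter.Eventually.of_forall fun φ => ?_)
  simp only
  rw [gaussDensity_eq_mul (PosDef.isSymm hA) m, Real.exp_neg]
  field_simp

theorem integral_gaussLaw_eq_integral_mul_exp {n : ℕ} {A : Matrix (Fin n) (Fin n) ℝ}
    (hA : A.PosDef) (m : Fin n → ℝ) (f : (Fin n → ℝ) → ℝ) :
    ∫ φ, f φ ∂gaussLaw A m =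
      Real.exp (-quad A m) * ∫ φ, f φ * Real.exp ((A⁻¹ *ᵥ m) ⬝ᵥ φ) ∂gaussLaw A 0 := by
  rw [integral_gaussLaw, integral_gaussLaw, ← integral_const_mul]
  refine integral_congr_ae (Filter.Eventually.of_forall fun φ => ?_)
  simp only [smul_eq_mul]
  rw [gaussDensity_eq_mul (PosDef.isSymm hA) m]
  ring

/-- Expansion of the average of an even function in powers of `χ = A⁻¹ m`. -/
theorem hasSum_integral_gaussLaw {n : ℕ} {A : Matrix (Fin n) (Fin n) ℝ} (hA : A.PosDef)
    (m : Fin n → ℝ) {f : (Fin n → ℝ) → ℝ} (hf : Measurable f) {C : ℝ} {N : ℕ}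
    (hb : ∀ φ, |f φ| ≤ C * (1 + ‖φ‖) ^ N) (he : ∀ φ, f (-φ) = f φ) :
    HasSum (fun k : ℕ => Real.exp (-quad A m) *
      (1 / (2 * k).factorial * ∫ φ, f φ * ((A⁻¹ *ᵥ m) ⬝ᵥ φ) ^ (2 * k) ∂gaussLaw A 0))
      (∫ φ, f φ ∂gaussLaw A m) := by
  rw [integral_gaussLaw_eq_integral_mul_exp hA m]
  refine HasSum.mul_left _ ?_
  set χ := A⁻¹ *ᵥ m with hχ
  have hχm : Measurable fun φ : Fin n → ℝ => χ ⬝ᵥ φ := by unfold dotProduct; fun_prop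
  have i1 : Integrable (fun φ => f φ * Real.exp (χ ⬝ᵥ φ)) (gaussLaw A 0) :=
    integrable_mul_exp_gaussLaw hA m (integrable_gaussLaw_of_le hA m hf hb)
  have i2 : Integrable (fun φ => f φ * Real.exp (-(χ ⬝ᵥ φ))) (gaussLaw A 0) := by
    have := integrable_mul_exp_gaussLaw hA (-m) (integrable_gaussLaw_of_le hA (-m) hf hb)
    simpa only [mulVec_neg, neg_dotProduct] using this
  have e2 : ∫ φ, f φ * Real.exp (-(χ ⬝ᵥ φ)) ∂gaussLaw A 0 =
      ∫ φ, f φ * Real.exp (χ ⬝ᵥ φ) ∂gaussLaw A 0 := by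
    have := integral_gaussLaw_comp_neg A 0 fun φ => f φ * Real.exp (χ ⬝ᵥ φ)
    simpa only [he, dotProduct_neg, neg_zero] using this
  -- Averaging over `φ` and `-φ` replaces the exponential by `cosh`; only even powers of `χ ⬝ᵥ φ`
  -- remain.
  have e3 : ∫ φ, f φ * Real.exp (χ ⬝ᵥ φ) ∂gaussLaw A 0 =
      ∫ φ, f φ * Real.cosh (χ ⬝ᵥ φ) ∂gaussLaw A 0 := by
    have : ∀ φ, f φ * Real.cosh (χ ⬝ᵥ φ) =
        (1 / 2) * (f φ * Real.exp (χ ⬝ᵥ φ) + f φ * Real.exp (-(χ ⬝ᵥ φ))) := by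
      intro φ
      rw [Real.cosh_eq]
      ring
    simp_rw [this]
    rw [integral_const_mul, integral_add i1 i2, e2]
    ring
  have hcosh : ∀ φ, HasSum (fun k : ℕ => f φ * ((χ ⬝ᵥ φ) ^ (2 * k) / (2 * k).factorial))
      (f φ * Real.cosh (χ ⬝ᵥ φ)) := fun φ => (Real.hasSum_cosh _).mul_left _
  rw [e3]
  have key : HasSum (fun k : ℕ => ∫ φ, f φ * ((χ ⬝ᵥ φ) ^ (2 * k) / (2 * k).factorial) ∂gaussLaw A 0)
      (∫ φ, f φ * Real.cosh (χ ⬝ᵥ φ) ∂gaussLaw A 0) := by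
    -- The terms of the `cosh` series are nonnegative, so multiplied by `|f|` they dominate
    -- themselves and sum to the integrable `|f| cosh`.
    refine hasSum_integral_of_dominated_convergence
      (fun k φ => |f φ| * ((χ ⬝ᵥ φ) ^ (2 * k) / (2 * k).factorial))
      (fun k => (by fun_prop : Measurable _).aestronglyMeasurable) ?_ ?_ ?_ ?_
    · refine fun k => Filter.Eventually.of_forall fun φ => ?_
      rw [norm_mul, Real.norm_eq_abs, Real.norm_eq_abs, abs_div, abs_of_nonneg (a := _ ^ _)
        (by rw [pow_mul]; positivity)]
      simp
    · exact Filter.Eventually.of_forall fun φ => ((Real.hasSum_cosh _).mul_left _).summable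
    · have : ∀ φ, ∑' k : ℕ, |f φ| * ((χ ⬝ᵥ φ) ^ (2 * k) / (2 * k).factorial) =
          |f φ| * Real.cosh (χ ⬝ᵥ φ) := fun φ => ((Real.hasSum_cosh _).mul_left _).tsum_eq
      simp_rw [this]
      have h3 := (i1.abs.add i2.abs).const_mul (1 / 2)
      refine h3.congr (Filter.Eventually.of_forall fun φ => ?_)
      simp only [Pi.add_apply, abs_mul, Real.abs_exp]
      rw [Real.cosh_eq]
      ring
    · exact Filter.Eventually.of_forall hcosh
  convert! key using 1
  funext k
  rw [← integral_const_mul]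
  refine integral_congr_ae (Filter.Eventually.of_forall fun φ => ?_)
  simp only
  ring

theorem Gamma_add_natCast {z : ℝ} (hz : 0 < z) (k : ℕ) :
    Real.Gamma (z + k) = (ascPochhammer ℝ k).eval z * Real.Gamma z := by
  induction k with
  | zero => simp
  | succ k ih =>
    rw [Nat.cast_succ, ← add_assoc, Real.Gamma_add_one (by positivity), ih, ascPochhammer_succ_eval]
    ring

/-- Converts the Taylor factor `1 / (2 k)!` into the prefactor `1 / (4 ^ k k! (1/2)_k)` of `kTerm`.
-/
theorem ascPochhammer_half (k : ℕ) : 4 ^ k * (k.factorial : ℝ) *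
    (ascPochhammer ℝ k).eval (1 / 2 : ℝ) = (2 * k).factorial := by
  induction k with
  | zero => simp
  | succ k ih =>
    rw [ascPochhammer_succ_eval, show 2 * (k + 1) = 2 * k + 1 + 1 by ring,
      Nat.factorial_succ (2 * k + 1), Nat.factorial_succ (2 * k), Nat.factorial_succ k]
    push_cast
    rw [← ih]
    ring

/-- The expansion in the form of the explicit series. -/
theorem hasSum_kTerm {n : ℕ} (c α : ℝ) {A : Matrix (Fin n) (Fin n) ℝ} (hA : A.PosDef)
    (m : Fin n → ℝ) {f : (Fin n → ℝ) → ℝ} (hf : Measurable f) {C : ℝ} {N : ℕ}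
    (hb : ∀ φ, |f φ| ≤ C * (1 + ‖φ‖) ^ N) (he : ∀ φ, f (-φ) = f φ)
    (inner : ℕ → (Fin n → ℕ) → ℝ)
    (hin : ∀ k, ∀ ν ∈ Finset.piAntidiag (Finset.univ : Finset (Fin n)) (2 * k),
      ∫ φ, f φ * ∏ a, φ a ^ ν a ∂gaussLaw A 0 =
        (2 * c) ^ (n * α / 2 : ℝ) * (ascPochhammer ℝ k).eval (n * (α + 1) / 2 : ℝ) * inner k ν) :
    HasSum (fun k => Real.exp (-quad A m) * kTerm c α A m inner k)
      (∫ φ, f φ ∂gaussLaw A m) := by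
  convert! hasSum_integral_gaussLaw hA m hf hb he using 1
  funext k
  congr 1
  have hi : ∀ ν ∈ Finset.piAntidiag (Finset.univ : Finset (Fin n)) (2 * k),
      Integrable (fun φ : Fin n → ℝ => f φ * ((Nat.multinomial Finset.univ ν : ℝ) *
        (∏ a, (A⁻¹ *ᵥ m) a ^ ν a) * ∏ a, φ a ^ ν a)) (gaussLaw A 0) := by
    intro ν _
    have : Integrable (fun φ : Fin n → ℝ => f φ * ∏ a, φ a ^ ν a) (gaussLaw A 0) := by
      refine integrable_gaussLaw_of_le hA 0 (by fun_prop) (C := C) (N := N + ∑ a, ν a) fun φ => ?_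
      rw [abs_mul, pow_add, ← mul_assoc]
      have := prod_pow_abs_le ν φ
      have h0 := (abs_nonneg _).trans (hb φ)
      exact mul_le_mul (hb φ) this (abs_nonneg _) h0
    convert! this.const_mul ((Nat.multinomial Finset.univ ν : ℝ) *
        (∏ a, (A⁻¹ *ᵥ m) a ^ ν a)) using 2
    ring
  simp_rw [dotProduct_pow_eq, Finset.mul_sum]
  rw [integral_finsetSum _ hi, kTerm, Finset.mul_sum, Finset.mul_sum]
  refine Finset.sum_congr rfl fun ν hν => ?_
  have e : ∀ φ : Fin n → ℝ, f φ * ((Nat.multinomial Finset.univ ν : ℝ) *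
        (∏ a, (A⁻¹ *ᵥ m) a ^ ν a) * ∏ a, φ a ^ ν a) = (Nat.multinomial Finset.univ ν : ℝ) *
        (∏ a, (A⁻¹ *ᵥ m) a ^ ν a) * (f φ * ∏ a, φ a ^ ν a) := fun φ => by ring
  simp_rw [e]
  rw [integral_const_mul, hin k ν hν, ← ascPochhammer_half k]
  have h1 : (ascPochhammer ℝ k).eval (1 / 2 : ℝ) ≠ 0 :=
    (ascPochhammer_pos k _ (by norm_num)).ne'
  field_simp

end LegendreQFT

end

noncomputable section

namespace LegendreQFT

/-! ### The Legendre expansion on the hypersphere -/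

/-- The minimum of `Q` over fields with prescribed `φ_a` is attained at a multiple of column `a` of
`A`. The claim is the nonnegativity of `Q` on the difference from that minimizer. -/
theorem sq_le_two_mul_quad {n : ℕ} {c : ℝ} (hc : 0 < c) {A : Matrix (Fin n) (Fin n) ℝ}
    (hA : A.PosDef) (hd : ∀ a, A a a = c) (φ : Fin n → ℝ) (a : Fin n) :
    φ a ^ 2 ≤ 2 * c * quad A φ := by
  have hu : IsUnit A.det := hA.det_pos.ne'.isUnit
  have h := quad_nonneg hA (φ - A *ᵥ Pi.single a (φ a / c))
  have h1 : A⁻¹ *ᵥ (A *ᵥ Pi.single a (φ a / c)) = Pi.single a (φ a / c) := by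
    rw [mulVec_mulVec, nonsing_inv_mul _ hu, one_mulVec]
  rw [quad_sub (PosDef.isSymm hA), quad_eq_dotProduct A (A *ᵥ _), h1, dotProduct_single,
    single_dotProduct, mulVec_single] at h
  simp only [Pi.smul_apply, col_apply, hd, MulOpposite.smul_eq_mul_unop, MulOpposite.unop_op] at h
  have h2 : quad A φ + 1 / 2 * (c * (φ a / c) * (φ a / c)) - φ a / c * φ a =
      quad A φ - φ a ^ 2 / (2 * c) := by
    field_simp
    ring
  rw [h2, sub_nonneg, div_le_iff₀ (by positivity)] at h
  linarith

/-- The variable `t` of the Legendre expansion. -/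
def sphereVar {n : ℕ} (c : ℝ) (A : Matrix (Fin n) (Fin n) ℝ) (φ : Fin n → ℝ) : ℝ :=
  (∏ a, |φ a|) / (2 * c * quad A φ) ^ (n / 2 : ℝ)

theorem sphereVar_mem {n : ℕ} {c : ℝ} (hc : 0 < c) {A : Matrix (Fin n) (Fin n) ℝ}
    (hA : A.PosDef) (hd : ∀ a, A a a = c) (φ : Fin n → ℝ) :
    sphereVar c A φ ∈ Set.Icc (0 : ℝ) 1 := by
  have hq : 0 ≤ 2 * c * quad A φ := mul_nonneg (by positivity) (quad_nonneg hA φ)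
  refine ⟨div_nonneg (Finset.prod_nonneg fun a _ => abs_nonneg _) (Real.rpow_nonneg hq _), ?_⟩
  refine div_le_one_of_le₀ ?_ (Real.rpow_nonneg hq _)
  calc ∏ a, |φ a| ≤ ∏ _a : Fin n, Real.sqrt (2 * c * quad A φ) := by
        refine Finset.prod_le_prod (fun a _ => abs_nonneg _) fun a _ => ?_
        rw [← Real.sqrt_sq_eq_abs]
        exact Real.sqrt_le_sqrt (sq_le_two_mul_quad hc hA hd φ a)
    _ = _ := by
        rw [Finset.prod_const, Finset.card_univ, Fintype.card_fin, Real.sqrt_eq_rpow,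
          ← Real.rpow_natCast, ← Real.rpow_mul hq]
        ring_nf

/-- The contribution of one Legendre polynomial. -/
def legendrePart {n : ℕ} (c α : ℝ) (A : Matrix (Fin n) (Fin n) ℝ) (q : ℕ) (φ : Fin n → ℝ) : ℝ :=
  (2 * c * quad A φ) ^ (n * α / 2 : ℝ) * (legendrePoly (2 * q)).eval (sphereVar c A φ)

theorem approxInteraction_eq_sum {n : ℕ} (c α : ℝ) (N : ℕ) (A : Matrix (Fin n) (Fin n) ℝ)
    (φ : Fin n → ℝ) : approxInteraction c α N A φ =
      ∑ q ∈ Finset.range (N + 1), legendreCoeff α q * legendrePart c α A q φ := by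
  unfold approxInteraction legendreApprox legendrePart sphereVar
  rw [Finset.mul_sum]
  exact Finset.sum_congr rfl fun q _ => by ring

theorem measurable_sphereVar {n : ℕ} (c : ℝ) (A : Matrix (Fin n) (Fin n) ℝ) :
    Measurable (sphereVar c A) := by
  have := (continuous_quad A).measurable
  unfold sphereVar
  fun_prop

theorem measurable_legendrePart {n : ℕ} (c α : ℝ) (A : Matrix (Fin n) (Fin n) ℝ) (q : ℕ) :
    Measurable (legendrePart c α A q) := by
  have := (continuous_quad A).measurable
  have h2 := (legendrePoly (2 * q)).continuous.measurable.comp (measurable_sphereVar c A)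
  unfold legendrePart
  exact ((this.const_mul _).pow_const _).mul h2

theorem abs_legendrePart_le {n : ℕ} {c : ℝ} (hc : 0 < c) (α : ℝ) {A : Matrix (Fin n) (Fin n) ℝ}
    (hA : A.PosDef) (hd : ∀ a, A a a = c) (q : ℕ) (φ : Fin n → ℝ) :
    |legendrePart c α A q φ| ≤ (2 * c * quad A φ) ^ (n * α / 2 : ℝ) := by
  have hq : 0 ≤ 2 * c * quad A φ := mul_nonneg (by positivity) (quad_nonneg hA φ)
  have ht := sphereVar_mem hc hA hd φ
  rw [legendrePart, abs_mul, abs_of_nonneg (Real.rpow_nonneg hq _)]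
  exact mul_le_of_le_one_right (Real.rpow_nonneg hq _) (abs_eval_legendrePoly_le _ ht.1 ht.2)

theorem exists_quad_le {n : ℕ} (A : Matrix (Fin n) (Fin n) ℝ) :
    ∃ K, 0 ≤ K ∧ ∀ φ, quad A φ ≤ K * ‖φ‖ ^ 2 := by
  refine ⟨1 / 2 * ∑ a, ∑ b, |A⁻¹ a b|, by positivity, fun φ => ?_⟩
  unfold quad
  rw [mul_assoc, Finset.sum_mul]
  refine mul_le_mul_of_nonneg_left (Finset.sum_le_sum fun a _ => ?_) (by norm_num)
  rw [Finset.sum_mul]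
  refine Finset.sum_le_sum fun b _ => (le_abs_self _).trans ?_
  have h1 := norm_le_pi_norm φ a
  have h2 := norm_le_pi_norm φ b
  rw [Real.norm_eq_abs] at h1 h2
  rw [abs_mul, abs_mul, mul_assoc, sq]
  exact mul_le_mul_of_nonneg_left (mul_le_mul h1 h2 (abs_nonneg _) (norm_nonneg _)) (abs_nonneg _)

theorem exists_rpow_quad_le {n : ℕ} {c : ℝ} (hc : 0 < c) {A : Matrix (Fin n) (Fin n) ℝ}
    (hA : A.PosDef) {p : ℝ} (hp : 0 ≤ p) :
    ∃ C : ℝ, ∃ N : ℕ, ∀ φ, (2 * c * quad A φ) ^ p ≤ C * (1 + ‖φ‖) ^ N := by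
  obtain ⟨K, hK, h⟩ := exists_quad_le A
  refine ⟨(1 + 2 * c * K) ^ ⌈p⌉₊, 2 * ⌈p⌉₊, fun φ => ?_⟩
  have hq : 0 ≤ 2 * c * quad A φ := mul_nonneg (by positivity) (quad_nonneg hA φ)
  have h1 : 2 * c * quad A φ ≤ (1 + 2 * c * K) * (1 + ‖φ‖) ^ 2 := by
    have h2 : ‖φ‖ ^ 2 ≤ (1 + ‖φ‖) ^ 2 := pow_le_pow_left₀ (norm_nonneg _) (by linarith) _
    calc 2 * c * quad A φ ≤ 2 * c * (K * ‖φ‖ ^ 2) :=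
          mul_le_mul_of_nonneg_left (h φ) (by positivity)
      _ = 2 * c * K * ‖φ‖ ^ 2 := by ring
      _ ≤ (1 + 2 * c * K) * (1 + ‖φ‖) ^ 2 :=
          mul_le_mul (by linarith) h2 (by positivity) (by positivity)
  have h3 : 1 ≤ (1 + 2 * c * K) * (1 + ‖φ‖) ^ 2 := by
    have h4 : 1 ≤ 1 + 2 * c * K := by
      have : 0 ≤ 2 * c * K := by positivity
      linarith
    have h5 : 1 ≤ (1 + ‖φ‖) ^ 2 := one_le_pow₀ (by linarith [norm_nonneg φ])
    nlinarith
  calc (2 * c * quad A φ) ^ p ≤ ((1 + 2 * c * K) * (1 + ‖φ‖) ^ 2) ^ p :=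
        Real.rpow_le_rpow hq h1 hp
    _ ≤ ((1 + 2 * c * K) * (1 + ‖φ‖) ^ 2) ^ (⌈p⌉₊ : ℝ) :=
        Real.rpow_le_rpow_of_exponent_le h3 (Nat.le_ceil p)
    _ = _ := by rw [Real.rpow_natCast, mul_pow, ← pow_mul]

theorem sphereVar_neg {n : ℕ} (c : ℝ) (A : Matrix (Fin n) (Fin n) ℝ) (φ : Fin n → ℝ) :
    sphereVar c A (-φ) = sphereVar c A φ := by
  simp [sphereVar, quad_neg]

theorem legendrePart_neg {n : ℕ} (c α : ℝ) (A : Matrix (Fin n) (Fin n) ℝ) (q : ℕ)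
    (φ : Fin n → ℝ) : legendrePart c α A q (-φ) = legendrePart c α A q φ := by
  simp [legendrePart, sphereVar_neg, quad_neg]

/-- Each Legendre part is a sum of monomials times powers of `Q`. -/
theorem legendrePart_mul_prod {n : ℕ} (hn : 0 < n) {c : ℝ} (hc : 0 < c) {α : ℝ} (hα : 0 < α)
    {A : Matrix (Fin n) (Fin n) ℝ} (hA : A.PosDef) (q : ℕ) (ν : Fin n → ℕ) (φ : Fin n → ℝ) :
    legendrePart c α A q φ * ∏ a, φ a ^ ν a = ∑ i ∈ Finset.range (q + 1),
      legCoef q i * (2 * c) ^ (n * α / 2 - n * i : ℝ) *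
        ((∏ a, φ a ^ (2 * i + ν a)) * quad A φ ^ (n * α / 2 - n * i : ℝ)) := by
  rw [legendrePart, eval_legendrePoly, Finset.mul_sum, Finset.sum_mul]
  refine Finset.sum_congr rfl fun i _ => ?_
  have hn' : (0 : ℝ) < n := by exact_mod_cast hn
  -- At the origin a power of `Q` with negative exponent has only a default value, but both sides
  -- vanish: the left through `0 < n α / 2`, the right through the monomial if `0 < i` and through
  -- `Q ^ (n α / 2)` if `i = 0`.
  by_cases hφ : φ = 0
  · subst hφ
    have hq : quad A 0 = 0 := by simp [quad]
    rw [hq, mul_zero, Real.zero_rpow (by positivity), zero_mul, zero_mul]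
    rcases Nat.eq_zero_or_pos i with rfl | hi
    · rw [Real.zero_rpow (by simp; constructor <;> positivity)]; simp
    · have : Nonempty (Fin n) := ⟨⟨0, hn⟩⟩
      rw [Finset.prod_eq_zero (Finset.mem_univ ⟨0, hn⟩)]
      · simp
      · simp; lia
  · have hQ := quad_pos hA hφ
    have h2 : (0 : ℝ) < 2 * c * quad A φ := by positivity
    have e1 : sphereVar c A φ ^ (2 * i) =
        (∏ a, φ a ^ (2 * i)) * (2 * c * quad A φ) ^ (-(n * i) : ℝ) := by
      rw [sphereVar, div_pow, ← Finset.prod_pow, div_eq_mul_inv, ← Real.rpow_natCast (_ ^ _),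
        ← Real.rpow_mul h2.le, ← Real.rpow_neg h2.le]
      congr 1
      · refine Finset.prod_congr rfl fun a _ => ?_
        rw [pow_mul, sq_abs, ← pow_mul]
      · congr 1
        push_cast
        ring
    have e2 : (2 * c) ^ (n * α / 2 - n * i : ℝ) * quad A φ ^ (n * α / 2 - n * i : ℝ) =
        (2 * c * quad A φ) ^ (n * α / 2 : ℝ) * (2 * c * quad A φ) ^ (-(n * i) : ℝ) := by
      rw [← Real.mul_rpow (by positivity) hQ.le, ← Real.rpow_add h2, sub_eq_add_neg]
    simp_rw [e1, pow_add, Finset.prod_mul_distrib]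
    calc _ = legCoef q i * ((2 * c * quad A φ) ^ (n * α / 2 : ℝ) *
          (2 * c * quad A φ) ^ (-(n * i) : ℝ)) * ((∏ a, φ a ^ (2 * i)) * ∏ a, φ a ^ ν a) := by ring
      _ = _ := by rw [← e2]; ring

/-- The exponent `s` may be negative. By `sq_le_two_mul_quad` the monomial is at most a multiple of
`Q ^ (D / 2)`, and the total exponent `D / 2 + s` is positive. -/
theorem integrable_prod_mul_quad_rpow {n : ℕ} {c : ℝ} (hc : 0 < c) {A : Matrix (Fin n) (Fin n) ℝ}
    (hA : A.PosDef) (hd : ∀ a, A a a = c) (β : Fin n → ℕ) {s : ℝ}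
    (hs : 0 < ((∑ a, β a : ℕ) : ℝ) / 2 + s) :
    Integrable (fun φ => (∏ a, φ a ^ β a) * quad A φ ^ s) (gaussLaw A 0) := by
  have hm := (continuous_quad A).measurable
  obtain ⟨C, N, h⟩ := exists_rpow_quad_le (c := 1 / 2) (by norm_num) hA hs.le
  set D := ((∑ a, β a : ℕ) : ℝ) with hD
  refine integrable_gaussLaw_of_le hA 0 (by fun_prop) (C := (2 * c) ^ (D / 2) * C) (N := N) fun φ => ?_
  have hφ := h φ
  rw [show 2 * (1 / 2) * quad A φ = quad A φ by ring] at hφ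
  rw [mul_assoc]
  refine le_trans ?_ (mul_le_mul_of_nonneg_left hφ (by positivity))
  have hq0 := quad_nonneg hA φ
  have h1 : |∏ a, φ a ^ β a| ≤ (2 * c * quad A φ) ^ (D / 2) := by
    rw [Finset.abs_prod]
    calc ∏ a, |φ a ^ β a| ≤ ∏ a, Real.sqrt (2 * c * quad A φ) ^ β a := by
          refine Finset.prod_le_prod (fun a _ => abs_nonneg _) fun a _ => ?_
          rw [abs_pow, ← Real.sqrt_sq_eq_abs]
          exact pow_le_pow_left₀ (Real.sqrt_nonneg _)
            (Real.sqrt_le_sqrt (sq_le_two_mul_quad hc hA hd φ a)) _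
      _ = _ := by
          rw [Finset.prod_pow_eq_pow_sum, Real.sqrt_eq_rpow, ← Real.rpow_natCast,
            ← Real.rpow_mul (by positivity)]
          congr 1
          rw [hD]; ring
  rw [abs_mul, abs_of_nonneg (Real.rpow_nonneg hq0 s)]
  rcases hq0.eq_or_lt with h0 | h0
  · rw [← h0, Real.zero_rpow hs.ne', mul_zero]
    have hφ0 : φ = 0 := by
      by_contra hne
      exact (quad_pos hA hne).ne h0
    -- For `s = 0` the convention `0 ^ 0 = 1` leaves the monomial alone; it vanishes at the origin
    -- because its degree is then positive.
    by_cases hs0 : s = 0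
    · have hD0 : ∃ a, β a ≠ 0 := by
        by_contra hcon
        push Not at hcon
        simp [hD, hcon, hs0] at hs
      obtain ⟨a, ha⟩ := hD0
      rw [Finset.prod_eq_zero (Finset.mem_univ a) (by rw [hφ0]; simp [ha])]
      simp
    · rw [Real.zero_rpow hs0, mul_zero]
  · calc |∏ a, φ a ^ β a| * quad A φ ^ s ≤ (2 * c * quad A φ) ^ (D / 2) * quad A φ ^ s :=
          mul_le_mul_of_nonneg_right h1 (Real.rpow_nonneg hq0 s)
      _ = _ := by
          rw [Real.mul_rpow (by positivity) hq0, mul_assoc, ← Real.rpow_add h0]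

/-- The average of a Legendre part times a monomial. -/
theorem integral_legendrePart_mul_prod {n : ℕ} (hn : 0 < n) {c : ℝ} (hc : 0 < c) {α : ℝ}
    (hα : 0 < α) {A : Matrix (Fin n) (Fin n) ℝ} (hA : A.PosDef) (hd : ∀ a, A a a = c) (q : ℕ)
    {k : ℕ} {ν : Fin n → ℕ} (hν : ∑ a, ν a = 2 * k) :
    legendreCoeff α q * ∫ φ, legendrePart c α A q φ * ∏ a, φ a ^ ν a ∂gaussLaw A 0 =
      (2 * c) ^ (n * α / 2 : ℝ) * (ascPochhammer ℝ k).eval (n * (α + 1) / 2 : ℝ) *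
        qTerm c α A k ν q := by
  have hn' : (0 : ℝ) < n := by exact_mod_cast hn
  have hβ : ∀ i, ∑ a, (2 * i + ν a) = 2 * (n * i + k) := by
    intro i
    rw [Finset.sum_add_distrib, hν]
    simp
    ring
  have hint : ∀ i ∈ Finset.range (q + 1), Integrable (fun φ : Fin n → ℝ =>
      (∏ a, φ a ^ (2 * i + ν a)) * quad A φ ^ (n * α / 2 - n * i : ℝ)) (gaussLaw A 0) := by
    intro i _
    refine integrable_prod_mul_quad_rpow hc hA hd _ ?_
    rw [hβ]
    push_cast
    have : 0 < n * α / 2 := by positivity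
    have : (0 : ℝ) ≤ k := by positivity
    linarith
  simp_rw [legendrePart_mul_prod hn hc hα hA]
  rw [integral_finsetSum _ fun i hi => (hint i hi).const_mul _]
  simp_rw [integral_const_mul]
  rw [qTerm, Finset.mul_sum, Finset.mul_sum]
  refine Finset.sum_congr rfl fun i hi => ?_
  have hiq : i ≤ q := by simp at hi; lia
  have hz : (0 : ℝ) < n * (α + 1) / 2 := by positivity
  rw [integral_mul_quad_rpow hn hA (D := 2 * (n * i + k)) (fun r φ => by
      simp_rw [Pi.smul_apply, smul_eq_mul, mul_pow, Finset.prod_mul_distrib]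
      rw [Finset.prod_pow_eq_pow_sum, hβ]) (by
      push_cast
      have : 0 < n * α / 2 := by positivity
      have : (0 : ℝ) ≤ k := by positivity
      linarith) (hint i hi) (integrable_prod_pow_gaussLaw hA 0 _),
    integral_prod_pow_eq_lineSum hc.ne' hA hd (hβ i)]
  -- Degree `2 (n i + k)` and exponent `n α / 2 - n i` combine so that `i` drops out. The Gamma
  -- function in the numerator is common to all terms, and its Pochhammer factor can be moved in
  -- front of the sum over `q`.
  have e1 : ((n : ℝ) + (2 * (n * i + k) : ℕ)) / 2 + (n * α / 2 - n * i) = n * (α + 1) / 2 + k := by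
    push_cast; ring
  have e2 : ((n : ℝ) + (2 * (n * i + k) : ℕ)) / 2 = n / 2 + n * i + k := by
    push_cast; ring
  have e3 : ∑ p ∈ Finset.range (q + 1), ((2 * q).choose (2 * p) : ℝ) * halfBinom q p *
      (1 / (2 * p + α + 1)) = legMoment α q / 4 ^ q := by
    rw [← sum_legCoef_div hα.le, Finset.sum_div]
    refine Finset.sum_congr rfl fun p hp => ?_
    rw [legCoef_eq_halfBinom (by simp at hp; lia)]
    field_simp
  have e4 : (2 * c) ^ (n * α / 2 - n * i : ℝ) =
      (2 * c) ^ (n * α / 2 : ℝ) * ((2 ^ (n * i))⁻¹ * (c ^ (n * i))⁻¹) := by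
    rw [Real.rpow_sub (by positivity), ← mul_inv, ← mul_pow, ← Real.rpow_natCast (2 * c) (n * i),
      div_eq_mul_inv]
    push_cast
    rfl
  have e5 : (2 : ℝ) ^ (4 * (q : ℤ) - n * i + 1) = 4 ^ q * 4 ^ q * 2 * (2 ^ (n * i))⁻¹ := by
    rw [zpow_add₀ two_ne_zero, zpow_sub₀ two_ne_zero, _root_.zpow_mul]
    have : (2 : ℝ) ^ ((n : ℤ) * i) = 2 ^ (n * i) := by exact_mod_cast zpow_natCast (2 : ℝ) (n * i)
    rw [this, ← mul_pow, zpow_natCast]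
    norm_num
    ring
  rw [e1, e2, e3, e4, e5, Gamma_add_natCast hz, legendreCoeff_eq hα.le, legCoef_eq_halfBinom hiq,
    pow_add]
  have h4 : (4 : ℝ) ^ q ≠ 0 := by positivity
  have h5 : c ^ (n * i) ≠ 0 := by positivity
  field_simp
  ring

end LegendreQFT

end

noncomputable section

namespace LegendreQFT

/-! ### The explicit series of the Gaussian averages -/

theorem integrable_legendrePart_mul_prod {n : ℕ} {c : ℝ} (hc : 0 < c) {α : ℝ}
    (hα : 0 ≤ α) {A : Matrix (Fin n) (Fin n) ℝ} (hA : A.PosDef) (hd : ∀ a, A a a = c)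
    (ν : Fin n → ℕ) :
    Integrable (fun φ => (2 * c * quad A φ) ^ (n * α / 2 : ℝ) * |∏ a, φ a ^ ν a|) (gaussLaw A 0) ∧
    ∀ q, Integrable (fun φ => legendrePart c α A q φ * ∏ a, φ a ^ ν a) (gaussLaw A 0) := by
  have hmq := (continuous_quad A).measurable
  obtain ⟨C, N, hCN⟩ := exists_rpow_quad_le hc hA (p := n * α / 2) (by positivity)
  have h0 : ∀ φ, 0 ≤ (2 * c * quad A φ) ^ (n * α / 2 : ℝ) := fun φ =>
    Real.rpow_nonneg (mul_nonneg (by positivity) (quad_nonneg hA φ)) _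
  have key : Integrable (fun φ => (2 * c * quad A φ) ^ (n * α / 2 : ℝ) * |∏ a, φ a ^ ν a|)
      (gaussLaw A 0) := by
    refine integrable_gaussLaw_of_le hA 0 (by fun_prop) (C := C) (N := N + ∑ a, ν a) fun φ => ?_
    rw [abs_mul, abs_abs, abs_of_nonneg (h0 φ), pow_add, ← mul_assoc]
    exact mul_le_mul (hCN φ) (prod_pow_abs_le ν φ) (abs_nonneg _) ((h0 φ).trans (hCN φ))
  refine ⟨key, fun q => ?_⟩
  have hm := measurable_legendrePart c α A q
  refine key.mono' (by fun_prop) (Filter.Eventually.of_forall fun φ => ?_)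
  rw [Real.norm_eq_abs, abs_mul]
  exact mul_le_mul_of_nonneg_right (abs_legendrePart_le hc α hA hd q φ) (abs_nonneg _)

theorem measurable_approxInteraction {n : ℕ} (c α : ℝ) (N : ℕ) (A : Matrix (Fin n) (Fin n) ℝ) :
    Measurable (approxInteraction c α N A) := by
  have h : approxInteraction c α N A = fun φ =>
      ∑ q ∈ Finset.range (N + 1), legendreCoeff α q * legendrePart c α A q φ :=
    funext fun φ => approxInteraction_eq_sum c α N A φ
  rw [h]
  exact Finset.measurable_sum _ fun q _ => (measurable_legendrePart c α A q).const_mul _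

theorem abs_approxInteraction_le {n : ℕ} {c : ℝ} (hc : 0 < c) (α : ℝ) (N : ℕ)
    {A : Matrix (Fin n) (Fin n) ℝ} (hA : A.PosDef) (hd : ∀ a, A a a = c) (φ : Fin n → ℝ) :
    |approxInteraction c α N A φ| ≤
      (∑ q ∈ Finset.range (N + 1), |legendreCoeff α q|) * (2 * c * quad A φ) ^ (n * α / 2 : ℝ) := by
  rw [approxInteraction_eq_sum, Finset.sum_mul]
  refine (Finset.abs_sum_le_sum_abs _ _).trans (Finset.sum_le_sum fun q _ => ?_)
  rw [abs_mul]
  exact mul_le_mul_of_nonneg_left (abs_legendrePart_le hc α hA hd q φ) (abs_nonneg _)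

theorem prod_rpow_eq {n : ℕ} (hn : 0 < n) {c : ℝ} (hc : 0 < c) {α : ℝ} (hα : 0 < α)
    {A : Matrix (Fin n) (Fin n) ℝ} (hA : A.PosDef) (φ : Fin n → ℝ) :
    ∏ a, |φ a| ^ α = (2 * c * quad A φ) ^ (n * α / 2 : ℝ) * sphereVar c A φ ^ α := by
  rw [Real.finsetProd_rpow _ _ fun a _ => abs_nonneg _]
  have hp : 0 ≤ ∏ a, |φ a| := Finset.prod_nonneg fun a _ => abs_nonneg _
  have hn' : (0 : ℝ) < n := by exact_mod_cast hn
  by_cases hφ : φ = 0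
  · subst hφ
    have hq : quad A 0 = 0 := by simp [quad]
    rw [hq, mul_zero, Real.zero_rpow (by positivity), zero_mul, Finset.prod_eq_zero
      (Finset.mem_univ ⟨0, hn⟩) (by simp), Real.zero_rpow hα.ne']
  · have hQ := quad_pos hA hφ
    have h2 : (0 : ℝ) < 2 * c * quad A φ := by positivity
    rw [sphereVar, Real.div_rpow hp (by positivity), ← Real.rpow_mul h2.le,
      show (n : ℝ) / 2 * α = n * α / 2 by ring]
    field_simp

theorem hasSum_legendrePart {n : ℕ} (hn : 0 < n) {c : ℝ} (hc : 0 < c) {α : ℝ} (h1 : 1 ≤ α)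
    (h2 : α ≤ 2) {A : Matrix (Fin n) (Fin n) ℝ} (hA : A.PosDef) (hd : ∀ a, A a a = c)
    (φ : Fin n → ℝ) :
    HasSum (fun q => legendreCoeff α q * legendrePart c α A q φ) (∏ a, |φ a| ^ α) := by
  rw [prod_rpow_eq hn hc (by linarith) hA]
  have := (hasSum_legendreCoeff_mul h1 h2 (sphereVar_mem hc hA hd φ)).mul_left
    ((2 * c * quad A φ) ^ (n * α / 2 : ℝ))
  refine this.congr_fun fun q => ?_
  unfold legendrePart
  ring

/-- The approximated interaction is an even function of polynomial growth and a finite sum of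
Legendre parts, so the inner `q`-sum is obtained by linearity alone. Only `0 < α` is needed. -/
theorem approxSeries_spec {n : ℕ} (hn : 0 < n) {c : ℝ} (hc : 0 < c) {α : ℝ} (hα : 0 < α)
    {A : Matrix (Fin n) (Fin n) ℝ} (hA : A.PosDef) (hd : ∀ a, A a a = c) (m : Fin n → ℝ) (N : ℕ) :
    Summable (kTerm c α A m (qPartialSum c α A N)) ∧
      gaussianAverage A m (approxInteraction c α N A) = approxSeries c α N A m := by
  obtain ⟨C, M, hCM⟩ := exists_rpow_quad_le hc hA (p := n * α / 2) (by positivity)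
  have hs := hasSum_kTerm c α hA m (measurable_approxInteraction c α N A)
    (C := (∑ q ∈ Finset.range (N + 1), |legendreCoeff α q|) * C) (N := M) (fun φ => by
      refine (abs_approxInteraction_le hc α N hA hd φ).trans ?_
      rw [mul_assoc _ C]
      exact mul_le_mul_of_nonneg_left (hCM φ) (Finset.sum_nonneg fun _ _ => abs_nonneg _))
    (fun φ => by simp_rw [approxInteraction_eq_sum, legendrePart_neg])
    (qPartialSum c α A N) (fun k ν hν => by
      have hi := (integrable_legendrePart_mul_prod hc hα.le hA hd ν).2
      simp_rw [approxInteraction_eq_sum, Finset.sum_mul, mul_assoc]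
      rw [integral_finsetSum _ fun q _ => (hi q).const_mul _]
      simp_rw [integral_const_mul]
      rw [qPartialSum, Finset.mul_sum, Finset.mul_sum]
      refine Finset.sum_congr rfl fun q _ => ?_
      rw [integral_legendrePart_mul_prod hn hc hα hA hd q (Finset.mem_piAntidiag.1 hν).1]
      ring)
  refine ⟨(summable_mul_left_iff (Real.exp_pos _).ne').1 hs.summable, ?_⟩
  rw [gaussianAverage_eq_integral, approxSeries, ← tsum_mul_left, hs.tsum_eq]

/-- Since `|P_{2q}(t)| ≤ 1`, each `q`-term is dominated by `|c_{2q}|` times a fixed integrable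
function. Summability of the coefficients permits integration of the Legendre expansion against
every monomial. -/
theorem legendreSeries_spec {n : ℕ} (hn : 0 < n) {c : ℝ} (hc : 0 < c) {α : ℝ} (h1 : 1 ≤ α)
    (h2 : α ≤ 2) {A : Matrix (Fin n) (Fin n) ℝ} (hA : A.PosDef) (hd : ∀ a, A a a = c)
    (m : Fin n → ℝ) :
    (∀ k, ∀ ν ∈ Finset.piAntidiag (Finset.univ : Finset (Fin n)) (2 * k),
      Summable (qTerm c α A k ν)) ∧
    Summable (kTerm c α A m (qSum c α A)) ∧
      gaussianAverage A m (fun φ => ∏ a, |φ a| ^ α) = legendreSeries c α A m := by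
  have hα : 0 < α := by linarith
  have hmq := (continuous_quad A).measurable
  obtain ⟨C, M, hCM⟩ := exists_rpow_quad_le hc hA (p := n * α / 2) (by positivity)
  have hsum : ∀ k, ∀ ν ∈ Finset.piAntidiag (Finset.univ : Finset (Fin n)) (2 * k),
      HasSum (fun q => (2 * c) ^ (n * α / 2 : ℝ) *
        (ascPochhammer ℝ k).eval (n * (α + 1) / 2 : ℝ) * qTerm c α A k ν q)
        (∫ φ, (∏ a, |φ a| ^ α) * ∏ a, φ a ^ ν a ∂gaussLaw A 0) := by
    intro k ν hν
    have hi := integrable_legendrePart_mul_prod hc hα.le hA hd ν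
    simp_rw [← integral_legendrePart_mul_prod hn hc hα hA hd _ (Finset.mem_piAntidiag.1 hν).1,
      ← integral_const_mul]
    refine hasSum_integral_of_dominated_convergence
      (fun q φ => |legendreCoeff α q| *
        ((2 * c * quad A φ) ^ (n * α / 2 : ℝ) * |∏ a, φ a ^ ν a|))
      (fun q => ((hi.2 q).const_mul _).aestronglyMeasurable) ?_ ?_ ?_ ?_
    · refine fun q => Filter.Eventually.of_forall fun φ => ?_
      rw [norm_mul, norm_mul, Real.norm_eq_abs, Real.norm_eq_abs, Real.norm_eq_abs]
      exact mul_le_mul_of_nonneg_left (mul_le_mul_of_nonneg_right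
        (abs_legendrePart_le hc α hA hd q φ) (abs_nonneg _)) (abs_nonneg _)
    · exact Filter.Eventually.of_forall fun φ => (summable_abs_legendreCoeff h1 h2).mul_right _
    · simp_rw [tsum_mul_right]
      exact hi.1.const_mul _
    · refine Filter.Eventually.of_forall fun φ => ?_
      simp_rw [← mul_assoc]
      exact (hasSum_legendrePart hn hc h1 h2 hA hd φ).mul_right _
  have hpre : ∀ k, (2 * c) ^ (n * α / 2 : ℝ) *
      (ascPochhammer ℝ k).eval (n * (α + 1) / 2 : ℝ) ≠ 0 := fun k =>
    (mul_pos (by positivity) (ascPochhammer_pos k _ (by positivity))).ne'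
  have hs := hasSum_kTerm c α hA m (f := fun φ => ∏ a, |φ a| ^ α) (by fun_prop)
    (C := C) (N := M) (fun φ => by
      have ht := sphereVar_mem hc hA hd φ
      have hq : 0 ≤ (2 * c * quad A φ) ^ (n * α / 2 : ℝ) :=
        Real.rpow_nonneg (mul_nonneg (by positivity) (quad_nonneg hA φ)) _
      rw [prod_rpow_eq hn hc hα hA, abs_of_nonneg (mul_nonneg hq (Real.rpow_nonneg ht.1 _))]
      exact (mul_le_of_le_one_right hq (Real.rpow_le_one ht.1 ht.2 hα.le)).trans (hCM φ))
    (fun φ => by simp)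
    (qSum c α A) (fun k ν hν => by
      rw [qSum, ← tsum_mul_left, (hsum k ν hν).tsum_eq])
  refine ⟨fun k ν hν => (summable_mul_left_iff (hpre k)).1 (hsum k ν hν).summable,
    (summable_mul_left_iff (Real.exp_pos _).ne').1 hs.summable, ?_⟩
  rw [gaussianAverage_eq_integral, legendreSeries, ← tsum_mul_left, hs.tsum_eq]

theorem gTilde_diag {d n : ℕ} (G : Point d → ℝ) (x : Fin n → Point d) (Γ : SimpleGraph (Fin n))
    (s : SVars n) (a : Fin n) : gTilde G x Γ s a a = G 0 := by
  simp [gTilde]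

end LegendreQFT

end

noncomputable section

namespace LegendreQFT

/-! ### Smooth dependence of Gaussian integrals on the covariance matrix -/

/-- The quadratic form `½ ∑ K_ab φ_a φ_b`. -/
def halfForm {n : ℕ} (K : Matrix (Fin n) (Fin n) ℝ) (φ : Fin n → ℝ) : ℝ :=
  1 / 2 * ∑ a, ∑ b, K a b * φ a * φ b

theorem quad_eq_halfForm {n : ℕ} (A : Matrix (Fin n) (Fin n) ℝ) (φ : Fin n → ℝ) :
    quad A φ = halfForm A⁻¹ φ := rfl

theorem continuous_halfForm {n : ℕ} (K : Matrix (Fin n) (Fin n) ℝ) : Continuous (halfForm K) := by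
  unfold halfForm
  fun_prop

theorem abs_halfForm_le {n : ℕ} {K : Matrix (Fin n) (Fin n) ℝ} {M : ℝ}
    (hK : ∀ a b, |K a b| ≤ M) (φ : Fin n → ℝ) : |halfForm K φ| ≤ n ^ 2 * M * (φ ⬝ᵥ φ) := by
  have h0 : 0 ≤ φ ⬝ᵥ φ := Finset.sum_nonneg fun a _ => mul_self_nonneg _
  have h1 : ∀ a, φ a * φ a ≤ φ ⬝ᵥ φ := fun a =>
    Finset.single_le_sum (f := fun a => φ a * φ a) (fun a _ => mul_self_nonneg _)
      (Finset.mem_univ a)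
  have h2 : ∀ a b, |K a b * φ a * φ b| ≤ M * (φ ⬝ᵥ φ) := by
    intro a b
    rw [mul_assoc, abs_mul]
    refine mul_le_mul (hK a b) ?_ (abs_nonneg _) ((abs_nonneg _).trans (hK a b))
    rw [abs_le]
    constructor <;> nlinarith [h1 a, h1 b, sq_nonneg (φ a + φ b), sq_nonneg (φ a - φ b)]
  rw [halfForm, abs_mul]
  have h3 : |∑ a, ∑ b, K a b * φ a * φ b| ≤ n ^ 2 * (M * (φ ⬝ᵥ φ)) := by
    refine (Finset.abs_sum_le_sum_abs _ _).trans ?_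
    calc ∑ a, |∑ b, K a b * φ a * φ b| ≤ ∑ _a : Fin n, ∑ _b : Fin n, M * (φ ⬝ᵥ φ) :=
          Finset.sum_le_sum fun a _ => (Finset.abs_sum_le_sum_abs _ _).trans
            (Finset.sum_le_sum fun b _ => h2 a b)
      _ = _ := by simp; ring
  rw [abs_of_pos (by norm_num : (0 : ℝ) < 1 / 2)]
  have h4 := (abs_nonneg _).trans h3
  linarith

theorem posDef_smul_one {n : ℕ} {v : ℝ} (hv : 0 < v) :
    (v • (1 : Matrix (Fin n) (Fin n) ℝ)).PosDef := PosDef.one.smul hv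

theorem quad_smul_one {n : ℕ} {v : ℝ} (hv : 0 < v) (φ : Fin n → ℝ) :
    quad (v • (1 : Matrix (Fin n) (Fin n) ℝ)) φ = (φ ⬝ᵥ φ) / (2 * v) := by
  have h : (v • (1 : Matrix (Fin n) (Fin n) ℝ))⁻¹ = v⁻¹ • 1 := by
    apply inv_eq_left_inv
    simp [smul_smul, hv.ne']
  rw [quad_eq_dotProduct, h, smul_mulVec, one_mulVec, dotProduct_smul, smul_eq_mul]
  field_simp

theorem dotProduct_self_le {n : ℕ} (φ : Fin n → ℝ) : φ ⬝ᵥ φ ≤ n * (1 + ‖φ‖) ^ 2 := by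
  calc φ ⬝ᵥ φ ≤ ∑ _a : Fin n, (1 + ‖φ‖) ^ 2 := Finset.sum_le_sum fun a _ => by
        have := norm_le_pi_norm φ a
        rw [Real.norm_eq_abs] at this
        rw [← sq, ← sq_abs]
        exact pow_le_pow_left₀ (abs_nonneg _) (by linarith) _
    _ = _ := by simp

/-- The common dominating function for differentiation under the integral: an isotropic Gaussian of
variance `1 / (2 κ)`, a power of `φ ⬝ᵥ φ`, and a factor `1 + |φ - m|²` that absorbs the derivative
of the exponent. -/
theorem integrable_dotProduct_rpow_mul_exp {n : ℕ} (m : Fin n → ℝ) {κ w : ℝ} (hκ : 0 < κ)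
    (hw : 0 ≤ w) : Integrable fun φ : Fin n → ℝ =>
      (φ ⬝ᵥ φ) ^ w * (1 + (φ - m) ⬝ᵥ (φ - m)) * Real.exp (-(κ * ((φ - m) ⬝ᵥ (φ - m)))) := by
  have hv : 0 < 1 / (2 * κ) := by positivity
  have hpd := posDef_smul_one (n := n) hv
  have hs : ∀ φ : Fin n → ℝ, 0 ≤ φ ⬝ᵥ φ := fun φ =>
    Finset.sum_nonneg fun a _ => mul_self_nonneg _
  have hcont : Continuous fun φ : Fin n → ℝ => φ ⬝ᵥ φ := by unfold dotProduct; fun_prop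
  have hcont' : Continuous fun φ : Fin n → ℝ => (φ - m) ⬝ᵥ (φ - m) := by
    unfold dotProduct; fun_prop
  have h := integrable_gaussLaw_of_le hpd m
    (f := fun φ => (φ ⬝ᵥ φ) ^ w * (1 + (φ - m) ⬝ᵥ (φ - m)))
    (C := (1 + n) ^ ⌈w⌉₊ * ((1 + n) * (1 + ‖m‖) ^ 2)) (N := 2 * ⌈w⌉₊ + 2)
    (((hcont.measurable.pow_const _)).mul (by have := hcont'.measurable; fun_prop)) ?_
  · rw [integrable_gaussLaw_iff] at h
    have hd := sqrt_det_pos hpd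
    have h2 := h.const_mul (Real.sqrt ((2 * Real.pi) ^ n *
      ((1 / (2 * κ)) • (1 : Matrix (Fin n) (Fin n) ℝ)).det))
    refine h2.congr (Filter.Eventually.of_forall fun φ => ?_)
    simp only [gaussDensity, quad_smul_one hv]
    rw [show (φ - m) ⬝ᵥ (φ - m) / (2 * (1 / (2 * κ))) = κ * ((φ - m) ⬝ᵥ (φ - m)) by
      field_simp]
    field_simp
  · intro φ
    rw [abs_of_nonneg (mul_nonneg (Real.rpow_nonneg (hs _) _) (by linarith [hs (φ - m)]))]
    have hφ := norm_nonneg φ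
    have hm := norm_nonneg m
    have e1 : (1 : ℝ) ≤ (1 + ‖φ‖) ^ 2 := one_le_pow₀ (by linarith)
    have hn0 : (0 : ℝ) ≤ n := Nat.cast_nonneg n
    have e2 : (φ ⬝ᵥ φ) ^ w ≤ ((1 + n) * (1 + ‖φ‖) ^ 2) ^ ⌈w⌉₊ := by
      have e3 : φ ⬝ᵥ φ ≤ (1 + n) * (1 + ‖φ‖) ^ 2 := by
        have := dotProduct_self_le φ
        nlinarith
      refine (Real.rpow_le_rpow (hs φ) e3 hw).trans ?_
      rw [← Real.rpow_natCast _ ⌈w⌉₊]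
      have e5 : (1 : ℝ) ≤ (1 + n) * (1 + ‖φ‖) ^ 2 :=
        one_le_mul_of_one_le_of_one_le (by linarith) e1
      exact Real.rpow_le_rpow_of_exponent_le e5
        (Nat.le_ceil w)
    have e4 : 1 + (φ - m) ⬝ᵥ (φ - m) ≤ (1 + n) * (1 + ‖m‖) ^ 2 * (1 + ‖φ‖) ^ 2 := by
      have f1 := dotProduct_self_le (φ - m)
      have f2 := norm_sub_le φ m
      have f3 : (1 + ‖φ - m‖) ^ 2 ≤ ((1 + ‖m‖) * (1 + ‖φ‖)) ^ 2 :=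
        pow_le_pow_left₀ (by positivity) (by nlinarith) _
      have f4 : (1 : ℝ) ≤ ((1 + ‖m‖) * (1 + ‖φ‖)) ^ 2 := one_le_pow₀ (by nlinarith)
      rw [mul_pow] at f3 f4
      nlinarith
    calc _ ≤ ((1 + n) * (1 + ‖φ‖) ^ 2) ^ ⌈w⌉₊ * ((1 + n) * (1 + ‖m‖) ^ 2 * (1 + ‖φ‖) ^ 2) :=
          mul_le_mul e2 e4 (by linarith [hs (φ - m)]) (by positivity)
      _ = _ := by rw [mul_pow, ← pow_mul, pow_add]; ring

set_option maxHeartbeats 400000 in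
/-- Gaussian integrals of homogeneous functions times powers of the quadratic form are continuously
differentiable in the quadratic form. -/
theorem contDiffAt_integral_rpow_halfForm {n : ℕ} (hn : 0 < n)
    {K : ℝ → Matrix (Fin n) (Fin n) ℝ} {τ₀ κ : ℝ} (hκ : 0 < κ)
    (hK : ∀ a b, ContDiffAt ℝ 1 (fun τ => K τ a b) τ₀)
    (hlow : ∀ᶠ τ in nhds τ₀, ∀ φ, κ * (φ ⬝ᵥ φ) ≤ halfForm (K τ) φ)
    {p : (Fin n → ℝ) → ℝ} (hp : Measurable p) {r s : ℝ} (hrs : 0 ≤ r + s)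
    (hpr : ∀ φ, |p φ| ≤ (φ ⬝ᵥ φ) ^ r) (m : Fin n → ℝ) :
    ContDiffAt ℝ 1 (fun τ => ∫ φ : Fin n → ℝ,
      p φ * halfForm (K τ) φ ^ s * Real.exp (-halfForm (K τ) (φ - m))) τ₀ := by
  set K' : ℝ → Matrix (Fin n) (Fin n) ℝ := fun τ => Matrix.of fun a b => deriv (fun τ => K τ a b) τ
  -- local bounds
  have hev : ∀ᶠ τ in nhds τ₀, (∀ a b, ContDiffAt ℝ 1 (fun τ => K τ a b) τ) ∧
      ∀ φ, κ * (φ ⬝ᵥ φ) ≤ halfForm (K τ) φ := by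
    refine Filter.Eventually.and ?_ hlow
    simp only [Filter.eventually_all]
    exact fun a b => (hK a b).eventually (by norm_num)
  have hbd : ∃ M, 0 < M ∧ ∀ᶠ τ in nhds τ₀, ∀ a b, |K τ a b| ≤ M ∧ |K' τ a b| ≤ M := by
    refine ⟨1 + ∑ a, ∑ b, (|K τ₀ a b| + |K' τ₀ a b|), by positivity, ?_⟩
    simp only [Filter.eventually_all]
    intro a b
    have hle : |K τ₀ a b| + |K' τ₀ a b| ≤ ∑ a, ∑ b, (|K τ₀ a b| + |K' τ₀ a b|) :=
      (Finset.single_le_sum (f := fun b => |K τ₀ a b| + |K' τ₀ a b|)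
        (fun b _ => by positivity) (Finset.mem_univ b)).trans
        (Finset.single_le_sum (f := fun a => ∑ b, (|K τ₀ a b| + |K' τ₀ a b|))
        (fun b _ => by positivity) (Finset.mem_univ a))
    have h1 := (hK a b).continuousAt.abs.eventually_lt
      (continuousAt_const (y := 1 + ∑ a, ∑ b, (|K τ₀ a b| + |K' τ₀ a b|)))
      (by have := abs_nonneg (K' τ₀ a b); linarith)
    have h2 := ((hK a b).derivWithin (m := 0) (by norm_num)).continuousAt.abs.eventually_lt
      (continuousAt_const (y := 1 + ∑ a, ∑ b, (|K τ₀ a b| + |K' τ₀ a b|)))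
      (by have := abs_nonneg (K τ₀ a b); simp only [K', of_apply] at hle ⊢; linarith)
    filter_upwards [h1, h2] with τ h1 h2
    exact ⟨h1.le, h2.le⟩
  obtain ⟨M, hM, hbd⟩ := hbd
  obtain ⟨ε, hε, hball⟩ := Metric.eventually_nhds_iff_ball.1 (hev.and hbd)
  set U := Metric.ball τ₀ ε
  have hUo : IsOpen U := Metric.isOpen_ball
  have hdot : ∀ φ : Fin n → ℝ, 0 ≤ φ ⬝ᵥ φ := fun φ =>
    Finset.sum_nonneg fun a _ => mul_self_nonneg _
  have hdot' : ∀ φ : Fin n → ℝ, φ ≠ 0 → 0 < φ ⬝ᵥ φ := fun φ hφ =>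
    lt_of_le_of_ne (hdot φ) fun h => hφ (dotProduct_self_eq_zero.1 h.symm)
  set M' : ℝ := n ^ 2 * M
  have hM' : 0 < M' := by positivity
  have hq : ∀ τ ∈ U, ∀ φ, |halfForm (K τ) φ| ≤ M' * (φ ⬝ᵥ φ) := fun τ hτ =>
    abs_halfForm_le fun a b => ((hball τ hτ).2 a b).1
  have hq' : ∀ τ ∈ U, ∀ φ, |halfForm (K' τ) φ| ≤ M' * (φ ⬝ᵥ φ) := fun τ hτ =>
    abs_halfForm_le fun a b => ((hball τ hτ).2 a b).2
  have hql : ∀ τ ∈ U, ∀ φ, κ * (φ ⬝ᵥ φ) ≤ halfForm (K τ) φ := fun τ hτ => (hball τ hτ).1.2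
  -- powers of the form
  have hpow : ∀ u : ℝ, ∃ C, 0 ≤ C ∧ ∀ τ ∈ U, ∀ φ ≠ 0,
      0 ≤ halfForm (K τ) φ ^ u ∧ halfForm (K τ) φ ^ u ≤ C * (φ ⬝ᵥ φ) ^ u := by
    intro u
    -- For `u ≥ 0` the upper bound on the form is used, for `u ≤ 0` the lower one; the sum of the
    -- two constants covers both signs.
    refine ⟨M' ^ u + κ ^ u, by positivity, fun τ hτ φ hφ => ?_⟩
    have d := hdot' φ hφ
    have l := hql τ hτ φ
    have l0 : 0 < κ * (φ ⬝ᵥ φ) := by positivity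
    have hu := (le_abs_self _).trans (hq τ hτ φ)
    refine ⟨Real.rpow_nonneg (l0.le.trans l) _, ?_⟩
    have a1 : 0 ≤ M' ^ u * (φ ⬝ᵥ φ) ^ u := by positivity
    have a2 : 0 ≤ κ ^ u * (φ ⬝ᵥ φ) ^ u := by positivity
    rcases le_total 0 u with h | h
    · have := Real.rpow_le_rpow (l0.le.trans l) hu h
      rw [Real.mul_rpow hM'.le d.le] at this
      linarith
    · have := Real.rpow_le_rpow_of_nonpos l0 l h
      rw [Real.mul_rpow hκ.le d.le] at this
      linarith
  obtain ⟨C₁, hC₁, hp₁⟩ := hpow s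
  obtain ⟨C₂, hC₂, hp₂⟩ := hpow (s - 1)
  set F : ℝ → (Fin n → ℝ) → ℝ := fun τ φ =>
    p φ * halfForm (K τ) φ ^ s * Real.exp (-halfForm (K τ) (φ - m)) with hF
  set F' : ℝ → (Fin n → ℝ) → ℝ := fun τ φ =>
    (p φ * (halfForm (K' τ) φ * s * halfForm (K τ) φ ^ (s - 1)) +
      p φ * halfForm (K τ) φ ^ s * (-halfForm (K' τ) (φ - m))) *
      Real.exp (-halfForm (K τ) (φ - m)) with hF'
  have hmF : ∀ τ, Measurable (F τ) := by
    intro τ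
    have h1 := (continuous_halfForm (K τ)).measurable
    have h2 : Measurable fun φ => halfForm (K τ) (φ - m) := h1.comp (measurable_id.sub_const m)
    exact (hp.mul (h1.pow_const _)).mul h2.neg.exp
  have hmF' : ∀ τ, Measurable (F' τ) := by
    intro τ
    have h1 := (continuous_halfForm (K τ)).measurable
    have h2 : Measurable fun φ => halfForm (K τ) (φ - m) := h1.comp (measurable_id.sub_const m)
    have h3 := (continuous_halfForm (K' τ)).measurable
    have h4 : Measurable fun φ => halfForm (K' τ) (φ - m) := h3.comp (measurable_id.sub_const m)
    exact ((hp.mul ((h3.mul_const _).mul (h1.pow_const _))).add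
      ((hp.mul (h1.pow_const _)).mul h4.neg)).mul h2.neg.exp
  set bd : (Fin n → ℝ) → ℝ := fun φ => (C₁ + M' * |s| * C₂ + M' * C₁) *
    ((φ ⬝ᵥ φ) ^ (r + s) * (1 + (φ - m) ⬝ᵥ (φ - m)) *
      Real.exp (-(κ * ((φ - m) ⬝ᵥ (φ - m))))) with hbdd
  have hbi : Integrable bd := (integrable_dotProduct_rpow_mul_exp m hκ hrs).const_mul _
  have hexp : ∀ τ ∈ U, ∀ φ, Real.exp (-halfForm (K τ) (φ - m)) ≤
      Real.exp (-(κ * ((φ - m) ⬝ᵥ (φ - m)))) := fun τ hτ φ =>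
    Real.exp_le_exp.2 (neg_le_neg (hql τ hτ _))
  -- At the origin the power of the form need not be differentiable, but the origin is a null set
  -- because `0 < n`.
  have hne : ∀ᵐ φ : Fin n → ℝ, φ ≠ 0 := by
    have : Nonempty (Fin n) := ⟨⟨0, hn⟩⟩
    exact Measure.ae_ne volume 0
  have hsp : ∀ τ ∈ U, ∀ φ ≠ 0, |p φ * halfForm (K τ) φ ^ s| ≤ C₁ * (φ ⬝ᵥ φ) ^ (r + s) := by
    intro τ hτ φ hφ
    have h := hp₁ τ hτ φ hφ
    rw [abs_mul, abs_of_nonneg h.1, Real.rpow_add (hdot' φ hφ)]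
    calc _ ≤ (φ ⬝ᵥ φ) ^ r * (C₁ * (φ ⬝ᵥ φ) ^ s) :=
          mul_le_mul (hpr φ) h.2 h.1 (Real.rpow_nonneg (hdot φ) _)
      _ = _ := by ring
  -- Differentiation lowers the power of the form by one, but the form of `K'` contributes a factor
  -- of order `φ ⬝ᵥ φ`; the exponent `r + s` of the bound is unchanged and nonnegative.
  have hsp' : ∀ τ ∈ U, ∀ φ ≠ 0, |p φ * (halfForm (K' τ) φ * s * halfForm (K τ) φ ^ (s - 1))| ≤
      M' * |s| * C₂ * (φ ⬝ᵥ φ) ^ (r + s) := by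
    intro τ hτ φ hφ
    have h := hp₂ τ hτ φ hφ
    have d := hdot' φ hφ
    rw [abs_mul, abs_mul, abs_mul, abs_of_nonneg h.1]
    calc _ ≤ (φ ⬝ᵥ φ) ^ r * (M' * (φ ⬝ᵥ φ) * |s| * (C₂ * (φ ⬝ᵥ φ) ^ (s - 1))) := by
          refine mul_le_mul (hpr φ) ?_ (mul_nonneg (by positivity) h.1)
            (Real.rpow_nonneg (hdot φ) _)
          exact mul_le_mul (mul_le_mul_of_nonneg_right (hq' τ hτ φ) (abs_nonneg _)) h.2 h.1
            (by positivity)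
      _ = _ := by
          rw [show r + s = r + 1 + (s - 1) by ring, Real.rpow_add d, Real.rpow_add d,
            Real.rpow_one]
          ring
  have hFb : ∀ τ ∈ U, ∀ φ ≠ 0, ‖F τ φ‖ ≤ bd φ := by
    intro τ hτ φ hφ
    rw [Real.norm_eq_abs, hF, hbdd]
    simp only
    rw [abs_mul, Real.abs_exp]
    have h1 := hsp τ hτ φ hφ
    have h2 := hdot (φ - m)
    have h3 : 0 ≤ (φ ⬝ᵥ φ) ^ (r + s) := Real.rpow_nonneg (hdot φ) _
    calc _ ≤ C₁ * (φ ⬝ᵥ φ) ^ (r + s) * Real.exp (-(κ * ((φ - m) ⬝ᵥ (φ - m)))) :=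
          mul_le_mul h1 (hexp τ hτ φ) (Real.exp_nonneg _) (by positivity)
      _ ≤ (C₁ + M' * |s| * C₂ + M' * C₁) * ((φ ⬝ᵥ φ) ^ (r + s) * (1 + (φ - m) ⬝ᵥ (φ - m))) *
          Real.exp (-(κ * ((φ - m) ⬝ᵥ (φ - m)))) := by
          refine mul_le_mul_of_nonneg_right ?_ (Real.exp_nonneg _)
          refine mul_le_mul ?_ ?_ h3 (by positivity)
          · have : 0 ≤ M' * |s| * C₂ + M' * C₁ := by positivity
            linarith
          · exact le_mul_of_one_le_right h3 (by linarith)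
      _ = _ := by ring
  have hFb' : ∀ τ ∈ U, ∀ φ ≠ 0, ‖F' τ φ‖ ≤ bd φ := by
    intro τ hτ φ hφ
    rw [Real.norm_eq_abs, hF', hbdd]
    simp only
    rw [abs_mul, Real.abs_exp]
    have h1 := hsp τ hτ φ hφ
    have h1' := hsp' τ hτ φ hφ
    have h2 := hdot (φ - m)
    have h4 := hq' τ hτ (φ - m)
    have h3 : 0 ≤ (φ ⬝ᵥ φ) ^ (r + s) := Real.rpow_nonneg (hdot φ) _
    have h5 : |p φ * (halfForm (K' τ) φ * s * halfForm (K τ) φ ^ (s - 1)) +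
        p φ * halfForm (K τ) φ ^ s * (-halfForm (K' τ) (φ - m))| ≤
        (C₁ + M' * |s| * C₂ + M' * C₁) * ((φ ⬝ᵥ φ) ^ (r + s) * (1 + (φ - m) ⬝ᵥ (φ - m))) := by
      refine (abs_add_le _ _).trans ?_
      have h6 : |p φ * halfForm (K τ) φ ^ s * (-halfForm (K' τ) (φ - m))| ≤
          C₁ * (φ ⬝ᵥ φ) ^ (r + s) * (M' * ((φ - m) ⬝ᵥ (φ - m))) := by
        rw [abs_mul, abs_neg]
        exact mul_le_mul h1 h4 (abs_nonneg _) (by positivity)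
      have a1 : 0 ≤ C₁ * (φ ⬝ᵥ φ) ^ (r + s) := by positivity
      have a2 : 0 ≤ M' * |s| * C₂ * (φ ⬝ᵥ φ) ^ (r + s) * ((φ - m) ⬝ᵥ (φ - m)) := by positivity
      have a3 : 0 ≤ M' * C₁ * (φ ⬝ᵥ φ) ^ (r + s) := by positivity
      have a4 : 0 ≤ C₁ * (φ ⬝ᵥ φ) ^ (r + s) * ((φ - m) ⬝ᵥ (φ - m)) := by positivity
      nlinarith
    calc _ ≤ (C₁ + M' * |s| * C₂ + M' * C₁) * ((φ ⬝ᵥ φ) ^ (r + s) * (1 + (φ - m) ⬝ᵥ (φ - m))) *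
          Real.exp (-(κ * ((φ - m) ⬝ᵥ (φ - m)))) :=
          mul_le_mul h5 (hexp τ hτ φ) (Real.exp_nonneg _) (by positivity)
      _ = _ := by ring
  -- differentiation of the integrand
  have hKd : ∀ τ ∈ U, ∀ φ, HasDerivAt (fun τ => halfForm (K τ) φ) (halfForm (K' τ) φ) τ := by
    intro τ hτ φ
    refine HasDerivAt.const_mul (1 / 2) (HasDerivAt.fun_sum fun a _ => HasDerivAt.fun_sum
      fun b _ => ?_)
    have h := ((hball τ hτ).1.1 a b).differentiableAt (by norm_num)
    exact (h.hasDerivAt.mul_const (φ a)).mul_const (φ b)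
  have hKc : ∀ τ ∈ U, ∀ φ, ContinuousAt (fun τ => halfForm (K' τ) φ) τ := by
    intro τ hτ φ
    unfold halfForm
    refine continuousAt_const.mul (tendsto_finsetSum _ fun a _ => tendsto_finsetSum _
      fun b _ => ?_)
    have h := (((hball τ hτ).1.1 a b).derivWithin (m := 0) (by norm_num)).continuousAt
    exact (h.mul continuousAt_const).mul continuousAt_const
  have hpos : ∀ τ ∈ U, ∀ φ ≠ 0, 0 < halfForm (K τ) φ := fun τ hτ φ hφ =>
    lt_of_lt_of_le (mul_pos hκ (hdot' φ hφ)) (hql τ hτ φ)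
  have hFd : ∀ τ ∈ U, ∀ φ ≠ 0, HasDerivAt (fun τ => F τ φ) (F' τ φ) τ := by
    intro τ hτ φ hφ
    have h1 := (hKd τ hτ φ).rpow_const (p := s) (Or.inl (hpos τ hτ φ hφ).ne')
    have h2 := (hKd τ hτ (φ - m)).neg.exp
    refine ((h1.const_mul (p φ)).mul h2).congr_deriv ?_
    simp only [hF', Pi.neg_apply]
    ring
  have hFc : ∀ τ ∈ U, ∀ φ ≠ 0, ContinuousAt (fun τ => F' τ φ) τ := by
    intro τ hτ φ hφ
    have h0 := hpos τ hτ φ hφ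
    have h1 := (hKd τ hτ φ).continuousAt
    have h2 := (hKd τ hτ (φ - m)).continuousAt
    have h3 := hKc τ hτ φ
    have h4 := hKc τ hτ (φ - m)
    have h5 := h1.rpow_const (p := s) (Or.inl h0.ne')
    have h6 := h1.rpow_const (p := s - 1) (Or.inl h0.ne')
    exact ((continuousAt_const.mul ((h3.mul continuousAt_const).mul h6)).add
      ((continuousAt_const.mul h5).mul h4.neg)).mul (Real.continuous_exp.continuousAt.comp h2.neg)
  have hmem : ∀ τ ∈ U, U ∈ nhds τ := fun τ hτ => hUo.mem_nhds hτ
  have hD : ∀ τ ∈ U, HasDerivAt (fun τ => ∫ φ, F τ φ) (∫ φ, F' τ φ) τ := by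
    intro τ hτ
    refine (hasDerivAt_integral_of_dominated_loc_of_deriv_le (F := F) (F' := F') (bound := bd)
      (hmem τ hτ)
      (Filter.Eventually.of_forall fun τ => (hmF τ).aestronglyMeasurable) ?_
      (hmF' τ).aestronglyMeasurable ?_ hbi ?_).2
    · refine hbi.mono' (hmF τ).aestronglyMeasurable ?_
      filter_upwards [hne] with φ hφ using hFb τ hτ φ hφ
    · filter_upwards [hne] with φ hφ τ hτ using hFb' τ hτ φ hφ
    · filter_upwards [hne] with φ hφ τ hτ using hFd τ hτ φ hφ
  have hC : ∀ τ ∈ U, ContinuousAt (fun τ => ∫ φ, F' τ φ) τ := by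
    intro τ hτ
    refine continuousAt_of_dominated (F := F') (bound := bd)
      (Filter.Eventually.of_forall fun τ => (hmF' τ).aestronglyMeasurable) ?_ hbi ?_
    · filter_upwards [hmem τ hτ] with τ hτ
      filter_upwards [hne] with φ hφ using hFb' τ hτ φ hφ
    · filter_upwards [hne] with φ hφ using hFc τ hτ φ hφ
  refine contDiffAt_one_iff.2 ⟨fun τ => ContinuousLinearMap.smulRight (1 : ℝ →L[ℝ] ℝ)
    (∫ φ, F' τ φ), U, Metric.ball_mem_nhds _ hε, ?_, fun τ hτ => (hD τ hτ).hasFDerivAt⟩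
  intro τ hτ
  refine ContinuousAt.continuousWithinAt ?_
  exact ((ContinuousLinearMap.smulRightL ℝ ℝ ℝ (1 : ℝ →L[ℝ] ℝ)).continuous.continuousAt).comp
    (hC τ hτ)

end LegendreQFT

end

/-! ### Differentiability of Gaussian averages and their series along curves of covariance matrices
-/

noncomputable section

namespace LegendreQFT

/-- Positivity of the form on the compact unit sphere is an open condition, and it extends to all
vectors by homogeneity. -/
theorem eventually_posDef {n : ℕ} {A : ℝ → Matrix (Fin n) (Fin n) ℝ} {τ₀ : ℝ}
    (hA : ∀ a b, ContDiff ℝ 1 fun τ => A τ a b) (hs : ∀ τ, (A τ).IsSymm) (h0 : (A τ₀).PosDef) :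
    ∀ᶠ τ in nhds τ₀, (A τ).PosDef := by
  have hc : Continuous fun z : ℝ × (Fin n → ℝ) => z.2 ⬝ᵥ A z.1 *ᵥ z.2 := by
    have := fun a b => (hA a b).continuous
    unfold dotProduct mulVec dotProduct
    fun_prop
  have hev : ∀ᶠ τ in nhds τ₀, ∀ φ ∈ Metric.sphere (0 : Fin n → ℝ) 1, 0 < φ ⬝ᵥ A τ *ᵥ φ := by
    refine (isCompact_sphere _ _).eventually_forall_of_forall_eventually fun φ hφ => ?_
    have hφ0 : φ ≠ 0 := by
      rintro rfl
      simp at hφ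
    have h1 := h0.dotProduct_mulVec_pos hφ0
    simp only [star_trivial] at h1
    exact hc.continuousAt.eventually (lt_mem_nhds h1)
  filter_upwards [hev] with τ hτ
  refine PosDef.of_dotProduct_mulVec_pos ?_ fun φ hφ => ?_
  · rw [IsHermitian, conjTranspose_eq_transpose_of_trivial]
    exact hs τ
  · have hn : 0 < ‖φ‖ := norm_pos_iff.2 hφ
    have h := hτ (‖φ‖⁻¹ • φ) (by simp [norm_smul, hn.ne'])
    rw [mulVec_smul, dotProduct_smul, smul_dotProduct, smul_eq_mul, smul_eq_mul, ← mul_assoc] at h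
    rw [star_trivial]
    exact pos_of_mul_pos_right h (by positivity)

theorem contDiff_det {n : ℕ} {A : ℝ → Matrix (Fin n) (Fin n) ℝ}
    (hA : ∀ a b, ContDiff ℝ 1 fun τ => A τ a b) : ContDiff ℝ 1 fun τ => (A τ).det := by
  simp only [det_apply, Units.smul_def, zsmul_eq_mul]
  exact ContDiff.sum fun σ _ => contDiff_const.mul (contDiff_prod fun i _ => hA _ _)

theorem contDiffAt_inv {n : ℕ} {A : ℝ → Matrix (Fin n) (Fin n) ℝ} {τ₀ : ℝ}
    (hA : ∀ a b, ContDiff ℝ 1 fun τ => A τ a b) (h0 : (A τ₀).det ≠ 0) (a b : Fin n) :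
    ContDiffAt ℝ 1 (fun τ => (A τ)⁻¹ a b) τ₀ := by
  simp only [inv_def, Matrix.smul_apply, smul_eq_mul, Ring.inverse_eq_inv', adjugate_apply]
  refine ContDiffAt.mul ((contDiff_det hA).contDiffAt.inv h0) (contDiff_det fun i k => ?_).contDiffAt
  by_cases h : i = b
  · subst h
    simp only [updateRow_self]
    exact contDiff_const
  · simp only [updateRow_ne h]
    exact hA i k

theorem contDiffAt_prefactor {n : ℕ} {A : ℝ → Matrix (Fin n) (Fin n) ℝ} {τ₀ : ℝ}
    (hA : ∀ a b, ContDiff ℝ 1 fun τ => A τ a b) (h0 : (A τ₀).PosDef) :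
    ContDiffAt ℝ 1 (fun τ => 1 / Real.sqrt ((2 * Real.pi) ^ n * (A τ).det)) τ₀ := by
  have hp : (2 * Real.pi) ^ n * (A τ₀).det ≠ 0 := by
    have := h0.det_pos
    positivity
  exact contDiffAt_const.div ((contDiff_const.mul (contDiff_det hA)).contDiffAt.sqrt hp)
    (sqrt_det_pos h0).ne'

theorem abs_prod_pow_le {n : ℕ} (i : ℕ) (φ : Fin n → ℝ) :
    |∏ a, φ a ^ (2 * i)| ≤ (φ ⬝ᵥ φ) ^ (n * i : ℝ) := by
  have h0 : 0 ≤ φ ⬝ᵥ φ := Finset.sum_nonneg fun a _ => mul_self_nonneg _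
  rw [Finset.abs_prod, ← Nat.cast_mul, Real.rpow_natCast, mul_comm n i, pow_mul]
  calc ∏ a, |φ a ^ (2 * i)| ≤ ∏ _a : Fin n, (φ ⬝ᵥ φ) ^ i := by
        refine Finset.prod_le_prod (fun a _ => abs_nonneg _) fun a _ => ?_
        rw [abs_pow, pow_mul, sq_abs, sq]
        exact pow_le_pow_left₀ (mul_self_nonneg _) (Finset.single_le_sum
          (f := fun a => φ a * φ a) (fun a _ => mul_self_nonneg _) (Finset.mem_univ a)) _
    _ = _ := by simp

theorem abs_prod_abs_rpow_le {n : ℕ} {α : ℝ} (hα : 0 ≤ α) (φ : Fin n → ℝ) :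
    |∏ a, |φ a| ^ α| ≤ (φ ⬝ᵥ φ) ^ (n * α / 2 : ℝ) := by
  have h0 : 0 ≤ φ ⬝ᵥ φ := Finset.sum_nonneg fun a _ => mul_self_nonneg _
  rw [abs_of_nonneg (Finset.prod_nonneg fun a _ => Real.rpow_nonneg (abs_nonneg _) _)]
  calc ∏ a, |φ a| ^ α ≤ ∏ _a : Fin n, (φ ⬝ᵥ φ) ^ (α / 2) := by
        refine Finset.prod_le_prod (fun a _ => Real.rpow_nonneg (abs_nonneg _) _) fun a _ => ?_
        have h1 : |φ a| ^ α = (φ a * φ a) ^ (α / 2) := by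
          rw [← sq, ← sq_abs, ← Real.rpow_natCast, ← Real.rpow_mul (abs_nonneg _)]
          congr 1
          push_cast
          ring
        rw [h1]
        exact Real.rpow_le_rpow (mul_self_nonneg _) (Finset.single_le_sum
          (f := fun a => φ a * φ a) (fun a _ => mul_self_nonneg _) (Finset.mem_univ a))
          (by positivity)
    _ = _ := by
        rw [Finset.prod_const, Finset.card_univ, Fintype.card_fin, ← Real.rpow_natCast,
          ← Real.rpow_mul h0]
        congr 1
        ring

/-- Smoothness of a Gaussian average of a homogeneous function. -/
theorem contDiffAt_gaussianAverage {n : ℕ} (hn : 0 < n) {c : ℝ} (hc : 0 < c)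
    {A : ℝ → Matrix (Fin n) (Fin n) ℝ} {τ₀ : ℝ} (hA : ∀ a b, ContDiff ℝ 1 fun τ => A τ a b)
    (hs : ∀ τ, (A τ).IsSymm) (hd : ∀ τ a, A τ a a = c) (h0 : (A τ₀).PosDef)
    {p : (Fin n → ℝ) → ℝ} (hp : Measurable p) {r s : ℝ} (hrs : 0 ≤ r + s)
    (hpr : ∀ φ, |p φ| ≤ (φ ⬝ᵥ φ) ^ r) (m : Fin n → ℝ) :
    ContDiffAt ℝ 1 (fun τ => gaussianAverage (A τ) m fun φ => p φ * quad (A τ) φ ^ s) τ₀ := by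
  have hn' : (0 : ℝ) < n := by exact_mod_cast hn
  refine (contDiffAt_prefactor hA h0).mul ?_
  -- Summing `φ_a² ≤ 2 c Q(φ)` over the `n` coordinates gives this `κ`; it is uniform in `τ` because
  -- the diagonal stays equal to `c`.
  refine contDiffAt_integral_rpow_halfForm hn (κ := 1 / (2 * c * n)) (by positivity)
    (contDiffAt_inv hA h0.det_pos.ne') ?_ hp hrs hpr m
  filter_upwards [eventually_posDef hA hs h0] with τ hτ φ
  rw [← quad_eq_halfForm, div_mul_eq_mul_div, one_mul, div_le_iff₀ (by positivity)]
  calc φ ⬝ᵥ φ ≤ ∑ _a : Fin n, 2 * c * quad (A τ) φ := Finset.sum_le_sum fun a _ => by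
        rw [← sq]
        exact sq_le_two_mul_quad hc hτ (hd τ) φ a
    _ = _ := by simp; ring

/-- The series is not differentiated termwise: near `τ₀` the matrices stay positive definite, so it
coincides there with the average of `∏ |φ_a|^α`, a function independent of the matrix. -/
theorem contDiffAt_legendreSeries {n : ℕ} (hn : 0 < n) {c : ℝ} (hc : 0 < c) {α : ℝ}
    (h1 : 1 ≤ α) (h2 : α ≤ 2) {A : ℝ → Matrix (Fin n) (Fin n) ℝ} {τ₀ : ℝ}
    (hA : ∀ a b, ContDiff ℝ 1 fun τ => A τ a b)
    (hs : ∀ τ, (A τ).IsSymm) (hd : ∀ τ a, A τ a a = c) (h0 : (A τ₀).PosDef) (m : Fin n → ℝ) :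
    ContDiffAt ℝ 1 (fun τ => legendreSeries c α (A τ) m) τ₀ := by
  have h := contDiffAt_gaussianAverage hn hc hA hs hd h0
    (p := fun φ => ∏ a, |φ a| ^ α) (by fun_prop) (r := n * α / 2) (s := 0) (by positivity)
    (abs_prod_abs_rpow_le (by linarith)) m
  refine h.congr_of_eventuallyEq ?_
  filter_upwards [eventually_posDef hA hs h0] with τ hτ
  rw [← (legendreSeries_spec hn hc h1 h2 hτ (hd τ) m).2.2]
  simp

/-- Here the averaged function itself depends on the matrix through `Q`. Expanded into monomials of
degree `2 n i` times `Q ^ (n α / 2 - n i)`, each term satisfies the smoothness criterion with `r + s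
= n α / 2`. -/
theorem contDiffAt_approxSeries {n : ℕ} (hn : 0 < n) {c : ℝ} (hc : 0 < c) {α : ℝ}
    (hα : 0 < α) {A : ℝ → Matrix (Fin n) (Fin n) ℝ} {τ₀ : ℝ}
    (hA : ∀ a b, ContDiff ℝ 1 fun τ => A τ a b)
    (hs : ∀ τ, (A τ).IsSymm) (hd : ∀ τ a, A τ a a = c) (h0 : (A τ₀).PosDef) (m : Fin n → ℝ)
    (N : ℕ) : ContDiffAt ℝ 1 (fun τ => approxSeries c α N (A τ) m) τ₀ := by
  have h : ContDiffAt ℝ 1 (fun τ => ∑ q ∈ Finset.range (N + 1), ∑ i ∈ Finset.range (q + 1),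
      legendreCoeff α q * (legCoef q i * (2 * c) ^ (n * α / 2 - n * i : ℝ)) *
        gaussianAverage (A τ) m fun φ =>
          (∏ a, φ a ^ (2 * i)) * quad (A τ) φ ^ (n * α / 2 - n * i : ℝ)) τ₀ := by
    refine ContDiffAt.sum fun q _ => ContDiffAt.sum fun i _ => contDiffAt_const.mul ?_
    exact contDiffAt_gaussianAverage hn hc hA hs hd h0 (by fun_prop) (r := n * i)
      (by rw [add_sub_cancel]; positivity) (abs_prod_pow_le i) m
  refine h.congr_of_eventuallyEq ?_
  filter_upwards [eventually_posDef hA hs h0] with τ hτ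
  rw [← (approxSeries_spec hn hc hα hτ (hd τ) m N).2]
  simp only [gaussianAverage_eq_integral]
  simp_rw [← integral_const_mul]
  have hint : ∀ q i, Integrable (fun φ : Fin n → ℝ =>
      legendreCoeff α q * (legCoef q i * (2 * c) ^ (n * α / 2 - n * i : ℝ)) *
      ((∏ a, φ a ^ (2 * i)) * quad (A τ) φ ^ (n * α / 2 - n * i : ℝ))) (gaussLaw (A τ) m) := by
    intro q i
    refine Integrable.const_mul ?_ _
    obtain ⟨C, M, hb⟩ := exists_rpow_quad_le hc hτ (p := n * α / 2) (by positivity)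
    refine integrable_gaussLaw_of_le hτ m (C := (2 * c) ^ (-(n * α / 2 - n * i) : ℝ) * C)
      (N := M) ?_ fun φ => ?_
    · have := (continuous_quad (A τ)).measurable
      fun_prop
    · have hq := quad_nonneg hτ φ
      have hn' : (0 : ℝ) < n := by exact_mod_cast hn
      rw [abs_mul, abs_of_nonneg (Real.rpow_nonneg hq _), mul_assoc]
      by_cases hφ : φ = 0
      · subst hφ
        have h0 := hb 0
        have h1 : quad (A τ) 0 = 0 := by simp [quad]
        rw [h1, mul_zero, Real.zero_rpow (by positivity)] at h0
        refine le_trans (le_of_eq ?_) (mul_nonneg (Real.rpow_nonneg (by positivity) _) h0)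
        rw [h1]
        rcases Nat.eq_zero_or_pos i with rfl | hi
        · simp only [Nat.cast_zero, mul_zero, sub_zero]
          rw [Real.zero_rpow (by positivity), mul_zero]
        · rw [Finset.prod_eq_zero (Finset.mem_univ ⟨0, hn⟩) (by simp; lia)]
          simp
      · have hQ := quad_pos hτ hφ
        have hpr : |∏ a, φ a ^ (2 * i)| ≤ (2 * c * quad (A τ) φ) ^ (n * i : ℝ) := by
          rw [Finset.abs_prod, ← Nat.cast_mul, Real.rpow_natCast, mul_comm n i, pow_mul]
          calc ∏ a, |φ a ^ (2 * i)| ≤ ∏ _a : Fin n, (2 * c * quad (A τ) φ) ^ i := by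
                refine Finset.prod_le_prod (fun a _ => abs_nonneg _) fun a _ => ?_
                rw [abs_pow, pow_mul, sq_abs]
                exact pow_le_pow_left₀ (sq_nonneg _) (sq_le_two_mul_quad hc hτ (hd τ) φ a) _
            _ = _ := by simp
        have h2 : (0 : ℝ) < 2 * c * quad (A τ) φ := by positivity
        calc _ ≤ (2 * c * quad (A τ) φ) ^ (n * i : ℝ) * quad (A τ) φ ^ (n * α / 2 - n * i : ℝ) :=
              mul_le_mul_of_nonneg_right hpr (Real.rpow_nonneg hq _)
          _ = (2 * c) ^ (-(n * α / 2 - n * i) : ℝ) * (2 * c * quad (A τ) φ) ^ (n * α / 2 : ℝ) := by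
              rw [Real.mul_rpow (by positivity) hq, Real.mul_rpow (by positivity) hq,
                show (n * α / 2 : ℝ) = n * i + (n * α / 2 - n * i) by ring,
                Real.rpow_add hQ, Real.rpow_add (by positivity : 0 < 2 * c)]
              rw [show (n * i + (n * α / 2 - n * i) - n * i : ℝ) = n * α / 2 - n * i by ring,
                Real.rpow_neg (by positivity)]
              field_simp
          _ ≤ _ := mul_le_mul_of_nonneg_left (hb φ) (Real.rpow_nonneg (by positivity) _)
  rw [← Finset.sum_congr rfl fun q _ => integral_finsetSum _ fun i _ => hint q i,
    ← integral_finsetSum _ fun q _ => integrable_finsetSum _ fun i _ => hint q i]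
  refine integral_congr_ae (Filter.Eventually.of_forall fun φ => ?_)
  simp only [approxInteraction_eq_sum]
  refine Finset.sum_congr rfl fun q _ => ?_
  have h := legendrePart_mul_prod hn hc hα hτ q 0 φ
  simp only [Pi.zero_apply, pow_zero, Finset.prod_const_one, mul_one, add_zero] at h
  rw [h, Finset.mul_sum]
  exact Finset.sum_congr rfl fun i _ => by ring

end LegendreQFT

end

noncomputable section

namespace LegendreQFT

/-! ### The operator in the variables `s_ab` -/

/-- Functions of the variables `s_ab` that are continuously differentiable in each variable on the
unit cube and do not depend on the variables off the edges of `Γ`. -/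
structure IsSmoothOnCube {n : ℕ} (Γ : SimpleGraph (Fin n)) (F : SVars n → ℝ) : Prop where
  contDiffAt : ∀ s : SVars n, (∀ e, s e ∈ Set.Icc (0 : ℝ) 1) → ∀ e, ∀ σ ∈ Set.Icc (0 : ℝ) 1,
    ContDiffAt ℝ 1 (fun τ => F (Function.update s e τ)) σ
  update_eq : ∀ s : SVars n, ∀ e ∉ Γ.edgeSet, ∀ τ, F (Function.update s e τ) = F s

theorem update_mem_cube {n : ℕ} {s : SVars n} (hs : ∀ e, s e ∈ Set.Icc (0 : ℝ) 1)
    (e : Sym2 (Fin n)) {τ : ℝ} (hτ : τ ∈ Set.Icc (0 : ℝ) 1) :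
    ∀ e', Function.update s e τ e' ∈ Set.Icc (0 : ℝ) 1 := by
  intro e'
  by_cases h : e' = e
  · subst h; simpa using hτ
  · rw [Function.update_of_ne h]; exact hs e'

theorem pairStep_of_notMem {n : ℕ} {Γ : SimpleGraph (Fin n)} {F : SVars n → ℝ}
    (hF : ∀ s : SVars n, ∀ e ∉ Γ.edgeSet, ∀ τ, F (Function.update s e τ) = F s)
    {e : Sym2 (Fin n)} (he : e ∉ Γ.edgeSet) : pairStep Γ e F = F := by
  funext s
  rw [pairStep, if_neg he]
  simp [hF s e he]

theorem pairStep_update {n : ℕ} {Γ : SimpleGraph (Fin n)} {F : SVars n → ℝ}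
    (hF : ∀ s : SVars n, ∀ e ∉ Γ.edgeSet, ∀ τ, F (Function.update s e τ) = F s)
    (e' : Sym2 (Fin n)) : ∀ s : SVars n, ∀ e ∉ Γ.edgeSet, ∀ τ,
      pairStep Γ e' F (Function.update s e τ) = pairStep Γ e' F s := by
  intro s e he τ
  by_cases h : e' ∈ Γ.edgeSet
  · have hne : e' ≠ e := fun h' => he (h' ▸ h)
    simp only [pairStep, if_pos h, Function.update_comm hne.symm, hF _ e he]
  · rw [pairStep_of_notMem hF h, hF s e he]

theorem IsSmoothOnCube.step {n : ℕ} {Γ : SimpleGraph (Fin n)} {F : SVars n → ℝ}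
    (hF : IsSmoothOnCube Γ F) (e' : Sym2 (Fin n)) : IsSmoothOnCube Γ (pairStep Γ e' F) := by
  refine ⟨fun s hs e σ hσ => ?_, pairStep_update hF.update_eq e'⟩
  by_cases h : e' ∈ Γ.edgeSet
  · simp only [LegendreQFT.pairStep, if_pos h]
    by_cases hee : e = e'
    · subst hee
      simp only [Function.update_idem]
      exact contDiffAt_const
    · simp only [Function.update_comm hee]
      exact (hF.contDiffAt _ (update_mem_cube hs e' ⟨by norm_num, le_rfl⟩) e σ hσ).sub
        (hF.contDiffAt _ (update_mem_cube hs e' ⟨le_rfl, by norm_num⟩) e σ hσ)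
  · rw [pairStep_of_notMem hF.update_eq h]
    exact hF.contDiffAt s hs e σ hσ

theorem IsSmoothOnCube.literalStep_eq {n : ℕ} {Γ : SimpleGraph (Fin n)} {F : SVars n → ℝ}
    (hF : IsSmoothOnCube Γ F) (e : Sym2 (Fin n)) {s : SVars n}
    (hs : ∀ e, s e ∈ Set.Icc (0 : ℝ) 1) : literalStep Γ e F s = pairStep Γ e F s := by
  have hu : Set.uIcc (0 : ℝ) 1 = Set.Icc 0 1 := Set.uIcc_of_le zero_le_one
  refine literalStep_eq_pairStep Γ e F s (fun σ hσ => ?_) ?_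
  · exact (hF.contDiffAt s hs e σ (hu ▸ hσ)).differentiableAt (by norm_num)
  · refine ContinuousOn.intervalIntegrable fun σ hσ => ContinuousAt.continuousWithinAt ?_
    exact ((hF.contDiffAt s hs e σ (hu ▸ hσ)).derivWithin (m := 0) (by norm_num)).continuousAt

/-- The integral ignores the endpoints, and a derivative at an interior point depends only on nearby
values. So agreement on the cube suffices, whatever the functions do outside. -/
theorem literalStep_congr {n : ℕ} (Γ : SimpleGraph (Fin n)) {F F' : SVars n → ℝ}
    (h : ∀ s : SVars n, (∀ e, s e ∈ Set.Icc (0 : ℝ) 1) → F s = F' s) (e : Sym2 (Fin n))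
    {s : SVars n} (hs : ∀ e, s e ∈ Set.Icc (0 : ℝ) 1) : literalStep Γ e F s = literalStep Γ e F' s := by
  unfold literalStep
  rw [intervalIntegral.integral_of_le zero_le_one, intervalIntegral.integral_of_le zero_le_one,
    integral_Ioc_eq_integral_Ioo, integral_Ioc_eq_integral_Ioo]
  refine setIntegral_congr_fun measurableSet_Ioo fun σ hσ => ?_
  refine Filter.EventuallyEq.iteratedDeriv_eq _ ?_
  filter_upwards [isOpen_Ioo.mem_nhds hσ] with τ hτ
  exact h _ (update_mem_cube hs e (Set.Ioo_subset_Icc_self hτ))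

/-- Smoothness of the partial result is carried along with the equality, because it is what permits
the fundamental theorem of calculus in the next variable. -/
theorem IsSmoothOnCube.foldr {n : ℕ} {Γ : SimpleGraph (Fin n)} {F : SVars n → ℝ}
    (hF : IsSmoothOnCube Γ F) (l : List (Sym2 (Fin n))) :
    IsSmoothOnCube Γ (l.foldr (LegendreQFT.pairStep Γ) F) ∧
      ∀ s : SVars n, (∀ e, s e ∈ Set.Icc (0 : ℝ) 1) →
        l.foldr (literalStep Γ) F s = l.foldr (LegendreQFT.pairStep Γ) F s := by
  induction l with
  | nil => exact ⟨hF, fun s _ => rfl⟩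
  | cons e l ih =>
    refine ⟨ih.1.step e, fun s hs => ?_⟩
    simp only [List.foldr_cons]
    rw [literalStep_congr Γ ih.2 e hs, ih.1.literalStep_eq e hs]

theorem IsSmoothOnCube.literalOp_eq {n : ℕ} {Γ : SimpleGraph (Fin n)} {F : SVars n → ℝ}
    (hF : IsSmoothOnCube Γ F) : literalOp Γ F = graphOp Γ F :=
  (hF.foldr _).2 0 fun _ => ⟨le_rfl, zero_le_one⟩

/-! ### The matrix `G̃` as a function of the variables `s_ab` -/

theorem gTilde_update_of_notMem {d n : ℕ} (G : Point d → ℝ) (x : Fin n → Point d)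
    (Γ : SimpleGraph (Fin n)) (s : SVars n) {e : Sym2 (Fin n)} (he : e ∉ Γ.edgeSet) (τ : ℝ) :
    gTilde G x Γ (Function.update s e τ) = gTilde G x Γ s := by
  ext a b
  simp only [gTilde, of_apply]
  split_ifs with hab
  · rfl
  · by_cases h : s(a, b) = e
    · have : ¬ Γ.Adj a b := fun h' => he (h ▸ (Γ.mem_edgeSet.2 h'))
      simp [SimpleGraph.adjMatrix_apply, this]
    · rw [Function.update_of_ne h]

theorem gTilde_isSymm {d n : ℕ} {G : Point d → ℝ} (hG : ∀ x, G (-x) = G x)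
    (x : Fin n → Point d) (Γ : SimpleGraph (Fin n)) (s : SVars n) : (gTilde G x Γ s).IsSymm := by
  ext a b
  simp only [gTilde, transpose_apply, of_apply, SimpleGraph.adjMatrix_apply]
  rw [show x b - x a = -(x a - x b) by abel, hG, Sym2.eq_swap, Γ.adj_comm]
  simp only [eq_comm]

theorem contDiff_gTilde_update {d n : ℕ} (G : Point d → ℝ) (x : Fin n → Point d)
    (Γ : SimpleGraph (Fin n)) (s : SVars n) (e : Sym2 (Fin n)) (a b : Fin n) :
    ContDiff ℝ 1 fun τ => gTilde G x Γ (Function.update s e τ) a b := by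
  simp only [gTilde, of_apply]
  split_ifs with hab
  · exact contDiff_const
  · by_cases h : s(a, b) = e
    · subst h
      simp only [Function.update_self]
      fun_prop
    · simp only [Function.update_of_ne h]
      exact contDiff_const

/-- When a single `s_ab` varies, `G̃` moves along a smooth curve of symmetric matrices with constant
diagonal; regularity of `F` is therefore required along such curves only. -/
theorem literalOp_eq_graphOp_of_contDiffAt {d n : ℕ} {G : Point d → ℝ} (hG : ∀ x, G (-x) = G x)
    {x : Fin n → Point d} {Γ : SimpleGraph (Fin n)}
    (hpd : ∀ s : SVars n, (∀ e, s e ∈ Set.Icc (0 : ℝ) 1) → (gTilde G x Γ s).PosDef)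
    {F : Matrix (Fin n) (Fin n) ℝ → ℝ}
    (hF : ∀ (A : ℝ → Matrix (Fin n) (Fin n) ℝ) (τ₀ : ℝ),
      (∀ a b, ContDiff ℝ 1 fun τ => A τ a b) → (∀ τ, (A τ).IsSymm) → (∀ τ a, A τ a a = G 0) →
      (A τ₀).PosDef → ContDiffAt ℝ 1 (fun τ => F (A τ)) τ₀) :
    literalOp Γ (fun s => F (gTilde G x Γ s)) = graphOp Γ (fun s => F (gTilde G x Γ s)) := by
  refine IsSmoothOnCube.literalOp_eq ⟨fun s hs e σ hσ => ?_, fun s e he τ => ?_⟩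
  · exact hF (fun τ => gTilde G x Γ (Function.update s e τ)) σ
      (contDiff_gTilde_update G x Γ s e) (fun τ => gTilde_isSymm hG x Γ _)
      (fun τ a => gTilde_diag G x Γ _ a) (hpd _ (update_mem_cube hs e hσ))
  · simp only [gTilde_update_of_notMem G x Γ s he]

end LegendreQFT

end

noncomputable section

namespace LegendreQFT

/-! ### Sums over connected graphs -/

section Inversion

variable {ι : Type*} [DecidableEq ι]

/-- The alternating sum `∑_{T ⊆ E} (-1)^{|E \ T|} Φ(T)`. -/
def signedSum (Φ : Finset ι → ℝ) (E : Finset ι) : ℝ :=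
  ∑ T ∈ E.powerset, (-1) ^ (E \ T).card * Φ T

theorem signedSum_insert (Φ : Finset ι → ℝ) {E : Finset ι} {e : ι} (he : e ∉ E) :
    signedSum Φ (insert e E) = signedSum (fun T => Φ (insert e T)) E - signedSum Φ E := by
  unfold signedSum
  rw [Finset.sum_powerset_insert he, add_comm, sub_eq_add_neg, ← Finset.sum_neg_distrib]
  congr 1
  · refine Finset.sum_congr rfl fun T hT => ?_
    rw [Finset.insert_sdiff_insert, Finset.sdiff_insert_of_notMem he]
  · refine Finset.sum_congr rfl fun T hT => ?_
    have heT : e ∉ T := fun h => he (Finset.mem_powerset.1 hT h)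
    rw [Finset.insert_sdiff_of_notMem _ heT, Finset.card_insert_of_notMem
      (fun h => he (Finset.mem_sdiff.1 h).1), pow_succ]
    ring

/-- Möbius inversion on the lattice of subsets; adding one element splits the sum into two, of which
one cancels. -/
theorem sum_signedSum (Φ : Finset ι → ℝ) (K : Finset ι) :
    ∑ E ∈ K.powerset, signedSum Φ E = Φ K := by
  induction K using Finset.induction_on generalizing Φ with
  | empty => simp [signedSum]
  | insert e K he ih =>
    have h : ∀ E ∈ K.powerset, signedSum Φ (insert e E) =
        signedSum (fun T => Φ (insert e T)) E - signedSum Φ E := fun E hE =>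
      signedSum_insert Φ fun h => he (Finset.mem_powerset.1 hE h)
    rw [Finset.sum_powerset_insert he, Finset.sum_congr rfl h, Finset.sum_sub_distrib, ih, ih]
    ring

end Inversion

open Classical in
/-- The edges of a graph. -/
def edges {n : ℕ} (Γ : SimpleGraph (Fin n)) : Finset (Sym2 (Fin n)) :=
  Finset.univ.filter (· ∈ Γ.edgeSet)

theorem mem_edges {n : ℕ} {Γ : SimpleGraph (Fin n)} {e : Sym2 (Fin n)} :
    e ∈ edges Γ ↔ e ∈ Γ.edgeSet := by simp [edges]

theorem edges_injective {n : ℕ} : Function.Injective (edges (n := n)) := by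
  intro Γ Γ' h
  apply SimpleGraph.edgeSet_injective
  ext e
  rw [← mem_edges, h, mem_edges]

theorem edges_subset_edges {n : ℕ} {Γ Γ' : SimpleGraph (Fin n)} :
    edges Γ ⊆ edges Γ' ↔ Γ ≤ Γ' := by
  rw [← SimpleGraph.edgeSet_subset_edgeSet]
  simp only [Finset.subset_iff, Set.subset_def, mem_edges]

theorem edges_fromEdgeSet {n : ℕ} {Γ : SimpleGraph (Fin n)} {T : Finset (Sym2 (Fin n))}
    (hT : T ⊆ edges Γ) : edges (SimpleGraph.fromEdgeSet (T : Set (Sym2 (Fin n)))) = T := by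
  ext e
  rw [mem_edges, SimpleGraph.edgeSet_fromEdgeSet]
  constructor
  · exact fun h => h.1
  · exact fun h => ⟨h, Γ.not_isDiag_of_mem_edgeSet (mem_edges.1 (hT h))⟩

-- Steps off the edges of `Γ` act as the identity and steps on edges are differences. Expanding the
-- differences leaves an inclusion-exclusion sum over the set `T` of edges with `s = 1`, with no
-- regularity of `F` required.
open Classical in
theorem foldr_pairStep_eq {n : ℕ} {Γ : SimpleGraph (Fin n)} {F : SVars n → ℝ}
    (hF : ∀ s : SVars n, ∀ e ∉ Γ.edgeSet, ∀ τ, F (Function.update s e τ) = F s)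
    (l : List (Sym2 (Fin n))) (hl : l.Nodup) : ∀ s : SVars n, l.foldr (pairStep Γ) F s =
      signedSum (fun T => F fun e => if e ∈ l.toFinset.filter (· ∈ Γ.edgeSet) then
        (if e ∈ T then 1 else 0) else s e) (l.toFinset.filter (· ∈ Γ.edgeSet)) := by
  induction l with
  | nil => intro s; simp [signedSum]
  | cons e l ih =>
    intro s
    have hel : e ∉ l := (List.nodup_cons.1 hl).1
    have ih' := ih (List.nodup_cons.1 hl).2
    have hupd : ∀ s : SVars n, ∀ e ∉ Γ.edgeSet, ∀ τ,
        l.foldr (pairStep Γ) F (Function.update s e τ) = l.foldr (pairStep Γ) F s := by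
      clear ih ih' hl hel
      induction l with
      | nil => exact hF
      | cons e' l ih => exact pairStep_update ih e'
    rw [List.foldr_cons]
    by_cases he : e ∈ Γ.edgeSet
    · have hne : e ∉ l.toFinset.filter (· ∈ Γ.edgeSet) := by simp [hel]
      have hset : (e :: l).toFinset.filter (· ∈ Γ.edgeSet) =
          insert e (l.toFinset.filter (· ∈ Γ.edgeSet)) := by
        rw [List.toFinset_cons, Finset.filter_insert, if_pos he]
      rw [pairStep, if_pos he, ih', ih', hset, signedSum_insert _ hne]
      congr 1
      · refine Finset.sum_congr rfl fun T hT => ?_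
        refine congrArg _ (congrArg F ?_)
        funext e'
        by_cases h : e' = e
        · subst h; simp [hel]
        · simp [h]
      · refine Finset.sum_congr rfl fun T hT => ?_
        refine congrArg _ (congrArg F ?_)
        funext e'
        have heT : e ∉ T := fun h => hne (Finset.mem_powerset.1 hT h)
        by_cases h : e' = e
        · subst h; simp [hel, heT]
        · simp [h]
    · have hset : (e :: l).toFinset.filter (· ∈ Γ.edgeSet) =
          l.toFinset.filter (· ∈ Γ.edgeSet) := by
        rw [List.toFinset_cons, Finset.filter_insert, if_neg he]
      rw [pairStep_of_notMem hupd he, hset, ih']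

open Classical in
theorem graphOp_eq_signedSum {n : ℕ} {Γ : SimpleGraph (Fin n)} {F : SVars n → ℝ}
    (hF : ∀ s : SVars n, ∀ e ∉ Γ.edgeSet, ∀ τ, F (Function.update s e τ) = F s) :
    graphOp Γ F = signedSum (fun T => F fun e => if e ∈ T then 1 else 0) (edges Γ) := by
  have hset : (vertexPairs n).toList.toFinset.filter (· ∈ Γ.edgeSet) = edges Γ := by
    ext e
    simp only [Finset.toList_toFinset, Finset.mem_filter, mem_edges, vertexPairs, Finset.mem_univ,
      true_and, and_iff_right_iff_imp]
    exact fun h => Γ.not_isDiag_of_mem_edgeSet h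
  rw [graphOp, foldr_pairStep_eq hF _ (Finset.nodup_toList _), hset]
  refine Finset.sum_congr rfl fun T hT => ?_
  refine congrArg _ (congrArg F ?_)
  funext e
  by_cases h : e ∈ edges Γ
  · simp [h]
  · have : e ∉ T := fun h' => h (Finset.mem_powerset.1 hT h')
    simp [h, this]

/-- The graph whose edges are the pairs of equal colour. -/
def colourGraph {n N : ℕ} (c : Fin n → Fin N) : SimpleGraph (Fin n) where
  Adj a b := a ≠ b ∧ c a = c b
  symm := ⟨fun _ _ h => ⟨h.1.symm, h.2.symm⟩⟩
  loopless := ⟨fun _ h => h.1 rfl⟩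

/-- The number of connected components. -/
def componentCount {n : ℕ} (Γ : SimpleGraph (Fin n)) : ℕ := Nat.card Γ.ConnectedComponent

theorem componentCount_le {n : ℕ} (Γ : SimpleGraph (Fin n)) : componentCount Γ ≤ n := by
  have := Nat.card_le_card_of_surjective Γ.connectedComponentMk Quot.mk_surjective
  simpa [componentCount] using this

theorem componentCount_eq_one_iff {n : ℕ} (Γ : SimpleGraph (Fin n)) :
    componentCount Γ = 1 ↔ Γ.Connected := by
  rw [componentCount, Nat.card_eq_one_iff_unique]
  constructor
  · rintro ⟨h1, ⟨c⟩⟩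
    have : Nonempty (Fin n) := c.nonempty_supp.to_type
    exact ⟨fun a b => SimpleGraph.ConnectedComponent.exact (Subsingleton.elim _ _)⟩
  · intro h
    have := h.nonempty
    exact ⟨h.preconnected.subsingleton_connectedComponent,
      this.map Γ.connectedComponentMk⟩

-- A colouring that is constant along every edge is the same as a function on the connected
-- components.
open Classical in
theorem card_colourings {n : ℕ} (Γ : SimpleGraph (Fin n)) (N : ℕ) :
    (Finset.univ.filter fun c : Fin n → Fin N => Γ ≤ colourGraph c).card =
      N ^ componentCount Γ := by
  have e : {c : Fin n → Fin N // Γ ≤ colourGraph c} ≃ (Γ.ConnectedComponent → Fin N) :=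
    { toFun := fun c => SimpleGraph.ConnectedComponent.lift c.1 fun v w p hp => by
        clear hp
        induction p with
        | nil => rfl
        | cons h p ih => exact (c.2 h).2.trans ih
      invFun := fun f => ⟨fun a => f (Γ.connectedComponentMk a), fun a b h =>
        ⟨h.ne, congrArg f (SimpleGraph.ConnectedComponent.sound h.reachable)⟩⟩
      left_inv := fun c => by
        ext a
        rfl
      right_inv := fun f => by
        funext x
        induction x using SimpleGraph.ConnectedComponent.ind
        rfl }
  rw [← Fintype.card_subtype, Fintype.card_congr e, Fintype.card_fun, Fintype.card_fin,
    componentCount, Nat.card_eq_fintype_card]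

/-- Weights that extract the linear coefficient of a polynomial of degree at most `n` from its
values at `0, …, n`. -/
def linearWeight (n N : ℕ) : ℝ :=
  (Lagrange.basis (Finset.range (n + 1)) (fun i : ℕ => (i : ℝ)) N).coeff 1

theorem sum_linearWeight {n : ℕ} {p : ℝ[X]} (hp : p.natDegree ≤ n) :
    ∑ N ∈ Finset.range (n + 1), linearWeight n N * p.eval (N : ℝ) = p.coeff 1 := by
  have h := Lagrange.eq_interpolate (s := Finset.range (n + 1)) (v := fun i : ℕ => (i : ℝ))
    (f := p) (Nat.cast_injective.injOn)
    (by
      rw [Finset.card_range]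
      exact lt_of_le_of_lt degree_le_natDegree (by exact_mod_cast Nat.lt_succ_of_le hp))
  conv_rhs => rw [h, Lagrange.interpolate_apply, finsetSum_coeff]
  refine Finset.sum_congr rfl fun N _ => ?_
  rw [coeff_C_mul, linearWeight, mul_comm]

-- In `p(z) = ∑_Γ signedSum Φ(Γ) z ^ (components of Γ)` the linear coefficient singles out the
-- connected graphs. At `z = N` the power counts the colourings `c` with `Γ ≤ colourGraph c`; after
-- exchanging the sums, Möbius inversion over the subgraphs of `colourGraph c` leaves `Φ` at that
-- graph. Interpolation at `0, …, n` recovers the linear coefficient.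
open Classical in
theorem sum_connected_signedSum {n : ℕ} (Φ : Finset (Sym2 (Fin n)) → ℝ) :
    ∑ Γ ∈ connectedGraphs n, signedSum Φ (edges Γ) =
      ∑ N ∈ Finset.range (n + 1), linearWeight n N *
        ∑ c : Fin n → Fin N, Φ (edges (colourGraph c)) := by
  set p : ℝ[X] := ∑ Γ : SimpleGraph (Fin n), C (signedSum Φ (edges Γ)) * X ^ componentCount Γ
  have hdeg : p.natDegree ≤ n := natDegree_sum_le_of_forall_le _ _ fun Γ _ =>
    (natDegree_C_mul_X_pow_le _ _).trans (componentCount_le Γ)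
  have hcoeff : p.coeff 1 = ∑ Γ ∈ connectedGraphs n, signedSum Φ (edges Γ) := by
    rw [finsetSum_coeff, connectedGraphs, Finset.sum_filter]
    refine Finset.sum_congr rfl fun Γ _ => ?_
    rw [coeff_C_mul_X_pow]
    simp only [← componentCount_eq_one_iff, eq_comm]
  rw [← hcoeff, ← sum_linearWeight hdeg]
  refine Finset.sum_congr rfl fun N _ => ?_
  congr 1
  have h1 : ∀ K : SimpleGraph (Fin n), Φ (edges K) =
      ∑ Γ : SimpleGraph (Fin n), if Γ ≤ K then signedSum Φ (edges Γ) else 0 := by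
    intro K
    rw [← sum_signedSum Φ, ← Finset.sum_filter]
    refine (Finset.sum_bij (fun Γ _ => edges Γ) ?_ ?_ ?_ ?_).symm
    · intro Γ h
      exact Finset.mem_powerset.2 (edges_subset_edges.2 (Finset.mem_filter.1 h).2)
    · exact fun _ _ _ _ h => edges_injective h
    · intro T hT
      have h := edges_fromEdgeSet (Finset.mem_powerset.1 hT)
      refine ⟨SimpleGraph.fromEdgeSet T, Finset.mem_filter.2 ⟨Finset.mem_univ _, ?_⟩, h⟩
      rw [← edges_subset_edges, h]
      exact Finset.mem_powerset.1 hT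
    · exact fun _ _ => rfl
  simp only [p, eval_finsetSum, eval_mul, eval_C, eval_pow, eval_X]
  simp_rw [h1]
  rw [Finset.sum_comm]
  refine Finset.sum_congr rfl fun Γ _ => ?_
  rw [← Finset.sum_filter, Finset.sum_const, card_colourings, nsmul_eq_mul, mul_comm]
  push_cast
  rfl

/-- The covariance matrix of independent copies of the field, the copy at `x_a` being `c a`. -/
def blockMatrix {d n N : ℕ} (G : Point d → ℝ) (x : Fin n → Point d) (c : Fin n → Fin N) :
    Matrix (Fin n) (Fin n) ℝ :=
  Matrix.of fun a b => if c a = c b then G (x a - x b) else 0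

open Classical in
theorem gTilde_indicator {d n N : ℕ} (G : Point d → ℝ) (x : Fin n → Point d) (c : Fin n → Fin N) :
    gTilde G x ⊤ (fun e => if e ∈ edges (colourGraph c) then 1 else 0) = blockMatrix G x c := by
  ext a b
  simp only [gTilde, blockMatrix, of_apply, mem_edges, SimpleGraph.mem_edgeSet, colourGraph,
    SimpleGraph.adjMatrix_apply, SimpleGraph.top_adj]
  by_cases h : a = b
  · subst h; simp
  · by_cases h' : c a = c b <;> simp [h, h']

-- The variables vanish off `T`, so the adjacency factor of `Γ` is invisible and one set function
-- `Φ` serves all graphs.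
open Classical in
theorem gTilde_indicator_of_subset {d n : ℕ} (G : Point d → ℝ) (x : Fin n → Point d)
    {Γ : SimpleGraph (Fin n)} {T : Finset (Sym2 (Fin n))} (hT : T ⊆ edges Γ) :
    gTilde G x Γ (fun e => if e ∈ T then 1 else 0) =
      gTilde G x ⊤ (fun e => if e ∈ T then 1 else 0) := by
  ext a b
  simp only [gTilde, of_apply, SimpleGraph.adjMatrix_apply, SimpleGraph.top_adj]
  by_cases h : s(a, b) ∈ T
  · have := mem_edges.1 (hT h)
    rw [SimpleGraph.mem_edgeSet] at this
    simp [this, this.ne]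
  · simp [h]

/-- The sum over connected graphs as a combination of sums over colourings. -/
theorem sum_connected_graphOp {d n : ℕ} (G : Point d → ℝ)
    (H : ((Fin n → Point d) → Matrix (Fin n) (Fin n) ℝ) → ℝ) :
    ∑ Γ ∈ connectedGraphs n, graphOp Γ (fun s => H fun x => gTilde G x Γ s) =
      ∑ N ∈ Finset.range (n + 1), linearWeight n N *
        ∑ c : Fin n → Fin N, H fun x => blockMatrix G x c := by
  classical
  have h := sum_connected_signedSum (n := n)
    (fun T => H fun x => gTilde G x ⊤ fun e => if e ∈ T then 1 else 0)
  simp only [gTilde_indicator] at h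
  rw [← h]
  refine Finset.sum_congr rfl fun Γ _ => ?_
  rw [graphOp_eq_signedSum]
  · refine Finset.sum_congr rfl fun T hT => ?_
    simp only [gTilde_indicator_of_subset G _ (Finset.mem_powerset.1 hT)]
  · intro s e he τ
    simp only [gTilde_update_of_notMem G _ Γ s he]

end LegendreQFT

end

/-! ### Derivatives of `exp (z K)` as polynomials in `z` -/

noncomputable section

namespace LegendreQFT

/-- Derivatives of `exp (z K)` at a zero of `K` are polynomials in `z`, with the derivative of `K`
as linear coefficient. -/
theorem exists_polynomial_iteratedDeriv_exp {K : ℝ → ℝ} (hK : AnalyticAt ℝ K 0) (h0 : K 0 = 0)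
    (n : ℕ) : ∃ p : ℝ[X], p.natDegree ≤ n ∧ p.coeff 0 = (if n = 0 then 1 else 0) ∧
      (n ≠ 0 → p.coeff 1 = iteratedDeriv n K 0) ∧
      ∀ z : ℝ, iteratedDeriv n (fun t => Real.exp (z * K t)) 0 = p.eval z := by
  induction n using Nat.strong_induction_on with
  | _ n ih =>
    rcases n with _ | n
    · exact ⟨1, by simp, by simp, by simp, fun z => by simp [h0]⟩
    · have ih' : ∀ i : ℕ, ∃ p : ℝ[X], i ≤ n → p.natDegree ≤ i ∧
          p.coeff 0 = (if i = 0 then 1 else 0) ∧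
          ∀ z : ℝ, iteratedDeriv i (fun t => Real.exp (z * K t)) 0 = p.eval z := by
        intro i
        by_cases hi : i ≤ n
        · obtain ⟨p, h1, h2, -, h3⟩ := ih i (by lia)
          exact ⟨p, fun _ => ⟨h1, h2, h3⟩⟩
        · exact ⟨0, fun h => absurd h hi⟩
      choose p hp using ih'
      -- Leibniz' rule for `(exp (z K))' = z K' exp (z K)`. The factor `X` raises the degree by one
      -- and removes the constant term; only the summand `i = n` contributes to the linear
      -- coefficient, since the others have zero constant term.
      refine ⟨X * ∑ i ∈ Finset.range (n + 1),
        C ((n.choose i : ℝ) * iteratedDeriv (i + 1) K 0) * p (n - i), ?_, ?_, ?_, ?_⟩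
      · rw [add_comm n 1]
        refine natDegree_mul_le_of_le natDegree_X_le (natDegree_sum_le_of_forall_le _ _
          fun i hi => (natDegree_C_mul_le _ _).trans ?_)
        exact (hp (n - i) (Nat.sub_le _ _)).1.trans (Nat.sub_le _ _)
      · simp
      · intro _
        rw [coeff_X_mul, finsetSum_coeff, Finset.sum_eq_single_of_mem n (by simp)]
        · rw [coeff_C_mul, Nat.sub_self, (hp 0 (Nat.zero_le _)).2.1]
          simp
        · intro i hi hin
          have : n - i ≠ 0 := by
            have := Finset.mem_range.1 hi
            lia
          rw [coeff_C_mul, (hp _ (Nat.sub_le _ _)).2.1, if_neg this, mul_zero]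
      · intro z
        have hd : deriv (fun t => Real.exp (z * K t)) =ᶠ[nhds 0]
            fun t => (z * deriv K t) * Real.exp (z * K t) := by
          filter_upwards [hK.eventually_analyticAt] with t ht
          have := ((ht.differentiableAt.hasDerivAt.const_mul z).exp).deriv
          rw [this]
          ring
        have hKd : ContDiffAt ℝ n (fun t => z * deriv K t) 0 :=
          (analyticAt_const.mul hK.deriv).contDiffAt
        have hKe : ContDiffAt ℝ n (fun t => Real.exp (z * K t)) 0 :=
          (analyticAt_const.mul hK).rexp.contDiffAt
        rw [iteratedDeriv_succ', hd.iteratedDeriv_eq, iteratedDeriv_fun_mul hKd hKe, eval_mul,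
          eval_X, eval_finsetSum, Finset.mul_sum]
        refine Finset.sum_congr rfl fun i hi => ?_
        rw [eval_mul, eval_C, (hp _ (Nat.sub_le _ _)).2.2 z, iteratedDeriv_succ',
          iteratedDeriv_const_mul_field]
        ring

end LegendreQFT

end

noncomputable section

namespace LegendreQFT

/-! ### The covariance form -/

theorem measurableSet_box (d : ℕ) (L : ℝ) : MeasurableSet (box d L) :=
  MeasurableSet.univ_pi fun _ => measurableSet_Ico

theorem box_subset_Icc (d : ℕ) (L : ℝ) :
    box d L ⊆ Set.Icc (fun _ => -(L / 2)) (fun _ => L / 2) := fun _ hx =>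
  ⟨fun i => (hx i (Set.mem_univ i)).1, fun i => (hx i (Set.mem_univ i)).2.le⟩

instance (d : ℕ) (L : ℝ) : IsFiniteMeasure ((volume : Measure (Point d)).restrict (box d L)) :=
  isFiniteMeasure_restrict.2
    ((measure_mono (box_subset_Icc d L)).trans_lt isCompact_Icc.measure_lt_top).ne

theorem exists_forall_abs_le {d : ℕ} {G : Point d → ℝ} (hG : Continuous G) (L : ℝ) (x₀ : Point d) :
    ∃ M, 0 ≤ M ∧ ∀ x ∈ Metric.closedBall x₀ 1, ∀ y ∈ box d L, |G (x - y)| ≤ M := by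
  have hc : IsCompact ((fun p : Point d × Point d => p.1 - p.2) ''
      (Metric.closedBall x₀ 1 ×ˢ Set.Icc (fun _ => -(L / 2)) (fun _ => L / 2))) :=
    ((isCompact_closedBall x₀ 1).prod isCompact_Icc).image (by fun_prop)
  obtain ⟨M, hM⟩ := hc.exists_bound_of_continuousOn hG.continuousOn
  refine ⟨max M 0, le_max_right _ _, fun x hx y hy => (hM (x - y) ?_).trans (le_max_left _ _)⟩
  exact ⟨(x, y), ⟨hx, box_subset_Icc d L hy⟩, rfl⟩

theorem exists_forall_abs_le_box {d : ℕ} {G : Point d → ℝ} (hG : Continuous G) (L : ℝ) :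
    ∃ M, 0 ≤ M ∧ ∀ x ∈ box d L, ∀ y ∈ box d L, |G (x - y)| ≤ M := by
  have hc : IsCompact ((fun p : Point d × Point d => p.1 - p.2) ''
      (Set.Icc (fun _ => -(L / 2)) (fun _ => L / 2) ×ˢ
        Set.Icc (fun _ => -(L / 2)) (fun _ => L / 2))) :=
    (isCompact_Icc.prod isCompact_Icc).image (by fun_prop)
  obtain ⟨M, hM⟩ := hc.exists_bound_of_continuousOn hG.continuousOn
  refine ⟨max M 0, le_max_right _ _, fun x hx y hy => (hM (x - y) ?_).trans (le_max_left _ _)⟩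
  exact ⟨(x, y), ⟨box_subset_Icc d L hx, box_subset_Icc d L hy⟩, rfl⟩

theorem integrable_fieldSpace {d : ℕ} {L : ℝ} (f : FieldSpace d L) :
    Integrable f ((volume : Measure (Point d)).restrict (box d L)) :=
  (Lp.memLp f).integrable (by norm_num)

theorem ae_mem_box (d : ℕ) (L : ℝ) :
    ∀ᵐ x ∂(volume : Measure (Point d)).restrict (box d L), x ∈ box d L :=
  ae_restrict_mem (measurableSet_box d L)

theorem integrable_kernel_mul {d : ℕ} {L : ℝ} {G : Point d → ℝ} (hG : Continuous G)
    (f : FieldSpace d L) (x : Point d) :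
    Integrable (fun y => G (x - y) * f y) ((volume : Measure (Point d)).restrict (box d L)) := by
  obtain ⟨M, -, hM⟩ := exists_forall_abs_le hG L x
  refine (integrable_fieldSpace f).bdd_mul (c := M) (by fun_prop) ?_
  filter_upwards [ae_mem_box d L] with y hy
  exact hM x (Metric.mem_closedBall_self (by norm_num)) y hy

theorem continuous_classicalField {d : ℕ} {L : ℝ} {G : Point d → ℝ} (hG : Continuous G)
    (f : FieldSpace d L) : Continuous (classicalField G f) := by
  refine continuous_iff_continuousAt.2 fun x₀ => ?_
  obtain ⟨M, -, hM⟩ := exists_forall_abs_le hG L x₀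
  refine continuousAt_of_dominated (bound := fun y => M * |f y|)
    (Filter.Eventually.of_forall fun x => (integrable_kernel_mul hG f x).aestronglyMeasurable) ?_
    ((integrable_fieldSpace f).abs.const_mul M) ?_
  · filter_upwards [Metric.closedBall_mem_nhds x₀ one_pos] with x hx
    filter_upwards [ae_mem_box d L] with y hy
    rw [Real.norm_eq_abs, abs_mul]
    exact mul_le_mul_of_nonneg_right (hM x hx y hy) (abs_nonneg _)
  · refine Filter.Eventually.of_forall fun y => ?_
    fun_prop

theorem classicalField_add {d : ℕ} {L : ℝ} {G : Point d → ℝ} (hG : Continuous G)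
    (f f' : FieldSpace d L) (x : Point d) :
    classicalField G (f + f') x = classicalField G f x + classicalField G f' x := by
  unfold classicalField
  rw [← integral_add (integrable_kernel_mul hG f x) (integrable_kernel_mul hG f' x)]
  refine integral_congr_ae ?_
  filter_upwards [Lp.coeFn_add f f'] with y hy
  rw [hy, Pi.add_apply]
  ring

theorem classicalField_smul {d : ℕ} {L : ℝ} (G : Point d → ℝ) (c : ℝ)
    (f : FieldSpace d L) (x : Point d) :
    classicalField G (c • f) x = c * classicalField G f x := by
  unfold classicalField
  rw [← integral_const_mul]
  refine integral_congr_ae ?_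
  filter_upwards [Lp.coeFn_smul c f] with y hy
  rw [hy, Pi.smul_apply, smul_eq_mul]
  ring

theorem exists_abs_classicalField_le {d : ℕ} {L : ℝ} {G : Point d → ℝ} (hG : Continuous G)
    (f : FieldSpace d L) : ∃ M, ∀ x ∈ box d L, |classicalField G f x| ≤ M := by
  obtain ⟨M, hM⟩ := (isCompact_Icc (a := fun _ : Fin d => -(L / 2))
    (b := fun _ => L / 2)).exists_bound_of_continuousOn
    (continuous_classicalField hG f).continuousOn
  exact ⟨M, fun x hx => hM x (box_subset_Icc d L hx)⟩

/-- The covariance form `∫∫ f(x) G(x - y) f'(y)`. -/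
def covForm {d : ℕ} {L : ℝ} (G : Point d → ℝ) (f f' : FieldSpace d L) : ℝ :=
  ∫ x in box d L, f x * classicalField G f' x

theorem integrable_mul_classicalField {d : ℕ} {L : ℝ} {G : Point d → ℝ} (hG : Continuous G)
    (f f' : FieldSpace d L) : Integrable (fun x => f x * classicalField G f' x)
      ((volume : Measure (Point d)).restrict (box d L)) := by
  obtain ⟨M, hM⟩ := exists_abs_classicalField_le hG f'
  simp_rw [mul_comm (f _)]
  refine (integrable_fieldSpace f).bdd_mul (c := M)
    (continuous_classicalField hG f').aestronglyMeasurable ?_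
  filter_upwards [ae_mem_box d L] with y hy
  exact hM y hy

theorem covForm_add_left {d : ℕ} {L : ℝ} {G : Point d → ℝ} (hG : Continuous G)
    (f f' h : FieldSpace d L) : covForm G (f + f') h = covForm G f h + covForm G f' h := by
  unfold covForm
  rw [← integral_add (integrable_mul_classicalField hG f h) (integrable_mul_classicalField hG f' h)]
  refine integral_congr_ae ?_
  filter_upwards [Lp.coeFn_add f f'] with y hy
  rw [hy, Pi.add_apply]
  ring

theorem covForm_smul_left {d : ℕ} {L : ℝ} (G : Point d → ℝ) (c : ℝ)
    (f h : FieldSpace d L) : covForm G (c • f) h = c * covForm G f h := by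
  unfold covForm
  rw [← integral_const_mul]
  refine integral_congr_ae ?_
  filter_upwards [Lp.coeFn_smul c f] with y hy
  rw [hy, Pi.smul_apply, smul_eq_mul]
  ring

theorem covForm_comm {d : ℕ} {L : ℝ} {G : Point d → ℝ} (hG : Continuous G)
    (he : ∀ x, G (-x) = G x) (f f' : FieldSpace d L) : covForm G f f' = covForm G f' f := by
  unfold covForm classicalField
  simp_rw [← integral_const_mul]
  rw [integral_integral_swap]
  · refine integral_congr_ae (Filter.Eventually.of_forall fun x => ?_)
    refine integral_congr_ae (Filter.Eventually.of_forall fun y => ?_)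
    simp only
    rw [show x - y = -(y - x) by abel, he]
    ring
  · obtain ⟨M, -, hM⟩ := exists_forall_abs_le_box hG L
    have h := ((integrable_fieldSpace f).mul_prod (integrable_fieldSpace f')).bdd_mul (c := M)
      (f := fun p : Point d × Point d => G (p.1 - p.2)) (by fun_prop) ?_
    · refine h.congr (Filter.Eventually.of_forall fun p => ?_)
      simp only [Function.uncurry]
      ring
    · rw [Measure.prod_restrict]
      filter_upwards [ae_restrict_mem ((measurableSet_box d L).prod (measurableSet_box d L))]
        with p hp
      exact hM p.1 hp.1 p.2 hp.2

theorem covForm_add_right {d : ℕ} {L : ℝ} {G : Point d → ℝ} (hG : Continuous G)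
    (f h h' : FieldSpace d L) : covForm G f (h + h') = covForm G f h + covForm G f h' := by
  unfold covForm
  rw [← integral_add (integrable_mul_classicalField hG f h) (integrable_mul_classicalField hG f h')]
  simp_rw [classicalField_add hG, mul_add]

theorem covForm_smul_right {d : ℕ} {L : ℝ} (G : Point d → ℝ) (c : ℝ)
    (f h : FieldSpace d L) : covForm G f (c • h) = c * covForm G f h := by
  unfold covForm
  rw [← integral_const_mul]
  simp_rw [classicalField_smul, mul_left_comm]

theorem covForm_sum_left {d : ℕ} {L : ℝ} {G : Point d → ℝ} (hG : Continuous G) {ι : Type*}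
    (s : Finset ι) (f : ι → FieldSpace d L) (h : FieldSpace d L) :
    covForm G (∑ i ∈ s, f i) h = ∑ i ∈ s, covForm G (f i) h := by
  classical
  induction s using Finset.induction_on with
  | empty => simpa using covForm_smul_left G 0 (0 : FieldSpace d L) h
  | insert i s hi ih => rw [Finset.sum_insert hi, Finset.sum_insert hi, covForm_add_left hG, ih]

theorem covForm_sum_right {d : ℕ} {L : ℝ} {G : Point d → ℝ} (hG : Continuous G) {ι : Type*}
    (s : Finset ι) (h : FieldSpace d L) (f : ι → FieldSpace d L) :
    covForm G h (∑ i ∈ s, f i) = ∑ i ∈ s, covForm G h (f i) := by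
  classical
  induction s using Finset.induction_on with
  | empty => simpa using covForm_smul_right G 0 h (0 : FieldSpace d L)
  | insert i s hi ih => rw [Finset.sum_insert hi, Finset.sum_insert hi, covForm_add_right hG, ih]

end LegendreQFT

end

noncomputable section

namespace LegendreQFT

/-! ### The Gaussian field -/

open ProbabilityTheory Complex

instance (d : ℕ) (L : ℝ) : SecondCountableTopology (FieldSpace d L) :=
  have : Fact ((2 : ENNReal) ≠ ⊤) := ⟨by norm_num⟩
  Lp.SecondCountableTopology

theorem inner_fieldSpace {d : ℕ} {L : ℝ} (f f' : FieldSpace d L) :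
    inner ℝ f f' = ∫ x in box d L, f x * f' x := by
  rw [L2.inner_def]
  refine integral_congr_ae (Filter.Eventually.of_forall fun x => ?_)
  simp [mul_comm]

theorem charFun_eq_covForm {d : ℕ} {L : ℝ} {G : Point d → ℝ} {μ : Measure (FieldSpace d L)}
    (hμ : IsGaussianField G μ) (f : FieldSpace d L) :
    charFun μ f = cexp (-(1 / 2 * covForm G f f : ℝ)) := by
  rw [hμ f]
  congr 4
  unfold covForm classicalField
  simp_rw [← integral_const_mul, mul_assoc]

section Field

variable {d : ℕ} {L : ℝ} {G : Point d → ℝ} {μ : Measure (FieldSpace d L)} [IsProbabilityMeasure μ]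

/-- Read off from `‖charFun‖ ≤ 1`: the existence of the measure already forces the covariance form
to be positive semidefinite. -/
theorem covForm_self_nonneg (hμ : IsGaussianField G μ) (f : FieldSpace d L) :
    0 ≤ covForm G f f := by
  have h := norm_charFun_le_one (μ := μ) f
  rw [charFun_eq_covForm hμ, Complex.norm_exp, ← Complex.ofReal_neg, Complex.ofReal_re,
    Real.exp_le_one_iff] at h
  linarith

theorem map_inner_eq_gaussianReal (hμ : IsGaussianField G μ)
    (f : FieldSpace d L) : μ.map (fun φ => inner ℝ f φ) =
      gaussianReal 0 (covForm G f f).toNNReal := by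
  have hm : Measurable fun φ : FieldSpace d L => inner ℝ f φ := by fun_prop
  have := Measure.isProbabilityMeasure_map (μ := μ) hm.aemeasurable
  refine Measure.ext_of_charFun (funext fun t => ?_)
  rw [charFun_gaussianReal, charFun_apply_real, integral_map hm.aemeasurable (by fun_prop)]
  have h := charFun_eq_covForm hμ (t • f)
  rw [charFun_apply] at h
  rw [Real.coe_toNNReal _ (covForm_self_nonneg hμ f)]
  calc _ = ∫ φ, cexp (inner ℝ φ (t • f) * I) ∂μ := by
        refine integral_congr_ae (Filter.Eventually.of_forall fun φ => ?_)
        simp only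
        rw [inner_smul_right, real_inner_comm, Complex.ofReal_mul]
    _ = _ := by
        rw [h, covForm_smul_left, covForm_smul_right]
        congr 1
        push_cast
        ring

/-- Gives access to Fernique's theorem. -/
theorem isGaussian_of_isGaussianField (hμ : IsGaussianField G μ) : IsGaussian μ := by
  refine isGaussian_of_map_eq_gaussianReal fun Λ => ?_
  set f := (InnerProductSpace.toDual ℝ (FieldSpace d L)).symm Λ
  refine ⟨0, (covForm G f f).toNNReal, ?_⟩
  rw [← map_inner_eq_gaussianReal hμ f]
  congr 1
  funext φ
  exact (InnerProductSpace.toDual_symm_apply).symm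

/-- The Gaussian measure in the presence of the source. -/
def sourceMeasure (μ : Measure (FieldSpace d L)) (j : FieldSpace d L) :
    Measure (FieldSpace d L) := μ.tilted fun φ => -inner ℝ j φ

/-- Fernique's theorem yields an integrable `exp (C ‖φ‖²)`; half of `C` is spent, by Young's
inequality, on absorbing the linear source term. -/
theorem exists_integrable_exp (hμ : IsGaussianField G μ) (j : FieldSpace d L) :
    ∃ ε > 0, Integrable (fun φ => Real.exp (-inner ℝ j φ) * Real.exp (ε * ‖φ‖ ^ 2)) μ := by
  have := isGaussian_of_isGaussianField hμ
  obtain ⟨C, hC, hint⟩ := IsGaussian.exists_integrable_exp_sq μ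
  refine ⟨C / 2, by positivity, ?_⟩
  refine (hint.const_mul (Real.exp (‖j‖ ^ 2 / (2 * C)))).mono'
    (Continuous.aestronglyMeasurable (by fun_prop)) (Filter.Eventually.of_forall fun φ => ?_)
  rw [Real.norm_eq_abs, abs_of_pos (by positivity), ← Real.exp_add, ← Real.exp_add,
    Real.exp_le_exp]
  have h1 : -inner ℝ j φ ≤ ‖j‖ * ‖φ‖ := (neg_le_abs _).trans (abs_real_inner_le_norm j φ)
  have h2 : ‖j‖ * ‖φ‖ ≤ ‖j‖ ^ 2 / (2 * C) + C / 2 * ‖φ‖ ^ 2 := by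
    have h3 : ‖j‖ ^ 2 / (2 * C) + C / 2 * ‖φ‖ ^ 2 - ‖j‖ * ‖φ‖ =
        (‖j‖ - C * ‖φ‖) ^ 2 / (2 * C) := by
      field_simp
      ring
    have : 0 ≤ (‖j‖ - C * ‖φ‖) ^ 2 / (2 * C) := by positivity
    linarith
  linarith

theorem integrable_exp_neg_inner (hμ : IsGaussianField G μ) (j : FieldSpace d L) :
    Integrable (fun φ => Real.exp (-inner ℝ j φ)) μ := by
  obtain ⟨ε, hε, h⟩ := exists_integrable_exp hμ j
  refine h.mono' (Continuous.aestronglyMeasurable (by fun_prop))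
    (Filter.Eventually.of_forall fun φ => ?_)
  rw [Real.norm_eq_abs, Real.abs_exp]
  exact le_mul_of_one_le_right (Real.exp_nonneg _) (Real.one_le_exp (by positivity))

theorem isProbabilityMeasure_sourceMeasure (hμ : IsGaussianField G μ) (j : FieldSpace d L) :
    IsProbabilityMeasure (sourceMeasure μ j) :=
  isProbabilityMeasure_tilted (integrable_exp_neg_inner hμ j)

theorem exists_integrable_exp_sourceMeasure (hμ : IsGaussianField G μ) (j : FieldSpace d L) :
    ∃ ε > 0, Integrable (fun φ => Real.exp (ε * ‖φ‖ ^ 2)) (sourceMeasure μ j) := by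
  obtain ⟨ε, hε, h⟩ := exists_integrable_exp hμ j
  exact ⟨ε, hε, (integrable_tilted_iff (integrable_exp_neg_inner hμ j) _).2 h⟩

/-- The joint characteristic function factorizes because the cross term of the covariance form
vanishes. -/
theorem indepFun_inner (hG : Continuous G) (he : ∀ x, G (-x) = G x) (hμ : IsGaussianField G μ)
    {f f' : FieldSpace d L} (hff : covForm G f f' = 0) :
    IndepFun (fun φ : FieldSpace d L => (inner ℝ f φ : ℝ)) (fun φ => (inner ℝ f' φ : ℝ)) μ := by
  have hm : ∀ f : FieldSpace d L, Measurable fun φ : FieldSpace d L => (inner ℝ f φ : ℝ) :=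
    fun f => by fun_prop
  rw [indepFun_iff_charFun_prod (hm f).aemeasurable (hm f').aemeasurable]
  intro t
  have hcov : covForm G (t.ofLp.1 • f + t.ofLp.2 • f') (t.ofLp.1 • f + t.ofLp.2 • f') =
      t.ofLp.1 ^ 2 * covForm G f f + t.ofLp.2 ^ 2 * covForm G f' f' := by
    rw [covForm_add_left hG, covForm_add_right hG, covForm_add_right hG]
    simp only [covForm_smul_left, covForm_smul_right, hff, covForm_comm hG he f' f]
    ring
  have hlhs : charFun (μ.map fun ω => WithLp.toLp 2 ((inner ℝ f ω : ℝ), (inner ℝ f' ω : ℝ))) t =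
      charFun μ (t.ofLp.1 • f + t.ofLp.2 • f') := by
    rw [charFun_apply, charFun_apply, integral_map]
    · refine integral_congr_ae (Filter.Eventually.of_forall fun φ => ?_)
      simp only [WithLp.prod_inner_apply, inner_add_right, inner_smul_right,
        real_inner_comm]
      simp [mul_comm]
    · fun_prop
    · fun_prop
  rw [hlhs, charFun_eq_covForm hμ, hcov, map_inner_eq_gaussianReal hμ, map_inner_eq_gaussianReal hμ,
    charFun_gaussianReal, charFun_gaussianReal, ← Complex.exp_add,
    Real.coe_toNNReal _ (covForm_self_nonneg hμ f), Real.coe_toNNReal _ (covForm_self_nonneg hμ f')]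
  congr 1
  push_cast
  ring

theorem covForm_eq_zero_of_self_eq_zero (hG : Continuous G) (he : ∀ x, G (-x) = G x)
    (hμ : IsGaussianField G μ) {j : FieldSpace d L} (hj : covForm G j j = 0)
    (f : FieldSpace d L) : covForm G f j = 0 := by
  by_contra hne
  -- With this `t` the covariance form at `f + t • j` would be `-1`.
  set t : ℝ := -(covForm G f f + 1) / (2 * covForm G f j)
  have h := covForm_self_nonneg hμ (f + t • j)
  rw [covForm_add_left hG, covForm_add_right hG, covForm_add_right hG] at h
  simp only [covForm_smul_left, covForm_smul_right, covForm_comm hG he j f, hj] at h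
  have h2 : t * (2 * covForm G f j) = -(covForm G f f + 1) :=
    div_mul_cancel₀ _ (by simpa using hne)
  linarith

/-- The characteristic functional of the field in the presence of the source. -/
theorem charFun_sourceMeasure (hG : Continuous G) (he : ∀ x, G (-x) = G x)
    (hμ : IsGaussianField G μ) (j f : FieldSpace d L) :
    charFun (sourceMeasure μ j) f =
      cexp (-(covForm G f j : ℝ) * I - (1 / 2 * covForm G f f : ℝ)) := by
  -- Projection of `f` onto `j` in the covariance form. If `j` has variance zero, its covariance
  -- with `f` vanishes as well, and `β = 0` serves.
  obtain ⟨β, hβ⟩ : ∃ β, covForm G f j = β * covForm G j j := by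
    by_cases hj : covForm G j j = 0
    · exact ⟨0, by rw [covForm_eq_zero_of_self_eq_zero hG he hμ hj, zero_mul]⟩
    · exact ⟨covForm G f j / covForm G j j, by field_simp⟩
  set f' := f - β • j with hf'
  have hff : f = β • j + f' := by rw [hf']; abel
  have hj0 : covForm G j f' = 0 := by
    have : covForm G f j = β * covForm G j j + covForm G f' j := by
      conv_lhs => rw [hff, covForm_add_left hG, covForm_smul_left]
    rw [covForm_comm hG he]
    linarith
  have hcov : covForm G f f = β ^ 2 * covForm G j j + covForm G f' f' := by
    conv_lhs => rw [hff, covForm_add_left hG, covForm_add_right hG, covForm_add_right hG]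
    simp only [covForm_smul_left, covForm_smul_right, hj0, covForm_comm hG he f' j]
    ring
  have hm : ∀ f : FieldSpace d L, Measurable fun φ : FieldSpace d L => (inner ℝ f φ : ℝ) :=
    fun f => by fun_prop
  -- Used at `z = -1` for the normalization and at `z = -1 + β i` for the component along `j`; the
  -- component `f'` is independent of it.
  have hmgf : ∀ z : ℂ, ∫ φ, cexp (z * (inner ℝ j φ : ℝ)) ∂μ =
      cexp (covForm G j j * z ^ 2 / 2) := by
    intro z
    have h := complexMGF_gaussianReal (map_inner_eq_gaussianReal hμ j) z
    rw [complexMGF, Real.coe_toNNReal _ (covForm_self_nonneg hμ j)] at h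
    simpa using h
  have hZ : ∫ φ, Real.exp (-inner ℝ j φ) ∂μ = Real.exp (covForm G j j / 2) := by
    have h := hmgf (-1)
    apply Complex.ofReal_injective
    rw [← integral_complex_ofReal]
    push_cast
    simpa using h
  have hind := indepFun_inner hG he hμ hj0
  have hprod : ∫ φ, cexp ((-1 + β * I) * (inner ℝ j φ : ℝ)) * cexp ((inner ℝ f' φ : ℝ) * I) ∂μ =
      (∫ φ, cexp ((-1 + β * I) * (inner ℝ j φ : ℝ)) ∂μ) *
        ∫ φ, cexp ((inner ℝ f' φ : ℝ) * I) ∂μ := by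
    have h2 : IndepFun (fun φ : FieldSpace d L => cexp ((-1 + β * I) * (inner ℝ j φ : ℝ)))
        (fun φ => cexp ((inner ℝ f' φ : ℝ) * I)) μ :=
      hind.comp (φ := fun u : ℝ => cexp ((-1 + β * I) * u)) (ψ := fun u : ℝ => cexp (u * I))
        (by fun_prop) (by fun_prop)
    exact h2.integral_fun_mul_eq_mul_integral (Continuous.aestronglyMeasurable (by fun_prop))
      (Continuous.aestronglyMeasurable (by fun_prop))
  have hchar : ∫ φ, cexp ((inner ℝ f' φ : ℝ) * I) ∂μ = cexp (-(1 / 2 * covForm G f' f' : ℝ)) := by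
    rw [← charFun_eq_covForm hμ, charFun_apply]
    simp_rw [real_inner_comm]
  rw [charFun_apply, sourceMeasure, integral_tilted, hZ]
  calc _ = ∫ φ, ((Real.exp (covForm G j j / 2) : ℝ) : ℂ)⁻¹ *
        (cexp ((-1 + β * I) * (inner ℝ j φ : ℝ)) * cexp ((inner ℝ f' φ : ℝ) * I)) ∂μ := by
        refine integral_congr_ae (Filter.Eventually.of_forall fun φ => ?_)
        simp only
        rw [Complex.real_smul, Complex.ofReal_div, div_mul_eq_mul_div, div_eq_inv_mul,
          Complex.ofReal_exp (-inner ℝ j φ), ← Complex.exp_add, ← Complex.exp_add]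
        congr 2
        rw [real_inner_comm f φ, hff, inner_add_left, inner_smul_left]
        simp only [conj_trivial]
        push_cast
        ring
    _ = _ := by
        rw [integral_const_mul, hprod, hmgf, hchar, Complex.ofReal_exp, ← Complex.exp_neg,
          ← Complex.exp_add, ← Complex.exp_add, hβ, hcov]
        congr 1
        push_cast
        have : I ^ 2 = -1 := I_sq
        linear_combination (covForm G j j : ℂ) * β ^ 2 / 2 * this

end Field

end LegendreQFT

end

noncomputable section

namespace LegendreQFT

/-! ### Pointwise values of the field -/

open Filter Topology

/-- The radii of the averaging cubes. -/
def avgRadius (k : ℕ) : ℝ := 1 / (k + 1)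

theorem avgRadius_pos (k : ℕ) : 0 < avgRadius k := by
  unfold avgRadius
  positivity

theorem tendsto_avgRadius : Tendsto avgRadius atTop (𝓝[>] 0) :=
  tendsto_nhdsWithin_iff.2 ⟨tendsto_one_div_add_atTop_nhds_zero_nat,
    Eventually.of_forall avgRadius_pos⟩

/-- The normalized indicator function of a cube around `x`. -/
def smear {d : ℕ} (L : ℝ) (k : ℕ) (x : Point d) : FieldSpace d L :=
  ((2 * avgRadius k) ^ d)⁻¹ • indicatorConstLp 2
    (μ := (volume : Measure (Point d)).restrict (box d L))
    (measurableSet_closedBall (x := x) (ε := avgRadius k)) (measure_ne_top _ _) 1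

/-- The average of a function over a cube around `x`. -/
def cubeAverage {d : ℕ} (L : ℝ) (k : ℕ) (x : Point d) (F : Point d → ℝ) : ℝ :=
  ((2 * avgRadius k) ^ d)⁻¹ *
    ∫ y in Metric.closedBall x (avgRadius k), F y ∂(volume : Measure (Point d)).restrict (box d L)

theorem inner_smear {d : ℕ} {L : ℝ} (k : ℕ) (x : Point d) (φ : FieldSpace d L) :
    inner ℝ (smear L k x) φ = cubeAverage L k x φ := by
  rw [smear, real_inner_smul_left, L2.inner_indicatorConstLp_one, cubeAverage]

theorem integral_smear_mul {d : ℕ} {L : ℝ} (k : ℕ) (x : Point d) (F : Point d → ℝ) :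
    ∫ y in box d L, smear L k x y * F y = cubeAverage L k x F := by
  rw [cubeAverage, ← integral_const_mul,
    ← integral_indicator (measurableSet_closedBall (x := x) (ε := avgRadius k))]
  refine integral_congr_ae ?_
  have h1 := Lp.coeFn_smul ((2 * avgRadius k) ^ d)⁻¹ (indicatorConstLp 2
    (μ := (volume : Measure (Point d)).restrict (box d L))
    (measurableSet_closedBall (x := x) (ε := avgRadius k)) (measure_ne_top _ _) (1 : ℝ))
  have h2 := indicatorConstLp_coeFn (p := 2) (c := (1 : ℝ))
    (μ := (volume : Measure (Point d)).restrict (box d L))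
    (hs := measurableSet_closedBall (x := x) (ε := avgRadius k)) (hμs := measure_ne_top _ _)
  filter_upwards [h1, h2] with y h1 h2
  rw [smear, h1, Pi.smul_apply, h2]
  by_cases hy : y ∈ Metric.closedBall x (avgRadius k) <;> simp [hy]

theorem volume_real_cube {d : ℕ} (x : Point d) (k : ℕ) :
    volume.real (Metric.closedBall x (avgRadius k)) = (2 * avgRadius k) ^ d := by
  have := avgRadius_pos k
  rw [measureReal_def, Real.volume_pi_closedBall _ this.le, ENNReal.toReal_ofReal (by positivity),
    Fintype.card_fin]

theorem cubeAverage_eq_setAverage {d : ℕ} (L : ℝ) (k : ℕ) (x : Point d) (F : Point d → ℝ) :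
    cubeAverage L k x F = ⨍ y in Metric.closedBall x (avgRadius k), (box d L).indicator F y := by
  rw [cubeAverage, setAverage_eq, volume_real_cube, setIntegral_indicator (measurableSet_box d L),
    Measure.restrict_restrict measurableSet_closedBall, smul_eq_mul]

/-- The Lebesgue differentiation theorem for the field extended by zero outside the box. -/
theorem ae_tendsto_inner_smear {d : ℕ} {L : ℝ} (φ : FieldSpace d L) :
    ∀ᵐ x ∂(volume : Measure (Point d)).restrict (box d L),
      Tendsto (fun k => inner ℝ (smear L k x) φ) atTop (𝓝 (φ x)) := by
  have hint : Integrable ((box d L).indicator φ) :=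
    (integrable_indicator_iff (measurableSet_box d L)).2 (integrable_fieldSpace φ)
  have h := IsUnifLocDoublingMeasure.ae_tendsto_average volume hint.locallyIntegrable 1
  filter_upwards [ae_restrict_of_ae h, ae_mem_box d L] with x hx hbox
  have h2 := hx (fun _ : ℕ => x) avgRadius tendsto_avgRadius
    (Eventually.of_forall fun k => Metric.mem_closedBall_self (by
      have := avgRadius_pos k
      positivity))
  simp_rw [inner_smear, cubeAverage_eq_setAverage]
  rwa [Set.indicator_of_mem hbox] at h2

theorem measurable_inner_smear {d : ℕ} {L : ℝ} (k : ℕ) (φ : FieldSpace d L) :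
    Measurable fun x : Point d => inner ℝ (smear L k x) φ := by
  simp_rw [inner_smear, cubeAverage]
  refine Measurable.const_mul ?_ _
  have h : ∀ x : Point d, ∫ y in Metric.closedBall x (avgRadius k), φ y
      ∂(volume : Measure (Point d)).restrict (box d L) =
      ∫ y in box d L, {p : Point d × Point d | dist p.2 p.1 ≤ avgRadius k}.indicator
        (fun p => φ p.2) (x, y) := by
    intro x
    rw [← integral_indicator measurableSet_closedBall]
    rfl
  simp_rw [h]
  have hs : StronglyMeasurable ({p : Point d × Point d | dist p.2 p.1 ≤ avgRadius k}.indicator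
      (fun p => φ p.2)) := by
    refine StronglyMeasurable.indicator ((Lp.stronglyMeasurable φ).comp_measurable measurable_snd) ?_
    exact measurableSet_le (by fun_prop) measurable_const
  exact (hs.integral_prod_right').measurable

/-- The value of the field at a point, as a limit of averages. -/
def fieldValue {d : ℕ} {L : ℝ} (φ : FieldSpace d L) (x : Point d) : ℝ :=
  limsup (fun k => inner ℝ (smear L k x) φ) atTop

/-- Fields are classes of functions, so `φ x` carries no joint measurability. The cube averages are
continuous in `φ` and measurable in `x`, hence so is their upper limit jointly; this is what
Fubini's theorem needs. -/
theorem measurable_fieldValue {d : ℕ} {L : ℝ} :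
    Measurable fun p : FieldSpace d L × Point d => fieldValue p.1 p.2 := by
  refine Measurable.limsup fun k => ?_
  exact measurable_uncurry_of_continuous_of_measurable
    (u := fun (φ : FieldSpace d L) (x : Point d) => (inner ℝ (smear L k x) φ : ℝ))
    (fun x => by fun_prop) (fun φ => measurable_inner_smear k φ)

theorem ae_fieldValue_eq {d : ℕ} {L : ℝ} (φ : FieldSpace d L) :
    ∀ᵐ x ∂(volume : Measure (Point d)).restrict (box d L), fieldValue φ x = φ x := by
  filter_upwards [ae_tendsto_inner_smear φ] with x hx
  exact hx.limsup_eq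

theorem measurableSet_tendsto_fieldValue {d : ℕ} {L : ℝ} :
    MeasurableSet {p : FieldSpace d L × Point d |
      Tendsto (fun k => (inner ℝ (smear L k p.2) p.1 : ℝ)) atTop (𝓝 (fieldValue p.1 p.2))} := by
  refine measurableSet_tendsto_fun (fun k => ?_) measurable_fieldValue
  exact measurable_uncurry_of_continuous_of_measurable
    (u := fun (φ : FieldSpace d L) (x : Point d) => (inner ℝ (smear L k x) φ : ℝ))
    (fun x => by fun_prop) (fun φ => measurable_inner_smear k φ)

/-- Almost everywhere in the box, the averages converge almost surely. -/
theorem ae_ae_tendsto_fieldValue {d : ℕ} {L : ℝ} (ν : Measure (FieldSpace d L)) [SFinite ν] :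
    ∀ᵐ x ∂(volume : Measure (Point d)).restrict (box d L), ∀ᵐ φ ∂ν,
      Tendsto (fun k => (inner ℝ (smear L k x) φ : ℝ)) atTop (𝓝 (fieldValue φ x)) := by
  refine Measure.ae_ae_comm (p := fun φ x => Tendsto (fun k => (inner ℝ (smear L k x) φ : ℝ)) atTop
    (𝓝 (fieldValue φ x))) ?_ |>.1 (Eventually.of_forall fun φ => ?_)
  · exact measurableSet_tendsto_fieldValue
  · filter_upwards [ae_tendsto_inner_smear φ] with x hx
    rwa [fieldValue, hx.limsup_eq]

/-- The open box. -/
def openBox (d : ℕ) (L : ℝ) : Set (Point d) :=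
  Set.univ.pi fun _ => Set.Ioo (-(L / 2)) (L / 2)

theorem openBox_subset_box (d : ℕ) (L : ℝ) : openBox d L ⊆ box d L :=
  Set.pi_mono fun _ _ => Set.Ioo_subset_Ico_self

theorem ae_mem_openBox (d : ℕ) (L : ℝ) :
    ∀ᵐ x ∂(volume : Measure (Point d)).restrict (box d L), x ∈ openBox d L := by
  have h1 : box d L =ᵐ[volume] openBox d L :=
    (Measure.univ_pi_Ico_ae_eq_Icc (μ := fun _ : Fin d => (volume : Measure ℝ))).trans
      (Measure.univ_pi_Ioo_ae_eq_Icc (μ := fun _ : Fin d => (volume : Measure ℝ))).symm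
  rw [Measure.restrict_congr_set h1]
  exact ae_restrict_mem (MeasurableSet.univ_pi fun _ => measurableSet_Ioo)

theorem eventually_cube_subset {d : ℕ} {L : ℝ} {x : Point d} (hx : x ∈ openBox d L) {ε : ℝ}
    (hε : 0 < ε) : ∀ᶠ k in atTop, Metric.closedBall x (avgRadius k) ⊆ box d L ∧ avgRadius k ≤ ε := by
  have ho : IsOpen (openBox d L) := isOpen_set_pi Set.finite_univ fun _ _ => isOpen_Ioo
  obtain ⟨δ, hδ, hsub⟩ := Metric.isOpen_iff.1 ho x hx
  have h := (tendsto_nhdsWithin_iff.1 tendsto_avgRadius).1.eventually (gt_mem_nhds (lt_min hδ hε))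
  filter_upwards [h] with k hk
  exact ⟨(Metric.closedBall_subset_ball (hk.trans_le (min_le_left _ _))).trans
    (hsub.trans (openBox_subset_box d L)), (hk.trans_le (min_le_right _ _)).le⟩

theorem abs_cubeAverage_sub_le {d : ℕ} {L : ℝ} {k : ℕ} {x : Point d}
    (hb : Metric.closedBall x (avgRadius k) ⊆ box d L) {F : Point d → ℝ}
    (hF : Continuous F) {w ε : ℝ}
    (h : ∀ y ∈ Metric.closedBall x (avgRadius k), |F y - w| ≤ ε) :
    |cubeAverage L k x F - w| ≤ ε := by
  have hv := volume_real_cube x k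
  have hpos : 0 < (2 * avgRadius k) ^ d := by
    have := avgRadius_pos k
    positivity
  rw [← hv, measureReal_def, ENNReal.toReal_pos_iff] at hpos
  have heq : cubeAverage L k x F = ⨍ y in Metric.closedBall x (avgRadius k), F y := by
    rw [cubeAverage, setAverage_eq, hv, Measure.restrict_restrict measurableSet_closedBall,
      Set.inter_eq_self_of_subset_left hb, smul_eq_mul]
  have h2 := Convex.set_average_mem (μ := volume) (s := Metric.closedBall w ε)
    (t := Metric.closedBall x (avgRadius k)) (f := F) (convex_closedBall w ε)
    Metric.isClosed_closedBall hpos.1.ne' hpos.2.ne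
    ((ae_restrict_mem measurableSet_closedBall).mono fun y hy => by
      rw [Metric.mem_closedBall, Real.dist_eq]; exact h y hy)
    (hF.continuousOn.integrableOn_compact (isCompact_closedBall _ _))
  rw [heq]
  simpa [Real.dist_eq] using h2

theorem tendsto_covForm_smear_left {d : ℕ} {L : ℝ} {G : Point d → ℝ} (hG : Continuous G)
    {x : Point d} (hx : x ∈ openBox d L) (j : FieldSpace d L) :
    Tendsto (fun k => covForm G (smear L k x) j) atTop (𝓝 (classicalField G j x)) := by
  have hc := continuous_classicalField hG j
  refine Metric.tendsto_nhds.2 fun ε hε => ?_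
  obtain ⟨δ, hδ, hδ'⟩ := Metric.continuous_iff.1 hc x (ε / 2) (by positivity)
  filter_upwards [eventually_cube_subset hx (half_pos hδ)] with k hk
  rw [covForm, integral_smear_mul, Real.dist_eq]
  refine lt_of_le_of_lt (abs_cubeAverage_sub_le hk.1 hc (ε := ε / 2) fun y hy => ?_)
    (half_lt_self hε)
  have := hδ' y ((Metric.mem_closedBall.1 hy).trans_lt (hk.2.trans_lt (half_lt_self hδ)))
  rw [Real.dist_eq] at this
  exact this.le

theorem classicalField_smear {d : ℕ} {L : ℝ} (G : Point d → ℝ) (k : ℕ) (x u : Point d) :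
    classicalField G (smear L k x) u = cubeAverage L k x fun v => G (u - v) := by
  rw [classicalField, ← integral_smear_mul]
  simp_rw [mul_comm]

/-- Small cubes around inner points lie inside the box, so the `smear` functions are true averages
there, and continuity of `G` gives the limit. -/
theorem tendsto_covForm_smear {d : ℕ} {L : ℝ} {G : Point d → ℝ} (hG : Continuous G)
    {x y : Point d} (hx : x ∈ openBox d L) (hy : y ∈ openBox d L) :
    Tendsto (fun k => covForm G (smear L k x) (smear L k y)) atTop (𝓝 (G (x - y))) := by
  refine Metric.tendsto_nhds.2 fun ε hε => ?_
  obtain ⟨δ, hδ, hδ'⟩ := Metric.continuous_iff.1 hG (x - y) (ε / 2) (by positivity)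
  filter_upwards [eventually_cube_subset hx (ε := δ / 3) (by positivity),
    eventually_cube_subset hy (ε := δ / 3) (by positivity)] with k hk hk'
  rw [covForm, integral_smear_mul, Real.dist_eq]
  refine lt_of_le_of_lt (abs_cubeAverage_sub_le hk.1 (continuous_classicalField hG _)
    (ε := ε / 2) fun u hu => ?_) (half_lt_self hε)
  rw [classicalField_smear]
  refine abs_cubeAverage_sub_le hk'.1 (by fun_prop) fun v hv => ?_
  have h1 := Metric.mem_closedBall.1 hu
  have h2 := Metric.mem_closedBall.1 hv
  have h3 : dist (u - v) (x - y) < δ := by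
    have := dist_sub_sub_le u v x y
    linarith [hk.2, hk'.2]
  have := hδ' _ h3
  rw [Real.dist_eq] at this
  exact this.le

end LegendreQFT

end

noncomputable section

namespace LegendreQFT

/-! ### Finite-dimensional distributions of independent copies of the field -/

open Filter Topology Complex

theorem dotProduct_blockMatrix_mulVec {d n N : ℕ} (G : Point d → ℝ) (x : Fin n → Point d)
    (c : Fin n → Fin N) (t : Fin n → ℝ) : t ⬝ᵥ blockMatrix G x c *ᵥ t =
      ∑ l, ∑ a, ∑ b, (if c a = l then t a else 0) * (if c b = l then t b else 0) *
        G (x a - x b) := by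
  rw [Finset.sum_comm]
  simp only [dotProduct, mulVec, Finset.mul_sum, blockMatrix, of_apply]
  refine Finset.sum_congr rfl fun a _ => ?_
  rw [Finset.sum_comm]
  refine Finset.sum_congr rfl fun b _ => ?_
  rw [Finset.sum_eq_single_of_mem (c a) (Finset.mem_univ _)]
  · by_cases h : c b = c a
    · simp [h]; ring
    · simp [h, Ne.symm h]
  · intro l _ hl
    simp [Ne.symm hl]

theorem blockMatrix_isSymm {d n N : ℕ} {G : Point d → ℝ} (he : ∀ x, G (-x) = G x)
    (x : Fin n → Point d) (c : Fin n → Fin N) : (blockMatrix G x c).IsSymm := by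
  ext a b
  simp only [blockMatrix, transpose_apply, of_apply]
  rw [show x b - x a = -(x a - x b) by abel, he]
  simp only [eq_comm]

/-- The quadratic form is a sum over colours of the form of `G` on the parts of `t` of one colour.
Each summand is nonnegative, and the one for the colour of a nonzero entry is positive. -/
theorem posDef_blockMatrix {d n N : ℕ} {L : ℝ} {G : Point d → ℝ} (hG : IsPropagator L G)
    {x : Fin n → Point d} (hx : x ∈ configs d n L) (hinj : Function.Injective x)
    (c : Fin n → Fin N) : (blockMatrix G x c).PosDef := by
  have hpd := hG.posDef n x hx hinj
  refine PosDef.of_dotProduct_mulVec_pos ?_ fun t ht => ?_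
  · rw [IsHermitian, conjTranspose_eq_transpose_of_trivial]
    exact blockMatrix_isSymm hG.even x c
  · rw [star_trivial, dotProduct_blockMatrix_mulVec]
    have hq : ∀ u : Fin n → ℝ, u ⬝ᵥ (of fun a b => G (x a - x b)) *ᵥ u =
        ∑ a, ∑ b, u a * u b * G (x a - x b) := by
      intro u
      simp only [dotProduct, mulVec, Finset.mul_sum, of_apply]
      exact Finset.sum_congr rfl fun a _ => Finset.sum_congr rfl fun b _ => by ring
    simp_rw [← hq fun a => if c a = _ then t a else 0]
    obtain ⟨a, ha⟩ := Function.ne_iff.1 ht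
    refine Finset.sum_pos' (fun l _ => ?_) ⟨c a, Finset.mem_univ _, ?_⟩
    · simpa using hpd.posSemidef.dotProduct_mulVec_nonneg fun a => if c a = l then t a else 0
    · have h : (fun b => if c b = c a then t b else 0) ≠ 0 := fun h => ha (by
        simpa using congrFun h a)
      simpa using hpd.dotProduct_mulVec_pos h

theorem blockMatrix_diag {d n N : ℕ} (G : Point d → ℝ) (x : Fin n → Point d)
    (c : Fin n → Fin N) (a : Fin n) : blockMatrix G x c a a = G 0 := by simp [blockMatrix]

/-- Test functions whose pairings approximate a linear combination of field values. -/
def smearSum {d n N : ℕ} (L : ℝ) (k : ℕ) (x : Fin n → Point d) (c : Fin n → Fin N)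
    (t : Fin n → ℝ) (l : Fin N) : FieldSpace d L :=
  ∑ a, (if c a = l then t a else 0) • smear L k (x a)

theorem tendsto_sum_covForm_smearSum_left {d n N : ℕ} {L : ℝ} {G : Point d → ℝ}
    (hG : Continuous G) {x : Fin n → Point d} (hx : ∀ a, x a ∈ openBox d L) (c : Fin n → Fin N)
    (t : Fin n → ℝ) (j : FieldSpace d L) :
    Tendsto (fun k => ∑ l, covForm G (smearSum L k x c t l) j) atTop
      (𝓝 (t ⬝ᵥ fun a => classicalField G j (x a))) := by
  have h : ∀ k, ∑ l, covForm G (smearSum L k x c t l) j =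
      ∑ a, t a * covForm G (smear L k (x a)) j := by
    intro k
    simp_rw [smearSum, covForm_sum_left hG, covForm_smul_left]
    rw [Finset.sum_comm]
    refine Finset.sum_congr rfl fun a _ => ?_
    rw [← Finset.sum_mul]
    simp
  simp_rw [h]
  exact tendsto_finsetSum _ fun a _ => (tendsto_covForm_smear_left hG (hx a) j).const_mul _

theorem tendsto_sum_covForm_smearSum {d n N : ℕ} {L : ℝ} {G : Point d → ℝ}
    (hG : Continuous G) {x : Fin n → Point d} (hx : ∀ a, x a ∈ openBox d L) (c : Fin n → Fin N)
    (t : Fin n → ℝ) :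
    Tendsto (fun k => ∑ l, covForm G (smearSum L k x c t l) (smearSum L k x c t l)) atTop
      (𝓝 (t ⬝ᵥ blockMatrix G x c *ᵥ t)) := by
  rw [dotProduct_blockMatrix_mulVec]
  have h : ∀ k l, covForm G (smearSum L k x c t l) (smearSum L k x c t l) =
      ∑ a, ∑ b, (if c a = l then t a else 0) * (if c b = l then t b else 0) *
        covForm G (smear L k (x a)) (smear L k (x b)) := by
    intro k l
    simp_rw [smearSum, covForm_sum_left hG, covForm_sum_right hG, covForm_smul_left,
      covForm_smul_right, ← mul_assoc]
  simp_rw [h]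
  exact tendsto_finsetSum _ fun l _ => tendsto_finsetSum _ fun a _ => tendsto_finsetSum _
    fun b _ => (tendsto_covForm_smear hG (hx a) (hx b)).const_mul _

variable {d n N : ℕ} {L : ℝ} {G : Point d → ℝ} {μ : Measure (FieldSpace d L)}
  [IsProbabilityMeasure μ]

/-- Positivity of the joint covariance of the source and the field values. -/
theorem quad_classicalField_le (hG : IsPropagator L G) (hμ : IsGaussianField G μ)
    (j : FieldSpace d L) {x : Fin n → Point d} (hx : ∀ a, x a ∈ openBox d L)
    (hinj : Function.Injective x) (c : Fin n → Fin N) :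
    quad (blockMatrix G x c) (fun a => classicalField G j (x a)) ≤ N * covForm G j j / 2 := by
  set A := blockMatrix G x c
  set m := fun a => classicalField G j (x a)
  have hA : A.PosDef := posDef_blockMatrix hG (fun a _ => openBox_subset_box d L (hx a)) hinj c
  -- The covariance form is nonnegative at `j` plus the smeared combination of each colour;
  -- summation over the `N` colours and the limit of small cubes give the inequality.
  have key : ∀ t : Fin n → ℝ, 0 ≤ N * covForm G j j + 2 * (t ⬝ᵥ m) + t ⬝ᵥ A *ᵥ t := by
    intro t
    have h1 := tendsto_sum_covForm_smearSum_left hG.continuous hx c t j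
    have h2 := tendsto_sum_covForm_smearSum hG.continuous hx c t
    refine ge_of_tendsto' ((tendsto_const_nhds (x := N * covForm G j j)).add
      (h1.const_mul 2) |>.add h2) fun k => ?_
    have h3 : ∑ l : Fin N, covForm G (j + smearSum L k x c t l) (j + smearSum L k x c t l) =
        N * covForm G j j + 2 * ∑ l, covForm G (smearSum L k x c t l) j +
          ∑ l, covForm G (smearSum L k x c t l) (smearSum L k x c t l) := by
      have h4 : N * covForm G j j = ∑ _l : Fin N, covForm G j j := by simp
      rw [Finset.mul_sum, h4, ← Finset.sum_add_distrib, ← Finset.sum_add_distrib]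
      refine Finset.sum_congr rfl fun l _ => ?_
      rw [covForm_add_left hG.continuous, covForm_add_right hG.continuous,
        covForm_add_right hG.continuous, covForm_comm hG.continuous hG.even j (smearSum L k x c t l)]
      ring
    rw [← h3]
    exact Finset.sum_nonneg fun l _ => covForm_self_nonneg hμ _
  -- This vector minimizes the right side; the minimum is `N * covForm G j j - 2 Q(m)`.
  have h := key (-(A⁻¹ *ᵥ m))
  have hu : IsUnit A.det := hA.det_pos.ne'.isUnit
  have h1 : A *ᵥ (-(A⁻¹ *ᵥ m)) = -m := by
    rw [mulVec_neg, mulVec_mulVec, mul_nonsing_inv _ hu, one_mulVec]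
  rw [h1, neg_dotProduct, neg_dotProduct_neg, dotProduct_comm] at h
  rw [quad_eq_dotProduct]
  linarith

/-- The values of independent copies of the field. -/
def copyValues (c : Fin n → Fin N) (x : Fin n → Point d) (ω : Fin N → FieldSpace d L) :
    Fin n → ℝ := fun a => fieldValue (ω (c a)) (x a)

theorem measurable_copyValues_left (c : Fin n → Fin N) (x : Fin n → Point d) :
    Measurable (copyValues (L := L) c x) := by
  refine measurable_pi_lambda _ fun a => ?_
  exact measurable_fieldValue.comp (f := fun ω : Fin N → FieldSpace d L => (ω (c a), x a))
    (by fun_prop)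

/-- Grouping the pairings by copy turns the exponential into a product over independent copies, each
contributing its characteristic functional. -/
theorem integral_cexp_smear (hG : IsPropagator L G) (hμ : IsGaussianField G μ)
    (j : FieldSpace d L) (x : Fin n → Point d) (c : Fin n → Fin N) (t : Fin n → ℝ) (k : ℕ) :
    ∫ ω : Fin N → FieldSpace d L,
      cexp ((∑ a, t a * inner ℝ (smear L k (x a)) (ω (c a)) : ℝ) * I)
      ∂Measure.pi (fun _ => sourceMeasure μ j) =
    cexp (-(∑ l, covForm G (smearSum L k x c t l) j : ℝ) * I -
      (1 / 2 * ∑ l, covForm G (smearSum L k x c t l) (smearSum L k x c t l) : ℝ)) := by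
  have := isProbabilityMeasure_sourceMeasure hμ j
  have e : ∀ ω : Fin N → FieldSpace d L,
      cexp ((∑ a, t a * inner ℝ (smear L k (x a)) (ω (c a)) : ℝ) * I) =
      ∏ l, cexp ((inner ℝ (ω l) (smearSum L k x c t l) : ℝ) * I) := by
    intro ω
    rw [← Complex.exp_sum, ← Finset.sum_mul, ← Complex.ofReal_sum]
    congr 3
    simp_rw [smearSum, inner_sum, inner_smul_right]
    rw [Finset.sum_comm]
    refine Finset.sum_congr rfl fun a _ => ?_
    rw [Finset.sum_eq_single_of_mem (c a) (Finset.mem_univ _)]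
    · rw [if_pos rfl, real_inner_comm]
    · intro l _ hl
      rw [if_neg (Ne.symm hl), zero_mul]
  simp_rw [e]
  rw [integral_fintype_prod_eq_prod (fun l φ => cexp ((inner ℝ φ (smearSum L k x c t l) : ℝ) * I))]
  simp_rw [← charFun_apply, charFun_sourceMeasure hG.continuous hG.even hμ]
  rw [← Complex.exp_sum]
  congr 1
  push_cast
  rw [Finset.sum_sub_distrib, ← Finset.sum_mul, Finset.sum_neg_distrib, Finset.mul_sum]

theorem tendsto_integral_cexp_smear (hμ : IsGaussianField G μ)
    (j : FieldSpace d L) {x : Fin n → Point d} (c : Fin n → Fin N)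
    (hlim : ∀ a, ∀ᵐ φ ∂sourceMeasure μ j,
      Tendsto (fun k => (inner ℝ (smear L k (x a)) φ : ℝ)) atTop (𝓝 (fieldValue φ (x a))))
    (t : Fin n → ℝ) :
    Tendsto (fun k => ∫ ω : Fin N → FieldSpace d L,
      cexp ((∑ a, t a * inner ℝ (smear L k (x a)) (ω (c a)) : ℝ) * I)
      ∂Measure.pi (fun _ => sourceMeasure μ j)) atTop
      (𝓝 (∫ ω, cexp ((t ⬝ᵥ copyValues c x ω : ℝ) * I)
        ∂Measure.pi (fun _ => sourceMeasure μ j))) := by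
  have := isProbabilityMeasure_sourceMeasure hμ j
  have hl : ∀ᵐ ω ∂Measure.pi (fun _ : Fin N => sourceMeasure μ j), ∀ a,
      Tendsto (fun k => (inner ℝ (smear L k (x a)) (ω (c a)) : ℝ)) atTop
        (𝓝 (fieldValue (ω (c a)) (x a))) := by
    rw [ae_all_iff]
    exact fun a => (Measure.quasiMeasurePreserving_eval
      (fun _ : Fin N => sourceMeasure μ j) (c a)).ae (hlim a)
  refine tendsto_integral_of_dominated_convergence (fun _ => 1) (fun k => ?_)
    (integrable_const _) (fun k => Eventually.of_forall fun ω => ?_) ?_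
  · refine Continuous.aestronglyMeasurable ?_
    refine Complex.continuous_exp.comp ((Complex.continuous_ofReal.comp ?_).mul continuous_const)
    exact continuous_finsetSum _ fun a _ => continuous_const.mul
      ((continuous_const).inner (continuous_apply (c a)))
  · rw [Complex.norm_exp_ofReal_mul_I]
  · filter_upwards [hl] with ω hω
    have h2 : Tendsto (fun k => ∑ a, t a * (inner ℝ (smear L k (x a)) (ω (c a)) : ℝ)) atTop
        (𝓝 (t ⬝ᵥ copyValues c x ω)) :=
      tendsto_finsetSum _ fun a _ => (hω a).const_mul _
    exact (Complex.continuous_exp.tendsto _).comp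
      (((Complex.continuous_ofReal.tendsto _).comp h2).mul_const I)

/-- The values of independent copies of the field have a Gaussian law. -/
theorem map_copyValues (hG : IsPropagator L G) (hμ : IsGaussianField G μ)
    (j : FieldSpace d L) {x : Fin n → Point d} (hx : ∀ a, x a ∈ openBox d L)
    (hinj : Function.Injective x) (c : Fin n → Fin N)
    (hlim : ∀ a, ∀ᵐ φ ∂sourceMeasure μ j,
      Tendsto (fun k => (inner ℝ (smear L k (x a)) φ : ℝ)) atTop (𝓝 (fieldValue φ (x a)))) :
    (Measure.pi fun _ : Fin N => sourceMeasure μ j).map (copyValues c x) =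
      gaussLaw (blockMatrix G x c) (-fun a => classicalField G j (x a)) := by
  have := isProbabilityMeasure_sourceMeasure hμ j
  have hA := posDef_blockMatrix hG (fun a _ => openBox_subset_box d L (hx a)) hinj c
  have := isProbabilityMeasure_gaussLaw hA (-fun a => classicalField G j (x a))
  have hm : Measurable (copyValues (L := L) c x) :=
    measurable_copyValues_left c x
  have := Measure.isProbabilityMeasure_map
    (μ := Measure.pi fun _ : Fin N => sourceMeasure μ j) hm.aemeasurable
  refine measure_ext_of_dotProduct fun t => ?_
  have hc : Continuous fun φ : Fin n → ℝ => cexp ((t ⬝ᵥ φ : ℝ) * I) := by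
    unfold dotProduct
    fun_prop
  rw [gaussLaw_charFun hA, integral_map hm.aemeasurable hc.aestronglyMeasurable]
  -- The characteristic function of the averages converges both to that of the field values, by
  -- dominated convergence, and to the Gaussian one, by convergence of the covariances. The mean is
  -- `-φ̄` because the source enters as `exp (-j φ)`.
  refine tendsto_nhds_unique (tendsto_integral_cexp_smear hμ j c hlim t) ?_
  simp_rw [integral_cexp_smear hG hμ]
  refine (Complex.continuous_exp.tendsto _).comp (Tendsto.sub ?_ ?_)
  · rw [dotProduct_neg, Complex.ofReal_neg]
    exact ((Complex.continuous_ofReal.tendsto _).comp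
      (tendsto_sum_covForm_smearSum_left hG.continuous hx c t j)).neg.mul_const I
  · refine (Complex.continuous_ofReal.tendsto _).comp ?_
    rw [show t ⬝ᵥ blockMatrix G x c *ᵥ t / 2 = 1 / 2 * (t ⬝ᵥ blockMatrix G x c *ᵥ t) by ring]
    exact (tendsto_sum_covForm_smearSum hG.continuous hx c t).const_mul _

/-- Almost all configurations consist of distinct inner points at which the field has values. -/
theorem ae_injective_configs (hd : 0 < d) (n : ℕ) (L : ℝ) :
    ∀ᵐ x ∂(volume : Measure (Fin n → Point d)).restrict (configs d n L), Function.Injective x := by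
  refine ae_restrict_of_ae ?_
  have h : ∀ a b : Fin n, a ≠ b → ∀ᵐ x : Fin n → Point d, x a ≠ x b := by
    intro a b hab
    -- The coincidence set of two points is a linear subspace, proper because `0 < d`, hence null.
    set V : Submodule ℝ (Fin n → Point d) := LinearMap.ker
      (LinearMap.proj (R := ℝ) (φ := fun _ : Fin n => Point d) a - LinearMap.proj b)
    have hV : V ≠ ⊤ := by
      intro h
      have h1 : (Pi.single a (fun _ => (1 : ℝ)) : Fin n → Point d) ∈ V := by
        rw [h]; exact Submodule.mem_top
      rw [LinearMap.mem_ker, LinearMap.sub_apply, LinearMap.proj_apply, LinearMap.proj_apply,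
        Pi.single_eq_same, Pi.single_eq_of_ne hab.symm, sub_zero] at h1
      exact one_ne_zero (congrFun h1 ⟨0, hd⟩)
    have h0 := Measure.addHaar_submodule volume V hV
    rw [ae_iff]
    refine measure_mono_null (fun x hx => ?_) h0
    simp only [Set.mem_ofPred_eq, not_not] at hx
    simp [V, hx]
  have h2 : ∀ᵐ x : Fin n → Point d, ∀ a b, a ≠ b → x a ≠ x b := by
    simp only [ae_all_iff]
    exact h
  filter_upwards [h2] with x hx a b hab
  by_contra hne
  exact hx a b hne hab

theorem volume_restrict_configs (d n : ℕ) (L : ℝ) :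
    (volume : Measure (Fin n → Point d)).restrict (configs d n L) =
      Measure.pi fun _ => (volume : Measure (Point d)).restrict (box d L) :=
  Measure.restrict_pi_pi (fun _ : Fin n => (volume : Measure (Point d))) fun _ => box d L

theorem ae_configs_of_ae_box {p : Point d → Prop}
    (h : ∀ᵐ x ∂(volume : Measure (Point d)).restrict (box d L), p x) (n : ℕ) :
    ∀ᵐ x ∂(volume : Measure (Fin n → Point d)).restrict (configs d n L), ∀ a, p (x a) := by
  rw [volume_restrict_configs, ae_all_iff]
  exact fun a => (Measure.quasiMeasurePreserving_eval
    (fun _ : Fin n => (volume : Measure (Point d)).restrict (box d L)) a).ae h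

end LegendreQFT

end

noncomputable section

namespace LegendreQFT

/-! ### Moments of the interaction -/

open Filter Topology ProbabilityTheory

/-- The interaction `∫ g |φ|^α`. -/
def interaction {d : ℕ} {L : ℝ} (g : Point d → ℝ) (α : ℝ) (φ : FieldSpace d L) : ℝ :=
  ∫ x in box d L, g x * |φ x| ^ α

/-- The role of `α ≤ 2` on the field side: the interaction is bounded by a multiple of the volume
plus `‖φ‖²`, which the Gaussian exponential moments control. -/
theorem abs_rpow_le_one_add_sq {α : ℝ} (h1 : 0 ≤ α) (h2 : α ≤ 2) (u : ℝ) :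
    |u| ^ α ≤ 1 + u ^ 2 := by
  rcases le_total |u| 1 with h | h
  · have := Real.rpow_le_one (abs_nonneg u) h h1
    linarith [sq_nonneg u]
  · have := Real.rpow_le_rpow_of_exponent_le h h2
    rw [Real.rpow_two, sq_abs] at this
    linarith

section

variable {d : ℕ} {L : ℝ} {α : ℝ} {g : Point d → ℝ} {M : ℝ}

theorem integrable_interaction (h1 : 0 ≤ α) (h2 : α ≤ 2) (hg : Measurable g)
    (hM : ∀ x, |g x| ≤ M) (φ : FieldSpace d L) : Integrable (fun x => g x * |φ x| ^ α)
      ((volume : Measure (Point d)).restrict (box d L)) := by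
  have hφ : Integrable (fun x => 1 + φ x ^ 2)
      ((volume : Measure (Point d)).restrict (box d L)) :=
    (integrable_const 1).add (Lp.memLp φ).integrable_sq
  have hm : Measurable fun x => |φ x| ^ α :=
    (measurable_id.abs.pow_const α).comp (Lp.stronglyMeasurable φ).measurable
  refine (hφ.mono' hm.aestronglyMeasurable (Eventually.of_forall fun x => ?_)).bdd_mul
    (c := M) hg.aestronglyMeasurable (Eventually.of_forall hM)
  rw [Real.norm_eq_abs, abs_of_nonneg (Real.rpow_nonneg (abs_nonneg _) _)]
  exact abs_rpow_le_one_add_sq h1 h2 _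

theorem integral_abs_interaction_le (h1 : 0 ≤ α) (h2 : α ≤ 2) (hg : Measurable g)
    (hM : ∀ x, |g x| ≤ M) (φ : FieldSpace d L) : ∫ x in box d L, |g x * |φ x| ^ α| ≤
      M * (volume.real (box d L) + ‖φ‖ ^ 2) := by
  have hφ2 : Integrable (fun x => φ x ^ 2)
      ((volume : Measure (Point d)).restrict (box d L)) := (Lp.memLp φ).integrable_sq
  have hφ : Integrable (fun x => 1 + φ x ^ 2)
      ((volume : Measure (Point d)).restrict (box d L)) := (integrable_const 1).add hφ2
  calc ∫ x in box d L, |g x * |φ x| ^ α| ≤ ∫ x in box d L, M * (1 + φ x ^ 2) := by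
        refine integral_mono (integrable_interaction h1 h2 hg hM φ).abs (hφ.const_mul M) fun x => ?_
        simp only
        rw [abs_mul, abs_of_nonneg (Real.rpow_nonneg (abs_nonneg _) _)]
        exact mul_le_mul (hM x) (abs_rpow_le_one_add_sq h1 h2 _)
          (Real.rpow_nonneg (abs_nonneg _) _) ((abs_nonneg _).trans (hM x))
    _ = _ := by
        rw [integral_const_mul, integral_add (integrable_const 1) hφ2, ← real_inner_self_eq_norm_sq,
          inner_fieldSpace]
        simp [sq]

theorem abs_interaction_le (h1 : 0 ≤ α) (h2 : α ≤ 2) (hg : Measurable g)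
    (hM : ∀ x, |g x| ≤ M) (φ : FieldSpace d L) :
    |interaction g α φ| ≤ M * (volume.real (box d L) + ‖φ‖ ^ 2) :=
  (abs_integral_le_integral_abs).trans (integral_abs_interaction_le h1 h2 hg hM φ)

theorem interaction_eq_fieldValue (g : Point d → ℝ) (α : ℝ) (φ : FieldSpace d L) :
    interaction g α φ = ∫ x in box d L, g x * |fieldValue φ x| ^ α := by
  refine integral_congr_ae ?_
  filter_upwards [ae_fieldValue_eq φ] with x hx
  rw [hx]

theorem measurable_fieldValue_rpow (hg : Measurable g) (α : ℝ) :
    Measurable fun p : FieldSpace d L × Point d => g p.2 * |fieldValue p.1 p.2| ^ α :=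
  (hg.comp measurable_snd).mul (measurable_fieldValue.abs.pow_const α)

theorem measurable_interaction (hg : Measurable g) (α : ℝ) :
    Measurable (interaction (L := L) g α) := by
  have h : interaction (L := L) g α = fun φ => ∫ x in box d L,
      (fun p : FieldSpace d L × Point d => g p.2 * |fieldValue p.1 p.2| ^ α) (φ, x) :=
    funext fun φ => interaction_eq_fieldValue g α φ
  rw [h]
  exact ((measurable_fieldValue_rpow hg α).stronglyMeasurable.integral_prod_right').measurable

variable {G : Point d → ℝ} {μ : Measure (FieldSpace d L)} [IsProbabilityMeasure μ]

theorem integrable_pow_norm_sq (hμ : IsGaussianField G μ) (j : FieldSpace d L) {M v : ℝ}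
    (hM : 0 ≤ M) (hv : 0 ≤ v) (k : ℕ) :
    Integrable (fun φ => (M * (v + ‖φ‖ ^ 2)) ^ k) (sourceMeasure μ j) := by
  obtain ⟨ε, hε, h⟩ := exists_integrable_exp_sourceMeasure hμ j
  refine (h.const_mul (M ^ k * (k.factorial / ε ^ k * Real.exp (ε * v)))).mono'
    (Continuous.aestronglyMeasurable (by fun_prop)) (Eventually.of_forall fun φ => ?_)
  rw [Real.norm_eq_abs, abs_of_nonneg (by positivity), mul_pow, mul_assoc]
  refine mul_le_mul_of_nonneg_left ?_ (by positivity)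
  have h2 := Real.pow_div_factorial_le_exp (ε * (v + ‖φ‖ ^ 2)) (by positivity) k
  rw [mul_pow, div_le_iff₀ (by positivity), mul_add ε, Real.exp_add] at h2
  calc (v + ‖φ‖ ^ 2) ^ k = (ε ^ k * (v + ‖φ‖ ^ 2) ^ k) / ε ^ k := by field_simp
    _ ≤ (Real.exp (ε * v) * Real.exp (ε * ‖φ‖ ^ 2) * k.factorial) / ε ^ k := by gcongr
    _ = _ := by ring

/-- Collecting the factors by colour gives a product of functions of the single independent copies.
-/
theorem integrable_prod_norm_sq (hμ : IsGaussianField G μ) (j : FieldSpace d L) {M v : ℝ}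
    (hM : 0 ≤ M) (hv : 0 ≤ v) {n N : ℕ} (c : Fin n → Fin N) :
    Integrable (fun ω : Fin N → FieldSpace d L => ∏ a, (M * (v + ‖ω (c a)‖ ^ 2)))
      (Measure.pi fun _ => sourceMeasure μ j) := by
  have := isProbabilityMeasure_sourceMeasure hμ j
  have h : ∀ ω : Fin N → FieldSpace d L, ∏ a, (M * (v + ‖ω (c a)‖ ^ 2)) =
      ∏ l, (M * (v + ‖ω l‖ ^ 2)) ^ (Finset.univ.filter fun a => c a = l).card := by
    intro ω
    rw [← Finset.prod_fiberwise' Finset.univ c fun l => M * (v + ‖ω l‖ ^ 2)]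
    exact Finset.prod_congr rfl fun l _ => by rw [Finset.prod_const]
  simp_rw [h]
  exact Integrable.fintype_prod (f := fun l φ => (M * (v + ‖φ‖ ^ 2)) ^ (Finset.univ.filter
    fun a => c a = l).card) fun l => integrable_pow_norm_sq hμ j hM hv _

theorem measurable_prod_copyValues (hg : Measurable g) (α : ℝ) {n N : ℕ} (c : Fin n → Fin N) :
    Measurable fun p : (Fin N → FieldSpace d L) × (Fin n → Point d) =>
      ∏ a, (g (p.2 a) * |copyValues c p.2 p.1 a| ^ α) := by
  refine Finset.measurable_fun_prod _ fun a _ => ?_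
  exact (measurable_fieldValue_rpow hg α).comp
    (f := fun p : (Fin N → FieldSpace d L) × (Fin n → Point d) => (p.1 (c a), p.2 a)) (by fun_prop)

/-- For fixed fields the integral over configurations factorizes into one-point integrals, each
bounded by the volume plus the squared norm; these bounds have integrable products. -/
theorem integrable_prod_copyValues (h1 : 0 ≤ α) (h2 : α ≤ 2) (hg : Measurable g)
    (hM : ∀ x, |g x| ≤ M) (hμ : IsGaussianField G μ) (j : FieldSpace d L) {n N : ℕ}
    (c : Fin n → Fin N) :
    Integrable (fun p : (Fin N → FieldSpace d L) × (Fin n → Point d) =>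
      ∏ a, (g (p.2 a) * |copyValues c p.2 p.1 a| ^ α))
      ((Measure.pi fun _ => sourceMeasure μ j).prod (Measure.pi fun _ : Fin n =>
        (volume : Measure (Point d)).restrict (box d L))) := by
  have := isProbabilityMeasure_sourceMeasure hμ j
  have hM0 : 0 ≤ M := (abs_nonneg _).trans (hM 0)
  have hm := measurable_prod_copyValues (L := L) hg α c
  have hi : ∀ φ : FieldSpace d L, Integrable (fun x => g x * |fieldValue φ x| ^ α)
      ((volume : Measure (Point d)).restrict (box d L)) := fun φ => by
    refine (integrable_interaction h1 h2 hg hM φ).congr ?_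
    filter_upwards [ae_fieldValue_eq φ] with x hx
    rw [hx]
  have hb : ∀ φ : FieldSpace d L, ∫ x in box d L, |g x * |fieldValue φ x| ^ α| ≤
      M * (volume.real (box d L) + ‖φ‖ ^ 2) := fun φ => by
    refine le_of_eq_of_le (integral_congr_ae ?_) (integral_abs_interaction_le h1 h2 hg hM φ)
    filter_upwards [ae_fieldValue_eq φ] with x hx
    rw [hx]
  rw [integrable_prod_iff hm.aestronglyMeasurable]
  refine ⟨Eventually.of_forall fun ω => Integrable.fintype_prod
    (f := fun a x => g x * |fieldValue (ω (c a)) x| ^ α) fun a => hi _, ?_⟩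
  refine (integrable_prod_norm_sq hμ j hM0 measureReal_nonneg c
    (v := volume.real (box d L))).mono' ?_ (Eventually.of_forall fun ω => ?_)
  · exact hm.norm.stronglyMeasurable.integral_prod_right'.aestronglyMeasurable
  · have e : ∫ x : Fin n → Point d, ‖∏ a, (g (x a) * |copyValues c x ω a| ^ α)‖
        ∂Measure.pi (fun _ : Fin n => (volume : Measure (Point d)).restrict (box d L)) =
        ∏ a, ∫ x in box d L, |g x * |fieldValue (ω (c a)) x| ^ α| := by
      simp_rw [Real.norm_eq_abs, Finset.abs_prod]
      exact integral_fintype_prod_eq_prod (fun a x => |g x * |fieldValue (ω (c a)) x| ^ α|)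
    rw [e, Real.norm_eq_abs, abs_of_nonneg (Finset.prod_nonneg fun a _ =>
      integral_nonneg fun x => abs_nonneg _)]
    exact Finset.prod_le_prod (fun a _ => integral_nonneg fun x => abs_nonneg _) fun a _ => hb _

theorem prod_interaction_eq (g : Point d → ℝ) (α : ℝ) {n N : ℕ} (c : Fin n → Fin N)
    (ω : Fin N → FieldSpace d L) : ∏ a, interaction g α (ω (c a)) =
      ∫ x : Fin n → Point d, ∏ a, (g (x a) * |copyValues c x ω a| ^ α)
        ∂Measure.pi (fun _ : Fin n => (volume : Measure (Point d)).restrict (box d L)) := by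
  simp_rw [interaction_eq_fieldValue]
  exact (integral_fintype_prod_eq_prod (fun a x => g x * |fieldValue (ω (c a)) x| ^ α)).symm

/-- The tilted field has mean `-φ̄`; evenness of the averaged function makes the sign immaterial. -/
theorem gaussianAverage_neg {n : ℕ} (A : Matrix (Fin n) (Fin n) ℝ) (m : Fin n → ℝ)
    {f : (Fin n → ℝ) → ℝ} (hf : ∀ φ, f (-φ) = f φ) :
    ∫ φ, f φ ∂gaussLaw A (-m) = gaussianAverage A m f := by
  rw [gaussianAverage_eq_integral, ← integral_gaussLaw_comp_neg]
  simp_rw [hf]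

theorem integral_prod_copyValues (hG : IsPropagator L G) (hμ : IsGaussianField G μ)
    (j : FieldSpace d L) (g : Point d → ℝ) (α : ℝ) {n N : ℕ} {x : Fin n → Point d}
    (hx : ∀ a, x a ∈ openBox d L) (hinj : Function.Injective x) (c : Fin n → Fin N)
    (hlim : ∀ a, ∀ᵐ φ ∂sourceMeasure μ j,
      Tendsto (fun k => (inner ℝ (smear L k (x a)) φ : ℝ)) atTop (𝓝 (fieldValue φ (x a)))) :
    ∫ ω : Fin N → FieldSpace d L, ∏ a, (g (x a) * |copyValues c x ω a| ^ α)
      ∂Measure.pi (fun _ => sourceMeasure μ j) =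
    (∏ a, g (x a)) * gaussianAverage (blockMatrix G x c) (fun a => classicalField G j (x a))
      fun φ => ∏ a, |φ a| ^ α := by
  simp_rw [Finset.prod_mul_distrib]
  rw [integral_const_mul, ← gaussianAverage_neg _ _ (by simp), ← map_copyValues hG hμ j hx hinj c hlim,
    integral_map (measurable_copyValues_left c x).aemeasurable
    (Measurable.aestronglyMeasurable (by fun_prop))]

theorem ae_integral_prod_copyValues (hd : 0 < d) (hG : IsPropagator L G) (hμ : IsGaussianField G μ)
    (j : FieldSpace d L) (g : Point d → ℝ) (α : ℝ) {n N : ℕ} (c : Fin n → Fin N) :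
    ∀ᵐ x ∂(volume : Measure (Fin n → Point d)).restrict (configs d n L),
    ∫ ω : Fin N → FieldSpace d L, ∏ a, (g (x a) * |copyValues c x ω a| ^ α)
      ∂Measure.pi (fun _ => sourceMeasure μ j) =
    (∏ a, g (x a)) * gaussianAverage (blockMatrix G x c) (fun a => classicalField G j (x a))
      fun φ => ∏ a, |φ a| ^ α := by
  have := isProbabilityMeasure_sourceMeasure hμ j
  filter_upwards [ae_injective_configs hd n L, ae_configs_of_ae_box (ae_mem_openBox d L) n,
    ae_configs_of_ae_box (ae_ae_tendsto_fieldValue (sourceMeasure μ j)) n] with x h1 h2 h3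
  exact integral_prod_copyValues hG hμ j g α h2 h1 c h3

theorem integrableOn_gaussianAverage (hd : 0 < d) (h1 : 0 ≤ α) (h2 : α ≤ 2) (hg : Measurable g)
    (hM : ∀ x, |g x| ≤ M) (hG : IsPropagator L G) (hμ : IsGaussianField G μ)
    (j : FieldSpace d L) {n N : ℕ} (c : Fin n → Fin N) :
    IntegrableOn (fun x : Fin n → Point d => (∏ a, g (x a)) *
      gaussianAverage (blockMatrix G x c) (fun a => classicalField G j (x a))
      fun φ => ∏ a, |φ a| ^ α) (configs d n L) := by
  have := isProbabilityMeasure_sourceMeasure hμ j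
  have h := (integrable_prod_copyValues h1 h2 hg hM hμ j c).integral_prod_right
  rw [← volume_restrict_configs] at h
  exact h.congr (ae_integral_prod_copyValues hd hG hμ j g α c)

/-- Moments of independent copies of the interaction as integrals of Gaussian averages. -/
theorem integral_prod_interaction (hd : 0 < d) (h1 : 0 ≤ α) (h2 : α ≤ 2) (hg : Measurable g)
    (hM : ∀ x, |g x| ≤ M) (hG : IsPropagator L G) (hμ : IsGaussianField G μ)
    (j : FieldSpace d L) {n N : ℕ} (c : Fin n → Fin N) :
    ∫ ω : Fin N → FieldSpace d L, ∏ a, interaction g α (ω (c a))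
      ∂Measure.pi (fun _ => sourceMeasure μ j) =
    ∫ x in configs d n L, (∏ a, g (x a)) *
      gaussianAverage (blockMatrix G x c) (fun a => classicalField G j (x a))
      fun φ => ∏ a, |φ a| ^ α := by
  have := isProbabilityMeasure_sourceMeasure hμ j
  simp_rw [prod_interaction_eq]
  rw [integral_integral_swap (integrable_prod_copyValues h1 h2 hg hM hμ j c),
    ← volume_restrict_configs]
  exact integral_congr_ae (ae_integral_prod_copyValues hd hG hμ j g α c)

theorem integrable_prod_interaction (h1 : 0 ≤ α) (h2 : α ≤ 2) (hg : Measurable g)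
    (hM : ∀ x, |g x| ≤ M) (hμ : IsGaussianField G μ)
    (j : FieldSpace d L) {n N : ℕ} (c : Fin n → Fin N) :
    Integrable (fun ω : Fin N → FieldSpace d L => ∏ a, interaction g α (ω (c a)))
      (Measure.pi fun _ => sourceMeasure μ j) := by
  have := isProbabilityMeasure_sourceMeasure hμ j
  simp_rw [prod_interaction_eq]
  exact (integrable_prod_copyValues h1 h2 hg hM hμ j c).integral_prod_left

end

end LegendreQFT

end

noncomputable section

namespace LegendreQFT

/-! ### The connected generating functional as a cumulant generating function -/

open Filter Topology ProbabilityTheory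

variable {d : ℕ} {L : ℝ} {α : ℝ} {g : Point d → ℝ} {M : ℝ} {G : Point d → ℝ}
  {μ : Measure (FieldSpace d L)} [IsProbabilityMeasure μ]

/-- Dividing by `Z₀` is the normalization of the tilted measure, so the quotient is a moment
generating function. -/
theorem connectedFunctional_eq_cgf (g : Point d → ℝ) (α : ℝ)
    (μ : Measure (FieldSpace d L)) (j : FieldSpace d L) :
    connectedFunctional μ α g j = cgf (fun φ => -interaction g α φ) (sourceMeasure μ j) := by
  funext t
  rw [connectedFunctional, cgf, mgf, sourceMeasure, integral_tilted]
  congr 1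
  have h : ∀ t, generatingFunctional μ α g j t =
      ∫ φ, Real.exp (-inner ℝ j φ) * Real.exp (t * -interaction g α φ) ∂μ := by
    intro t
    refine integral_congr_ae (Eventually.of_forall fun φ => ?_)
    simp only
    rw [← Real.exp_add, inner_fieldSpace, interaction]
    congr 1
    ring
  rw [h, h, ← integral_div]
  refine integral_congr_ae (Eventually.of_forall fun φ => ?_)
  simp only [zero_mul, Real.exp_zero, mul_one, smul_eq_mul]
  ring

theorem exists_integrable_exp_interaction (h1 : 0 ≤ α) (h2 : α ≤ 2) (hg : Measurable g)
    (hM : ∀ x, |g x| ≤ M) (hμ : IsGaussianField G μ) (j : FieldSpace d L) :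
    ∃ δ > 0, ∀ t, |t| < δ →
      Integrable (fun φ => Real.exp (t * -interaction g α φ)) (sourceMeasure μ j) := by
  obtain ⟨ε, hε, h⟩ := exists_integrable_exp_sourceMeasure hμ j
  have hM0 : 0 ≤ M := (abs_nonneg _).trans (hM 0)
  refine ⟨ε / (M + 1), by positivity, fun t ht => ?_⟩
  refine (h.const_mul (Real.exp (ε * volume.real (box d L)))).mono' ?_
    (Eventually.of_forall fun φ => ?_)
  · exact (((measurable_interaction hg α).neg.const_mul t).exp).aestronglyMeasurable
  · rw [Real.norm_eq_abs, Real.abs_exp, ← Real.exp_add, Real.exp_le_exp, ← mul_add]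
    have hv : 0 ≤ volume.real (box d L) + ‖φ‖ ^ 2 := by positivity
    have htM : |t| * M ≤ ε := by
      rw [lt_div_iff₀ (by positivity)] at ht
      nlinarith [abs_nonneg t]
    calc t * -interaction g α φ ≤ |t| * |interaction g α φ| := by
          rw [← abs_neg (interaction g α φ), ← abs_mul]; exact le_abs_self _
      _ ≤ |t| * (M * (volume.real (box d L) + ‖φ‖ ^ 2)) :=
          mul_le_mul_of_nonneg_left (abs_interaction_le h1 h2 hg hM φ) (abs_nonneg _)
      _ = |t| * M * (volume.real (box d L) + ‖φ‖ ^ 2) := by ring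
      _ ≤ _ := mul_le_mul_of_nonneg_right htM hv

theorem mem_interior_of_forall_abs_lt {s : Set ℝ} {δ : ℝ} (hδ : 0 < δ)
    (h : ∀ t, |t| < δ → t ∈ s) : (0 : ℝ) ∈ interior s :=
  mem_interior_iff_mem_nhds.2 (Metric.mem_nhds_iff.2
    ⟨δ, hδ, fun t ht => h t (by simpa [Real.dist_eq] using ht)⟩)

theorem analyticAt_cgf_interaction (h1 : 0 ≤ α) (h2 : α ≤ 2) (hg : Measurable g)
    (hM : ∀ x, |g x| ≤ M) (hμ : IsGaussianField G μ) (j : FieldSpace d L) :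
    AnalyticAt ℝ (cgf (fun φ => -interaction g α φ) (sourceMeasure μ j)) 0 := by
  obtain ⟨δ, hδ, h⟩ := exists_integrable_exp_interaction h1 h2 hg hM hμ j
  exact analyticAt_cgf (mem_interior_of_forall_abs_lt hδ h)

/-- `exp (N K)` is the moment generating function of the sum over `N` independent copies. Its `n`-th
derivative at `0` is the `n`-th moment of that sum, and multiplying out the power assigns a copy to
each of the `n` factors, that is, a colouring. -/
theorem iteratedDeriv_exp_mul_cgf (h1 : 0 ≤ α) (h2 : α ≤ 2) (hg : Measurable g)
    (hM : ∀ x, |g x| ≤ M) (hμ : IsGaussianField G μ) (j : FieldSpace d L) (n N : ℕ) :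
    iteratedDeriv n (fun t => Real.exp (N *
      cgf (fun φ => -interaction g α φ) (sourceMeasure μ j) t)) 0 =
    (-1) ^ n * ∑ c : Fin n → Fin N, ∫ ω : Fin N → FieldSpace d L,
      ∏ a, interaction g α (ω (c a)) ∂Measure.pi (fun _ => sourceMeasure μ j) := by
  have := isProbabilityMeasure_sourceMeasure hμ j
  obtain ⟨δ, hδ, h⟩ := exists_integrable_exp_interaction h1 h2 hg hM hμ j
  set P := Measure.pi fun _ : Fin N => sourceMeasure μ j
  set S : (Fin N → FieldSpace d L) → ℝ := fun ω => ∑ l, -interaction g α (ω l)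
  have hexp : ∀ t ω, Real.exp (t * S ω) = ∏ l, Real.exp (t * -interaction g α (ω l)) := by
    intro t ω
    rw [← Real.exp_sum, ← Finset.mul_sum]
  have hint : ∀ t, |t| < δ → Integrable (fun ω => Real.exp (t * S ω)) P := by
    intro t ht
    simp_rw [hexp]
    exact Integrable.fintype_prod (f := fun _ φ => Real.exp (t * -interaction g α φ))
      fun _ => h t ht
  have hmgf : (fun t => Real.exp (N * cgf (fun φ => -interaction g α φ) (sourceMeasure μ j) t))
      =ᶠ[𝓝 0] mgf S P := by
    filter_upwards [Metric.ball_mem_nhds 0 hδ] with t ht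
    have ht' : |t| < δ := by simpa [Real.dist_eq] using ht
    rw [Real.exp_nat_mul, exp_cgf (h t ht'), mgf, mgf]
    simp_rw [hexp]
    rw [integral_fintype_prod_eq_prod (fun _ φ => Real.exp (t * -interaction g α φ))]
    simp
  rw [hmgf.iteratedDeriv_eq, iteratedDeriv_mgf_zero (mem_interior_of_forall_abs_lt hδ hint)]
  have hpow : ∀ ω, (S ^ n) ω = ∑ c : Fin n → Fin N,
      (-1) ^ n * ∏ a, interaction g α (ω (c a)) := by
    intro ω
    have h3 := Finset.prod_univ_sum (fun _ : Fin n => (Finset.univ : Finset (Fin N)))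
      (fun _ l => -interaction g α (ω l))
    rw [Finset.prod_const, Finset.card_univ, Fintype.card_fin, Fintype.piFinset_univ] at h3
    rw [Pi.pow_apply, h3]
    refine Finset.sum_congr rfl fun c _ => ?_
    rw [Finset.prod_neg, Finset.card_univ, Fintype.card_fin]
  simp_rw [hpow]
  rw [integral_finsetSum _ fun c _ =>
    (integrable_prod_interaction h1 h2 hg hM hμ j c).const_mul _, Finset.mul_sum]
  exact Finset.sum_congr rfl fun c _ => integral_const_mul _ _

/-- The connected term of order `n` through moments of independent copies. -/
theorem iteratedDeriv_connectedFunctional (h1 : 0 ≤ α) (h2 : α ≤ 2) (hg : Measurable g)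
    (hM : ∀ x, |g x| ≤ M) (hμ : IsGaussianField G μ) (j : FieldSpace d L) {n : ℕ} (hn : n ≠ 0) :
    iteratedDeriv n (connectedFunctional μ α g j) 0 = (-1) ^ n *
      ∑ N ∈ Finset.range (n + 1), linearWeight n N *
        ∑ c : Fin n → Fin N, ∫ ω : Fin N → FieldSpace d L,
          ∏ a, interaction g α (ω (c a)) ∂Measure.pi (fun _ => sourceMeasure μ j) := by
  have := isProbabilityMeasure_sourceMeasure hμ j
  rw [connectedFunctional_eq_cgf]
  obtain ⟨p, hp1, -, hp2, hp3⟩ := exists_polynomial_iteratedDeriv_exp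
    (analyticAt_cgf_interaction h1 h2 hg hM hμ j) (by simp) n
  -- The polynomial is sampled at `0, …, n` with the same weights that occur in the sum over
  -- connected graphs.
  rw [← hp2 hn, ← sum_linearWeight hp1, Finset.mul_sum]
  refine Finset.sum_congr rfl fun N _ => ?_
  rw [← hp3, iteratedDeriv_exp_mul_cgf h1 h2 hg hM hμ j]
  ring

end LegendreQFT

end

noncomputable section

namespace LegendreQFT

/-! ### Bounds and measurability of Gaussian averages -/

theorem integral_gaussLaw_shift {n : ℕ} (A : Matrix (Fin n) (Fin n) ℝ) (m : Fin n → ℝ)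
    (f : (Fin n → ℝ) → ℝ) : ∫ φ, f φ ∂gaussLaw A m = ∫ φ, f (φ + m) ∂gaussLaw A 0 := by
  rw [integral_gaussLaw, integral_gaussLaw,
    ← integral_add_right_eq_self (fun φ => gaussDensity A m φ • f φ) m]
  simp [gaussDensity]

theorem quad_add_le {n : ℕ} {A : Matrix (Fin n) (Fin n) ℝ} (hA : A.PosDef) (φ m : Fin n → ℝ) :
    quad A (φ + m) ≤ 2 * quad A φ + 2 * quad A m := by
  have hs := PosDef.isSymm hA
  have h1 := quad_sub hs φ m
  have h2 := quad_sub hs φ (-m)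
  rw [sub_neg_eq_add, quad_neg, mulVec_neg, neg_dotProduct] at h2
  have := quad_nonneg hA (φ - m)
  linarith

theorem integrable_quad_pow {n : ℕ} {A : Matrix (Fin n) (Fin n) ℝ} (hA : A.PosDef) (k : ℕ) :
    Integrable (fun φ => quad A φ ^ k) (gaussLaw A 0) := by
  obtain ⟨K, hK, h⟩ := exists_quad_le A
  refine integrable_gaussLaw_of_le hA 0 ((continuous_quad A).measurable.pow_const k)
    (C := K ^ k) (N := 2 * k) fun φ => ?_
  have hq := quad_nonneg hA φ
  rw [abs_of_nonneg (pow_nonneg hq k)]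
  calc quad A φ ^ k ≤ (K * (1 + ‖φ‖) ^ 2) ^ k := by
        refine pow_le_pow_left₀ hq ((h φ).trans ?_) k
        gcongr
        linarith
    _ = _ := by rw [mul_pow, ← pow_mul]

/-- These moments depend on `n` and `k` only, which makes bounds uniform in the covariance matrix.
-/
theorem integral_quad_pow {n : ℕ} (hn : 0 < n) {A : Matrix (Fin n) (Fin n) ℝ} (hA : A.PosDef)
    (k : ℕ) : ∫ φ, quad A φ ^ k ∂gaussLaw A 0 =
      Real.Gamma (n / 2 + k) / Real.Gamma (n / 2) := by
  have := isProbabilityMeasure_gaussLaw hA 0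
  have hn' : (0 : ℝ) < n := by exact_mod_cast hn
  have h := integral_mul_quad_rpow hn hA (F := fun _ => 1) (D := 0) (by simp) (s := k)
    (by positivity) (by simpa using integrable_quad_pow hA k) (integrable_const 1)
  simpa using h

/-- After centring, `Q(φ + m) ≤ 2 Q(φ) + 2 R` bounds the interaction by a polynomial in `Q(φ)`,
whose average is the same for all `A`. So `A` may come arbitrarily close to being singular. -/
theorem exists_gaussianAverage_approxInteraction_le {n : ℕ} (hn : 0 < n) {c : ℝ} (hc : 0 < c)
    {α : ℝ} (hα : 0 ≤ α) (N : ℕ) (R : ℝ) :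
    ∃ C, ∀ A : Matrix (Fin n) (Fin n) ℝ, A.PosDef → (∀ a, A a a = c) → ∀ m, quad A m ≤ R →
      |gaussianAverage A m (approxInteraction c α N A)| ≤ C := by
  set S := ∑ q ∈ Finset.range (N + 1), |legendreCoeff α q|
  have hS : 0 ≤ S := Finset.sum_nonneg fun q _ => abs_nonneg _
  set k := ⌈(n * α / 2 : ℝ)⌉₊
  refine ⟨S * (2 ^ (k - 1) * ((1 + 4 * c * R) ^ k +
    (4 * c) ^ k * (Real.Gamma (n / 2 + k) / Real.Gamma (n / 2)))), fun A hA hd m hm => ?_⟩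
  have := isProbabilityMeasure_gaussLaw hA 0
  have hR : 0 ≤ R := (quad_nonneg hA m).trans hm
  rw [gaussianAverage_eq_integral, integral_gaussLaw_shift]
  refine (abs_integral_le_integral_abs).trans ?_
  have hint : Integrable (fun φ => S * (2 ^ (k - 1) * ((1 + 4 * c * R) ^ k +
      (4 * c) ^ k * quad A φ ^ k))) (gaussLaw A 0) :=
    (((integrable_const _).add ((integrable_quad_pow hA k).const_mul _)).const_mul _).const_mul _
  calc ∫ φ, |approxInteraction c α N A (φ + m)| ∂gaussLaw A 0
      ≤ ∫ φ, S * (2 ^ (k - 1) * ((1 + 4 * c * R) ^ k + (4 * c) ^ k * quad A φ ^ k))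
        ∂gaussLaw A 0 := by
        refine integral_mono_of_nonneg (Filter.Eventually.of_forall fun φ => abs_nonneg _) hint
          (Filter.Eventually.of_forall fun φ => ?_)
        refine (abs_approxInteraction_le hc α N hA hd (φ + m)).trans
          (mul_le_mul_of_nonneg_left ?_ hS)
        have hq := quad_nonneg hA φ
        have hq' := quad_nonneg hA (φ + m)
        have h1 : 2 * c * quad A (φ + m) ≤ (1 + 4 * c * R) + 4 * c * quad A φ := by
          have := quad_add_le hA φ m
          have h3 : 2 * c * quad A (φ + m) ≤ 2 * c * (2 * quad A φ + 2 * R) :=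
            mul_le_mul_of_nonneg_left (by linarith) (by positivity)
          linarith
        have h2 : 1 ≤ (1 + 4 * c * R) + 4 * c * quad A φ := by
          have h4 : 0 ≤ 4 * c * R := by positivity
          have h5 : 0 ≤ 4 * c * quad A φ := by positivity
          linarith
        calc (2 * c * quad A (φ + m)) ^ (n * α / 2 : ℝ)
            ≤ ((1 + 4 * c * R) + 4 * c * quad A φ) ^ (n * α / 2 : ℝ) :=
              Real.rpow_le_rpow (by positivity) h1 (by positivity)
          _ ≤ ((1 + 4 * c * R) + 4 * c * quad A φ) ^ (k : ℝ) :=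
              Real.rpow_le_rpow_of_exponent_le h2 (Nat.le_ceil _)
          _ ≤ _ := by
              rw [Real.rpow_natCast, ← mul_pow]
              exact add_pow_le (by positivity) (by positivity) k
    _ = _ := by
        rw [integral_const_mul, integral_const_mul, integral_add (integrable_const _)
          ((integrable_quad_pow hA k).const_mul _), integral_const_mul, integral_quad_pow hn hA]
        simp

section Measurability

variable {β : Type*} [MeasurableSpace β] {n : ℕ} {A : β → Matrix (Fin n) (Fin n) ℝ}

theorem measurable_det (hA : ∀ a b, Measurable fun x => A x a b) :
    Measurable fun x => (A x).det := by
  simp only [det_apply, Units.smul_def, zsmul_eq_mul]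
  exact Finset.measurable_fun_sum _ fun σ _ =>
    (Finset.measurable_fun_prod _ fun i _ => hA _ _).const_mul _

/-- Cramer's formula covers singular matrices too, where the inverse determinant is zero by
convention. -/
theorem measurable_inv_apply (hA : ∀ a b, Measurable fun x => A x a b) (a b : Fin n) :
    Measurable fun x => (A x)⁻¹ a b := by
  simp only [inv_def, Matrix.smul_apply, smul_eq_mul, Ring.inverse_eq_inv', adjugate_apply]
  refine (measurable_det hA).inv.mul (measurable_det fun i k => ?_)
  by_cases h : i = b
  · subst h
    simp only [updateRow_self]
    exact measurable_const
  · simp only [updateRow_ne h]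
    exact hA i k

theorem measurable_quad_comp (hA : ∀ a b, Measurable fun x => A x a b) {γ : Type*}
    [MeasurableSpace γ] {u : γ → β} (hu : Measurable u) {v : γ → Fin n → ℝ} (hv : Measurable v) :
    Measurable fun y => quad (A (u y)) (v y) := by
  have h1 := fun a b => (measurable_inv_apply hA a b).comp hu
  have h2 : ∀ a, Measurable fun y => v y a := fun a => (measurable_pi_apply a).comp hv
  exact (Finset.measurable_fun_sum _ fun a _ => Finset.measurable_fun_sum _ fun b _ =>
    ((h1 a b).mul (h2 a)).mul (h2 b)).const_mul _

theorem measurable_gaussianAverage_approxInteraction (hA : ∀ a b, Measurable fun x => A x a b)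
    {m : β → Fin n → ℝ} (hm : Measurable m) (c α : ℝ) (N : ℕ) :
    Measurable fun x => gaussianAverage (A x) (m x) (approxInteraction c α N (A x)) := by
  have h1 : Measurable fun p : β × (Fin n → ℝ) => quad (A p.1) p.2 :=
    measurable_quad_comp hA measurable_fst measurable_snd
  have h2 : Measurable fun p : β × (Fin n → ℝ) => quad (A p.1) (p.2 - m p.1) :=
    measurable_quad_comp hA measurable_fst (measurable_snd.sub (hm.comp measurable_fst))
  have h3 : Measurable fun p : β × (Fin n → ℝ) => approxInteraction c α N (A p.1) p.2 := by
    refine ((h1.const_mul _).pow_const _).mul ?_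
    refine Finset.measurable_fun_sum _ fun q _ => Measurable.const_mul ?_ _
    refine (legendrePoly (2 * q)).continuous.measurable.comp ?_
    refine Measurable.div ?_ ((h1.const_mul _).pow_const _)
    fun_prop
  refine Measurable.mul ?_ ?_
  · exact measurable_const.div ((measurable_det hA).const_mul _).sqrt
  · exact (h3.mul h2.neg.exp).stronglyMeasurable.integral_prod_right'.measurable

end Measurability

instance (d n : ℕ) (L : ℝ) :
    IsFiniteMeasure ((volume : Measure (Fin n → Point d)).restrict (configs d n L)) := by
  rw [volume_restrict_configs]
  infer_instance

theorem continuous_blockMatrix_apply {d n N : ℕ} {G : Point d → ℝ} (hG : Continuous G)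
    (c : Fin n → Fin N) (a b : Fin n) :
    Continuous fun x : Fin n → Point d => blockMatrix G x c a b := by
  simp only [blockMatrix, of_apply]
  split_ifs
  · fun_prop
  · exact continuous_const

/-- The approximated interaction depends on the covariance matrix and thus on the configuration, so
it does not come from a functional of the field to which Fubini's theorem applies. Instead the
uniform bound is used, with `quad_classicalField_le` controlling the mean. -/
theorem integrableOn_gaussianAverage_approxInteraction {d n N : ℕ} {L : ℝ} {α : ℝ}
    {g G : Point d → ℝ} {M : ℝ} {μ : Measure (FieldSpace d L)} [IsProbabilityMeasure μ]
    (hd : 0 < d) (hn : 0 < n) (hα : 0 ≤ α) (hg : Measurable g)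
    (hM : ∀ x, |g x| ≤ M) (hG0 : 0 < G 0) (hG : IsPropagator L G) (hμ : IsGaussianField G μ)
    (j : FieldSpace d L) (c : Fin n → Fin N) (K : ℕ) :
    IntegrableOn (fun x : Fin n → Point d => (∏ a, g (x a)) *
      gaussianAverage (blockMatrix G x c) (fun a => classicalField G j (x a))
      (approxInteraction (G 0) α K (blockMatrix G x c))) (configs d n L) := by
  obtain ⟨C, hC⟩ := exists_gaussianAverage_approxInteraction_le hn hG0 hα K
    (N * covForm G j j / 2)
  have hcf : Measurable fun x : Fin n → Point d => fun a => classicalField G j (x a) :=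
    measurable_pi_lambda _ fun a =>
      (continuous_classicalField hG.continuous j).measurable.comp (measurable_pi_apply a)
  refine Integrable.mono' (integrable_const (M ^ n * C)) (Measurable.aestronglyMeasurable
    (Measurable.mul ?_ (measurable_gaussianAverage_approxInteraction (fun a b =>
      (continuous_blockMatrix_apply hG.continuous c a b).measurable) hcf _ _ _))) ?_
  · exact Finset.measurable_fun_prod _ fun a _ => hg.comp (measurable_pi_apply a)
  · filter_upwards [ae_injective_configs hd n L,
      ae_configs_of_ae_box (ae_mem_openBox d L) n] with x h1 h2
    rw [Real.norm_eq_abs, abs_mul, Finset.abs_prod]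
    refine mul_le_mul ?_ (hC _ (posDef_blockMatrix hG
      (fun a _ => openBox_subset_box d L (h2 a)) h1 c) (blockMatrix_diag G x c) _
      (quad_classicalField_le hG hμ j h2 h1 c)) (abs_nonneg _)
      (pow_nonneg ((abs_nonneg _).trans (hM 0)) _)
    calc ∏ a, |g (x a)| ≤ ∏ _a : Fin n, M :=
          Finset.prod_le_prod (fun a _ => abs_nonneg _) fun a _ => hM _
      _ = M ^ n := by simp

end LegendreQFT

end

noncomputable section

namespace LegendreQFT

/-! ### The graph expansion -/

section

variable {d n : ℕ} {L : ℝ} {G g : Point d → ℝ} {j : FieldSpace d L}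

/-- Valid for arbitrary `F`: only block matrices survive the sum over graphs, so whatever value `F`
takes at matrices that are not positive definite cancels. -/
theorem graphSum_eq (F : Matrix (Fin n) (Fin n) ℝ → (Fin n → ℝ) → ℝ) :
    graphSum G g j F = (-1) ^ n / n.factorial *
      ∑ N ∈ Finset.range (n + 1), linearWeight n N * ∑ c : Fin n → Fin N,
        ∫ x in configs d n L, (∏ a, g (x a)) *
          F (blockMatrix G x c) (fun a => classicalField G j (x a)) := by
  rw [graphSum, sum_connected_graphOp G fun A => ∫ x in configs d n L, (∏ a, g (x a)) *
    F (A x) (fun a => classicalField G j (x a))]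

theorem graphIntegrand_eq (F : Matrix (Fin n) (Fin n) ℝ → (Fin n → ℝ) → ℝ) (x : Fin n → Point d) :
    graphIntegrand G g j F x =
      ∑ N ∈ Finset.range (n + 1), linearWeight n N * ∑ c : Fin n → Fin N, (∏ a, g (x a)) *
          F (blockMatrix G x c) (fun a => classicalField G j (x a)) := by
  rw [graphIntegrand, sum_connected_graphOp G fun A =>
    F (A x) (fun a => classicalField G j (x a)), Finset.mul_sum]
  refine Finset.sum_congr rfl fun N _ => ?_
  rw [← Finset.mul_sum, mul_left_comm]

theorem integrableOn_graphIntegrand {F : Matrix (Fin n) (Fin n) ℝ → (Fin n → ℝ) → ℝ}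
    (h : ∀ (N : ℕ) (c : Fin n → Fin N), IntegrableOn (fun x => (∏ a, g (x a)) *
      F (blockMatrix G x c) (fun a => classicalField G j (x a))) (configs d n L)) :
    IntegrableOn (graphIntegrand G g j F) (configs d n L) := by
  have e : graphIntegrand G g j F = fun x =>
      ∑ N ∈ Finset.range (n + 1), linearWeight n N * ∑ c : Fin n → Fin N, (∏ a, g (x a)) *
        F (blockMatrix G x c) (fun a => classicalField G j (x a)) :=
    funext fun x => graphIntegrand_eq F x
  rw [e]
  exact integrable_finsetSum _ fun N _ =>
    (integrable_finsetSum _ fun c _ => h N c).const_mul _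

/-- Two functions of covariance matrix and mean that agree at nondegenerate covariance matrices
give the same integrands at almost all configurations. -/
theorem ae_block_eq (hd : 0 < d) (hG : IsPropagator L G)
    {F F' : Matrix (Fin n) (Fin n) ℝ → (Fin n → ℝ) → ℝ}
    (h : ∀ A : Matrix (Fin n) (Fin n) ℝ, A.PosDef → (∀ a, A a a = G 0) → ∀ m, F A m = F' A m)
    {N : ℕ} (c : Fin n → Fin N) :
    (fun x => (∏ a, g (x a)) * F (blockMatrix G x c) (fun a => classicalField G j (x a)))
      =ᵐ[(volume : Measure (Fin n → Point d)).restrict (configs d n L)]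
    fun x => (∏ a, g (x a)) * F' (blockMatrix G x c) (fun a => classicalField G j (x a)) := by
  filter_upwards [ae_injective_configs hd n L,
    ae_configs_of_ae_box (ae_mem_box d L) n] with x h1 h2
  rw [h _ (posDef_blockMatrix hG (fun a _ => h2 a) h1 c) (blockMatrix_diag G x c)]

theorem graphSum_congr (hd : 0 < d) (hG : IsPropagator L G)
    {F F' : Matrix (Fin n) (Fin n) ℝ → (Fin n → ℝ) → ℝ}
    (h : ∀ A : Matrix (Fin n) (Fin n) ℝ, A.PosDef → (∀ a, A a a = G 0) → ∀ m, F A m = F' A m) :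
    graphSum G g j F = graphSum G g j F' := by
  simp_rw [graphSum_eq]
  congr 1
  refine Finset.sum_congr rfl fun N _ => ?_
  congr 1
  exact Finset.sum_congr rfl fun c _ => integral_congr_ae (ae_block_eq hd hG h c)

end

/-- The one-point configuration at the origin, which lies in the box since `0 < L`. -/
theorem IsPropagator.zero_pos {d : ℕ} {L : ℝ} (hL : 0 < L) {G : Point d → ℝ}
    (hG : IsPropagator L G) : 0 < G 0 := by
  have h := hG.posDef 1 (fun _ _ => 0)
    (fun _ _ _ _ => ⟨by simp only; linarith, by simp only; linarith⟩)
    (Function.injective_of_subsingleton _)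
  have h0 := h.diag_pos (i := 0)
  simpa using h0

end LegendreQFT

end

/-! ### Assembly of the theorem -/

open MeasureTheory LegendreQFT
theorem mainTheorem5 {d : ℕ} (hd : 0 < d) {L : ℝ} (hL : 0 < L) {α : ℝ} (hα₁ : 1 ≤ α)
    (hα₂ : α ≤ 2) {G : Point d → ℝ} (hG : IsPropagator L G)
    (μ : Measure (FieldSpace d L)) [IsProbabilityMeasure μ] (hμ : IsGaussianField G μ)
    {g : Point d → ℝ} (hg : Measurable g) (hgb : ∃ M, ∀ x, |g x| ≤ M)
    (j : FieldSpace d L) (n : ℕ) (hn : 1 ≤ n) :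
    -- the Gaussian integrals and their explicit series, at every nondegenerate configuration
    (∀ (x : Fin n → Point d) (Γ : SimpleGraph (Fin n)) (s : SVars n),
      (gTilde G x Γ s).PosDef → ∀ m : Fin n → ℝ,
        ((∀ k, ∀ ν ∈ Finset.piAntidiag (Finset.univ : Finset (Fin n)) (2 * k),
            Summable (qTerm (G 0) α (gTilde G x Γ s) k ν)) ∧
          Summable (kTerm (G 0) α (gTilde G x Γ s) m (qSum (G 0) α (gTilde G x Γ s))) ∧
          gaussianAverage (gTilde G x Γ s) m (fun φ => ∏ a, |φ a| ^ α) =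
            legendreSeries (G 0) α (gTilde G x Γ s) m) ∧
        ∀ N : ℕ,
          Summable (kTerm (G 0) α (gTilde G x Γ s) m
            (qPartialSum (G 0) α (gTilde G x Γ s) N)) ∧
          gaussianAverage (gTilde G x Γ s) m (approxInteraction (G 0) α N (gTilde G x Γ s)) =
            approxSeries (G 0) α N (gTilde G x Γ s) m) ∧
    -- where `G̃` is nondegenerate for all `s`, the operator is the literal one
    (∀ (x : Fin n → Point d) (Γ : SimpleGraph (Fin n)),
      (∀ s : SVars n, (∀ e, s e ∈ Set.Icc (0 : ℝ) 1) → (gTilde G x Γ s).PosDef) →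
        ∀ m : Fin n → ℝ,
          literalOp Γ (fun s => legendreSeries (G 0) α (gTilde G x Γ s) m) =
            graphOp Γ (fun s => legendreSeries (G 0) α (gTilde G x Γ s) m) ∧
          ∀ N : ℕ, literalOp Γ (fun s => approxSeries (G 0) α N (gTilde G x Γ s) m) =
            graphOp Γ (fun s => approxSeries (G 0) α N (gTilde G x Γ s) m)) ∧
    -- the formula for the term of order `n` of the connected generating functional
    AnalyticAt ℝ (connectedFunctional μ α g j) 0 ∧
    IntegrableOn (graphIntegrand (n := n) G g j (legendreSeries (G 0) α)) (configs d n L) ∧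
    connectedTerm μ α g j n = graphSum (n := n) G g j (legendreSeries (G 0) α) ∧
    -- the formula for its polynomial approximations
    ∀ N : ℕ,
      IntegrableOn (graphIntegrand (n := n) G g j (approxSeries (G 0) α N)) (configs d n L) ∧
      connectedTermApprox G α g j n N = graphSum (n := n) G g j (approxSeries (G 0) α N) := by
  have hn0 : 0 < n := hn
  have hα : 0 < α := by linarith
  have hG0 : 0 < G 0 := hG.zero_pos hL
  obtain ⟨M, hM⟩ := hgb
  have hser : ∀ A : Matrix (Fin n) (Fin n) ℝ, A.PosDef → (∀ a, A a a = G 0) → ∀ m,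
      (gaussianAverage A m fun φ => ∏ a, |φ a| ^ α) = legendreSeries (G 0) α A m :=
    fun A hA hdg m => (legendreSeries_spec hn0 hG0 hα₁ hα₂ hA hdg m).2.2
  have happ : ∀ K, ∀ A : Matrix (Fin n) (Fin n) ℝ, A.PosDef → (∀ a, A a a = G 0) → ∀ m,
      gaussianAverage A m (approxInteraction (G 0) α K A) = approxSeries (G 0) α K A m :=
    fun K A hA hdg m => (approxSeries_spec hn0 hG0 hα hA hdg m K).2
  refine ⟨fun x Γ s hA m => ⟨legendreSeries_spec hn0 hG0 hα₁ hα₂ hA (gTilde_diag G x Γ s) m,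
    fun K => approxSeries_spec hn0 hG0 hα hA (gTilde_diag G x Γ s) m K⟩,
    fun x Γ hpd m => ⟨?_, fun K => ?_⟩, ?_, ?_, ?_, fun K => ⟨?_, ?_⟩⟩
  · exact literalOp_eq_graphOp_of_contDiffAt hG.even hpd
      (F := fun A => legendreSeries (G 0) α A m) fun A τ₀ hA hs hdg h0 =>
        contDiffAt_legendreSeries hn0 hG0 hα₁ hα₂ hA hs hdg h0 m
  · exact literalOp_eq_graphOp_of_contDiffAt hG.even hpd
      (F := fun A => approxSeries (G 0) α K A m) fun A τ₀ hA hs hdg h0 =>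
        contDiffAt_approxSeries hn0 hG0 hα hA hs hdg h0 m K
  · rw [connectedFunctional_eq_cgf]
    exact analyticAt_cgf_interaction hα.le hα₂ hg hM hμ j
  · exact integrableOn_graphIntegrand fun N c =>
      (integrableOn_gaussianAverage hd hα.le hα₂ hg hM hG hμ j c).congr
        (ae_block_eq hd hG (F := fun A m => gaussianAverage A m fun φ => ∏ a, |φ a| ^ α) hser c)
  -- Once the series is replaced by the Gaussian average, both sides are sums over colourings with
  -- the same weights, and the moments of the copies are the coordinate integrals.
  · rw [connectedTerm, iteratedDeriv_connectedFunctional hα.le hα₂ hg hM hμ j hn0.ne',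
      ← graphSum_congr hd hG (F := fun A m => gaussianAverage A m fun φ => ∏ a, |φ a| ^ α) hser,
      graphSum_eq]
    simp_rw [integral_prod_interaction hd hα.le hα₂ hg hM hG hμ j]
    ring
  · exact integrableOn_graphIntegrand fun N c =>
      (integrableOn_gaussianAverage_approxInteraction hd hn0 hα.le hg hM hG0 hG hμ j c K).congr
        (ae_block_eq hd hG
          (F := fun A m => gaussianAverage A m (approxInteraction (G 0) α K A)) (happ K) c)
  · exact graphSum_congr hd hG
      (F := fun A m => gaussianAverage A m (approxInteraction (G 0) α K A)) (happ K)
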